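/- Let $T>0$, $I=(0,T)$, and $W_T=\{y\in L^2(I;\mathbb R^n): \dot y\in L^2(I;\mathbb R^n)\}$ (distributional derivative) with norm $(\|y\|_{L^2}^2+\|\dot y\|_{L^2}^2)^{1/2}$; elements of $W_T$ are identified with their continuous representatives on $[0,T]$. Let $f:[0,T]\times\mathbb R^n\to\mathbb R^n$ and $g:[0,T]\times\mathbb R^n\to\mathbb R^{n\times m}$ be twice continuously differentiable, let $\mathcal R$ be a finite-dimensional real Hilbert space, and let $(\theta,t,y)\mapsto V_\theta(t,y)\in\mathbb R$ be of class $C^4$ on $\mathcal R\times\mathbb R\times\mathbb R^n$. Let $Q_1,Q_2\in\mathbb R^{n\times n}$, $y_d\in L^2(I;\mathbb R^n)$, $y_d^T\in\mathbb R^n$, $\beta,\gamma_\varepsilon>0$, $\gamma_1,\gamma_2\ge 0$, initial values $y_0^1,\dots,y_0^N\in\mathbb R^n$ and weights $\omega_1,\dots,\omega_N>0$ be given. Set $$F_\theta(t,y)=-\tfrac1\beta g(t,y)^\top\partial_yV_\theta(t,y),\qquad A_\theta(t,y)=D_yf(t,y)^\top+[D_yg(t,y)^\top F_\theta(t,y)],$$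 i.e. $A_\theta(t,y)^\top h=D_yf(t,y)h+[D_yg(t,y)h]F_\theta(t,y)$. For $y,p\in W_T$ and $t\in[0,T]$ put $$J_t(y,\theta)=\tfrac12\int_t^T\big(|Q_1(y-y_d)|^2+\beta|F_\theta(s,y(s))|^2\big)\,ds+\tfrac12|Q_2(y(T)-y_d^T)|^2,\qquad r_{\theta,y}(t)=V_\theta(t,y(t))-J_t(y,\theta),$$ $$J_\varepsilon(y,p,\theta)=J_0(y,\theta)+\int_0^T\Big(\tfrac{\gamma_1}2|r_{\theta,y}(t)|^2+\tfrac{\gamma_2}2|\partial_yV_\theta(t,y(t))-p(t)|^2\Big)dt .$$ For each $i$ and $\theta$, consider the state and adjoint equations for $(y,p)\in W_T\times W_T$ (a.e. in $I$) $$\dot y=f(t,y)+g(t,y)F_\theta(t,y),\ \ y(0)=y_0^i;\qquad -\dot p=A_\theta(t,y)p+Q_1^\top Q_1(y-y_d),\ \ p(T)=Q_2^\top Q_2(y(T)-y_d^T).\tag{S$_i$}$$ Let $\tilde\theta\in\mathcal R$ be admissible, i.e. let $(\tilde y_i,\tilde p_i)$ solve (S$_i$) with $\theta=\tilde\theta$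 for every $i=1,\dots,N$. **(a)** There exist an open neighbourhood $U$ of $\tilde\theta$ and $C^1$ maps $Y_i,P_i:U\to W_T$ with $Y_i(\tilde\theta)=\tilde y_i$, $P_i(\tilde\theta)=\tilde p_i$ such that $(Y_i(\theta),P_i(\theta))$ solves (S$_i$) for all $\theta\in U$ and all $i$. **(b)** For any such $U,Y_i,P_i$, the reduced objective $\mathcal J_N(\theta)=\sum_{i=1}^N\omega_iJ_\varepsilon(Y_i(\theta),P_i(\theta),\theta)+\frac{\gamma_\varepsilon}2\|\theta\|_{\mathcal R}^2$ is of class $C^1$ on $U$. Let $\theta\in U$, $y_i=Y_i(\theta)$, $p_i=P_i(\theta)$, and (all functions being evaluated along $(t,y_i(t))$) $$\Phi_i(t)=\int_0^t r_{\theta,y_i}(s)\,ds,\qquad \hat p_i=\gamma_2(p_i-\partial_yV_\theta),\qquad \hat y_i^T=(1-\gamma_1\Phi_i(T))\,Q_2^\top Q_2(y_i(T)-y_d^T),$$ $$\hat y_i=(1-\gamma_1\Phi_i)Q_1^\top Q_1(y_i-y_d)+\beta(1-\gamma_1\Phi_i)D_yF_\theta^\top F_\theta+\gamma_1r_{\theta,y_i}\,\partial_yV_\theta+\gamma_2D_{yy}V_\theta(\partial_yV_\theta-p_i),$$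 $$\hat\theta_i=\gamma_1\int_0^T r_{\theta,y_i}\,D_\theta V_\theta^\top\,dt+\int_0^T\Big(\beta(1-\gamma_1\Phi_i)D_\theta F_\theta^\top F_\theta+\gamma_2D_{y\theta}V_\theta^\top(\partial_yV_\theta-p_i)\Big)dt .$$ Then for every $i$ the costate equations $$-\dot\zeta_i=A_\theta\zeta_i+D_yF_\theta^\top g^\top\zeta_i+[D_yA_\theta^\top p_i]\kappa_i+Q_1^\top Q_1\kappa_i+\hat y_i,\qquad \zeta_i(T)=Q_2^\top Q_2\kappa_i(T)+\hat y_i^T,$$ $$\dot\kappa_i=A_\theta^\top\kappa_i+\hat p_i,\qquad \kappa_i(0)=0,$$ have a unique solution $(\zeta_i,\kappa_i)\in W_T\times W_T$; here $[D_yA_\theta^\top p]\kappa$ is the vector with $\langle[D_yA_\theta^\top p]\kappa,h\rangle=\langle\kappa,(D_yA_\theta(t,y)h)\,p\rangle$ for all $h\in\mathbb R^n$. With this solution, the gradient of $\mathcal J_N$ at $\theta$ in $\mathcal R$ is $$\nabla\mathcal J_N(\theta)=\sum_{i=1}^N\omega_i\Big(D_\theta\mathcal F_\theta(y_i)^\top\big(g(\cdot,y_i)^\top\zeta_i+[D_yg(\cdot,y_i)\kappa_i]^\top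 p_i\big)+\hat\theta_i\Big)+\gamma_\varepsilon\theta,$$ where $D_\theta\mathcal F_\theta(y)^\top w=\int_0^TD_\theta F_\theta(t,y(t))^\top w(t)\,dt$. -/

import Mathlib

noncomputable section

open MeasureTheory Set
open scoped ContDiff

namespace LearnFeedback

/-- `ℝⁿ` with its Euclidean norm. -/
abbrev Euc (n : ℕ) : Type := EuclideanSpace ℝ (Fin n)

/-- `L²(I; ℝⁿ)` for `I = (0, T)`. -/
abbrev L2 (T : ℝ) (n : ℕ) : Type := Lp (Euc n) 2 (volume.restrict (Ioo 0 T))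

/-- Smooth real test functions with compact support in the open interval `(0, T)`. -/
def IsTestFun (T : ℝ) (φ : ℝ → ℝ) : Prop :=
  ContDiff ℝ ∞ φ ∧ HasCompactSupport φ ∧ tsupport φ ⊆ Ioo 0 T

/-- `v` is the distributional derivative of `y` on `(0, T)`. -/
def IsWeakDeriv {n : ℕ} (T : ℝ) (y v : ℝ → Euc n) : Prop :=
  ∀ φ, IsTestFun T φ → ∫ t in Ioo 0 T, deriv φ t • y t = -∫ t in Ioo 0 T, φ t • v t

theorem isTestFun_subset_Icc {T : ℝ} (hT : 0 < T) {φ : ℝ → ℝ} (h : IsTestFun T φ) :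
    ∃ a b, 0 < a ∧ a ≤ b ∧ b < T ∧ ∀ t, t ∉ Icc a b → φ t = 0 := by
  obtain ⟨_, h2, h3⟩ := h
  by_cases hne : (tsupport φ).Nonempty
  · obtain ⟨a, ha, ha'⟩ := h2.isCompact.exists_isLeast hne
    obtain ⟨b, hb, hb'⟩ := h2.isCompact.exists_isGreatest hne
    refine ⟨a, b, (h3 ha).1, ha' hb, (h3 hb).2, fun t ht => ?_⟩
    apply image_eq_zero_of_notMem_tsupport
    exact fun h => ht ⟨ha' h, hb' h⟩
  · refine ⟨T / 2, T / 2, by linarith, le_rfl, by linarith, fun t _ => ?_⟩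
    apply image_eq_zero_of_notMem_tsupport
    exact fun h => hne ⟨t, h⟩

theorem isTestFun_primitive {T : ℝ} (hT : 0 < T) {h : ℝ → ℝ} (hh : IsTestFun T h)
    (h0 : ∫ t, h t = 0) : ∃ φ, IsTestFun T φ ∧ deriv φ = h := by
  obtain ⟨a, b, ha, hab, hb, hz⟩ := isTestFun_subset_Icc hT hh
  have hc : Continuous h := hh.1.continuous
  have hi : Integrable h := hc.integrable_of_hasCompactSupport hh.2.1
  have hd : ∀ x, HasDerivAt (fun t => ∫ s in Iic t, h s) (h x) x := by
    intro x
    have h1 : (fun t => ∫ s in Iic t, h s) = fun t => (∫ s in Iic x, h s) + ∫ s in x..t, h s := by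
      funext t
      rw [intervalIntegral.integral_Iic_sub_Iic hi.integrableOn hi.integrableOn |>.symm]
      ring
    rw [h1]
    exact (intervalIntegral.integral_hasDerivAt_right (hc.intervalIntegrable _ _)
      (hc.stronglyMeasurableAtFilter _ _) hc.continuousAt).const_add _
  have hde : deriv (fun t => ∫ s in Iic t, h s) = h := funext fun x => (hd x).deriv
  have hsupp : ∀ t, t ∉ Icc a b → (∫ s in Iic t, h s) = 0 := by
    intro t ht
    by_cases hta : t < a
    · exact setIntegral_eq_zero_of_forall_eq_zero fun s hs =>
        hz s fun hs' => absurd (hs'.1.trans (show s ≤ t from hs)) (not_le.2 hta)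
    · have htb : b < t := by
        by_contra hcon
        exact ht ⟨not_lt.1 hta, not_lt.1 hcon⟩
      rw [← h0]
      apply setIntegral_eq_integral_of_forall_compl_eq_zero
      intro s hs
      exact hz s fun hs' => hs (hs'.2.trans htb.le)
  have hts : tsupport (fun t => ∫ s in Iic t, h s) ⊆ Icc a b := by
    apply closure_minimal _ isClosed_Icc
    intro t ht
    by_contra hcon
    exact ht (hsupp t hcon)
  refine ⟨fun t => ∫ s in Iic t, h s, ⟨?_, ?_, ?_⟩, hde⟩
  · rw [contDiff_infty_iff_deriv, hde]
    exact ⟨fun x => (hd x).differentiableAt, hh.1⟩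
  · exact isCompact_Icc.of_isClosed_subset (isClosed_tsupport _) hts
  · exact hts.trans fun t ht => ⟨ha.trans_le ht.1, ht.2.trans_lt hb⟩


theorem ae_const_of_test {E : Type*} [NormedAddCommGroup E] [NormedSpace ℝ E]
    [CompleteSpace E] {T : ℝ} (hT : 0 < T) {z : ℝ → E} (hz : IntegrableOn z (Ioo 0 T))
    (h : ∀ φ, IsTestFun T φ → ∫ t in Ioo 0 T, deriv φ t • z t = 0) :
    ∃ c, ∀ᵐ t ∂(volume.restrict (Ioo 0 T)), z t = c := by
  let B : ContDiffBump (T / 2) := ⟨T / 8, T / 4, by linarith, by linarith⟩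
  have hB : IsTestFun T (B.normed volume) := by
    refine ⟨B.contDiff_normed, B.hasCompactSupport_normed, ?_⟩
    rw [B.tsupport_normed_eq, Real.closedBall_eq_Icc]
    intro t ht
    have h1 : T / 2 - T / 4 ≤ t := ht.1
    have h2 : t ≤ T / 2 + T / 4 := ht.2
    exact ⟨by linarith, by linarith⟩
  have hint : ∀ φ : ℝ → ℝ, IsTestFun T φ → ∀ z : ℝ → E, IntegrableOn z (Ioo 0 T) →
      IntegrableOn (fun t => φ t • z t) (Ioo 0 T) := by
    intro φ hφ z hz
    obtain ⟨C, hC⟩ := hφ.2.1.exists_bound_of_continuous hφ.1.continuous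
    exact hz.bdd_smul C hφ.1.continuous.aestronglyMeasurable (ae_of_all _ hC)
  have hout : ∀ φ : ℝ → ℝ, IsTestFun T φ → ∫ t in Ioo 0 T, φ t = ∫ t, φ t := by
    intro φ hφ
    apply setIntegral_eq_integral_of_forall_compl_eq_zero
    intro t ht
    exact image_eq_zero_of_notMem_tsupport fun h' => ht (hφ.2.2 h')
  set c : E := ∫ t in Ioo 0 T, B.normed volume t • z t with hcdef
  refine ⟨c, ?_⟩
  have hzc : IntegrableOn (fun t => z t - c) (Ioo 0 T) :=
    hz.sub (integrableOn_const (by simp))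
  have key := isOpen_Ioo.ae_eq_zero_of_integral_contDiff_smul_eq_zero (μ := volume)
    (U := Ioo 0 T) (f := fun t => z t - c) hzc.locallyIntegrableOn ?_
  · rw [ae_restrict_iff' measurableSet_Ioo]
    filter_upwards [key] with t ht hm
    exact sub_eq_zero.1 (ht hm)
  · intro ψ h1 h2 h3
    have hψ : IsTestFun T ψ := ⟨h1, h2, h3⟩
    set a : ℝ := ∫ t, ψ t with ha
    have htest : IsTestFun T (fun t => ψ t - a * B.normed volume t) := by
      refine ⟨h1.sub (contDiff_const.mul hB.1), h2.sub (hB.2.1.mul_left), ?_⟩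
      refine (tsupport_sub _ _).trans (union_subset h3 ?_)
      exact (tsupport_mul_subset_right).trans hB.2.2
    obtain ⟨φ, hφ, hφd⟩ := isTestFun_primitive hT htest (by
      rw [integral_sub (h1.continuous.integrable_of_hasCompactSupport h2)
        ((hB.1.continuous.integrable_of_hasCompactSupport hB.2.1).const_mul a),
        integral_const_mul, B.integral_normed]
      simp [ha])
    have h5 := h φ hφ
    rw [hφd] at h5
    have h6 : ∫ t in Ioo 0 T, ψ t • z t = a • c := by
      have : ∫ t in Ioo 0 T, (ψ t - a * B.normed volume t) • z t =
          (∫ t in Ioo 0 T, ψ t • z t) - a • c := by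
        have hI : IntegrableOn (fun t => a • B.normed volume t • z t) (Ioo 0 T) :=
          (hint _ hB z hz).smul a
        rw [hcdef, ← integral_smul, ← integral_sub (hint ψ hψ z hz) hI]
        congr 1
        funext t
        rw [sub_smul, mul_smul]
      rw [this, sub_eq_zero] at h5
      exact h5
    have h7 : ∫ t, ψ t • (z t - c) = ∫ t in Ioo 0 T, ψ t • (z t - c) := by
      symm
      apply setIntegral_eq_integral_of_forall_compl_eq_zero
      intro t ht
      rw [image_eq_zero_of_notMem_tsupport fun h' => ht (h3 h'), zero_smul]
    rw [h7]
    simp_rw [smul_sub]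
    rw [integral_sub (hint ψ hψ z hz) (hint ψ hψ _ (integrableOn_const (by simp))), h6,
      integral_smul_const, hout ψ hψ, sub_self]

theorem test_primitive {E : Type*} [NormedAddCommGroup E] [NormedSpace ℝ E]
    [CompleteSpace E] {T : ℝ} {v : ℝ → E} (hv : IntegrableOn v (Ioo 0 T)) {φ : ℝ → ℝ}
    (hφ : IsTestFun T φ) :
    ∫ t in Ioo 0 T, deriv φ t • (∫ s in (0 : ℝ)..t, v s) = -∫ t in Ioo 0 T, φ t • v t := by
  have hdc : Continuous (deriv φ) := (contDiff_infty_iff_deriv.1 hφ.1).2.continuous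
  obtain ⟨C, hC⟩ := hφ.2.1.deriv.exists_bound_of_continuous hdc
  have e1 : ∀ t ∈ Ioo 0 T, deriv φ t • (∫ s in (0 : ℝ)..t, v s) =
      ∫ s in Ioo 0 T, (Ici s).indicator (fun t => deriv φ t) t • v s := by
    intro t ht
    rw [intervalIntegral.integral_of_le ht.1.le, ← integral_smul]
    have h1 : Ioc 0 t = Ioo 0 T ∩ Iic t := by
      ext s
      constructor
      · exact fun hs => ⟨⟨hs.1, hs.2.trans_lt ht.2⟩, hs.2⟩
      · exact fun hs => ⟨hs.1.1, hs.2⟩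
    rw [h1, ← setIntegral_indicator measurableSet_Iic]
    congr 1
    funext s
    by_cases hs : s ≤ t
    · rw [indicator_of_mem (show s ∈ Iic t from hs), indicator_of_mem (show t ∈ Ici s from hs)]
    · rw [indicator_of_notMem (show s ∉ Iic t from hs),
        indicator_of_notMem (show t ∉ Ici s from hs), zero_smul]
  rw [setIntegral_congr_fun measurableSet_Ioo e1, integral_integral_swap, ← integral_neg]
  · apply setIntegral_congr_fun measurableSet_Ioo
    intro s hs
    beta_reduce
    rw [integral_smul_const, ← neg_smul]
    congr 1
    rw [setIntegral_indicator measurableSet_Ici]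
    have h1 : Ioo 0 T ∩ Ici s = Ico s T := by
      ext t
      constructor
      · exact fun ht => ⟨ht.2, ht.1.2⟩
      · exact fun ht => ⟨⟨hs.1.trans_le ht.1, ht.2⟩, ht.1⟩
    rw [h1, integral_Ico_eq_integral_Ioo, ← integral_Ioc_eq_integral_Ioo,
      ← intervalIntegral.integral_of_le hs.2.le,
      intervalIntegral.integral_deriv_eq_sub
        (fun x _ => (contDiff_infty_iff_deriv.1 hφ.1).1 x) (hdc.intervalIntegrable _ _)]
    rw [image_eq_zero_of_notMem_tsupport (f := φ) (x := T) fun h' => (hφ.2.2 h').2.ne rfl]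
    simp
  · have hm : AEStronglyMeasurable (fun p : ℝ × ℝ => (Ici p.2).indicator (fun t => deriv φ t) p.1)
        ((volume.restrict (Ioo 0 T)).prod (volume.restrict (Ioo 0 T))) := by
      have : (fun p : ℝ × ℝ => (Ici p.2).indicator (fun t => deriv φ t) p.1) =
          {p : ℝ × ℝ | p.2 ≤ p.1}.indicator fun p => deriv φ p.1 := by
        funext p
        by_cases hp : p.2 ≤ p.1
        · rw [indicator_of_mem (show p.1 ∈ Ici p.2 from hp), indicator_of_mem (by exact hp)]
        · rw [indicator_of_notMem (show p.1 ∉ Ici p.2 from hp), indicator_of_notMem (by exact hp)]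
      rw [this]
      exact (((hdc.comp continuous_fst).measurable.indicator
        (measurableSet_le measurable_snd measurable_fst))).aestronglyMeasurable
    have hvv : Integrable (fun p : ℝ × ℝ => v p.2)
        ((volume.restrict (Ioo 0 T)).prod (volume.restrict (Ioo 0 T))) := by
      simpa using Integrable.comp_snd (ν := volume.restrict (Ioo 0 T)) hv _
    refine hvv.bdd_smul C hm (ae_of_all _ fun p => ?_)
    refine (norm_indicator_le_norm_self _ _).trans (hC _)

theorem L2.integrableOn {T : ℝ} {n : ℕ} (y : L2 T n) : IntegrableOn y (Ioo 0 T) :=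
  (Lp.memLp y).integrable (by norm_num)

theorem IsTestFun.integrableOn_smul {T : ℝ} {n : ℕ} {φ : ℝ → ℝ} (hφ : IsTestFun T φ)
    {z : ℝ → Euc n} (hz : IntegrableOn z (Ioo 0 T)) :
    IntegrableOn (fun t => φ t • z t) (Ioo 0 T) := by
  obtain ⟨C, hC⟩ := hφ.2.1.exists_bound_of_continuous hφ.1.continuous
  exact hz.bdd_smul C hφ.1.continuous.aestronglyMeasurable (ae_of_all _ hC)

theorem isTestFun_deriv {T : ℝ} {φ : ℝ → ℝ} (hφ : IsTestFun T φ) : IsTestFun T (deriv φ) :=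
  ⟨(contDiff_infty_iff_deriv.1 hφ.1).2, hφ.2.1.deriv,
    (closure_minimal (support_deriv_subset (f := φ)) (isClosed_tsupport φ)).trans hφ.2.2⟩

/-- The space `W_T = {y ∈ L²(I; ℝⁿ) | ẏ ∈ L²(I; ℝⁿ)}`, realised as the space of pairs `(y, ẏ)`,
where `ẏ` is the distributional derivative of `y`. The norm inherited from the `ℓ²`-product is
`(‖y‖²_{L²} + ‖ẏ‖²_{L²})^{1/2}`. -/
def sobolev (T : ℝ) (n : ℕ) : Submodule ℝ (WithLp 2 (L2 T n × L2 T n)) where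
  carrier := {w | IsWeakDeriv T w.fst w.snd}
  add_mem' := by
    intro a b ha hb φ hφ
    have h1 : ∫ t in Ioo 0 T, deriv φ t • (a + b).fst t =
        ∫ t in Ioo 0 T, (deriv φ t • a.fst t + deriv φ t • b.fst t) := by
      apply integral_congr_ae
      filter_upwards [Lp.coeFn_add a.fst b.fst] with t ht
      rw [WithLp.add_fst, ht, Pi.add_apply, smul_add]
    have h2 : ∫ t in Ioo 0 T, φ t • (a + b).snd t =
        ∫ t in Ioo 0 T, (φ t • a.snd t + φ t • b.snd t) := by
      apply integral_congr_ae
      filter_upwards [Lp.coeFn_add a.snd b.snd] with t ht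
      rw [WithLp.add_snd, ht, Pi.add_apply, smul_add]
    rw [h1, h2, integral_add ((isTestFun_deriv hφ).integrableOn_smul (L2.integrableOn _))
      ((isTestFun_deriv hφ).integrableOn_smul (L2.integrableOn _)),
      integral_add (hφ.integrableOn_smul (L2.integrableOn _))
      (hφ.integrableOn_smul (L2.integrableOn _)), ha φ hφ, hb φ hφ, neg_add]
  zero_mem' := by
    intro φ hφ
    have h1 : ∫ t in Ioo 0 T, deriv φ t • (0 : WithLp 2 (L2 T n × L2 T n)).fst t = 0 := by
      apply integral_eq_zero_of_ae
      filter_upwards [Lp.coeFn_zero (Euc n) 2 (volume.restrict (Ioo 0 T))] with t ht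
      rw [WithLp.zero_fst, ht]; simp
    have h2 : ∫ t in Ioo 0 T, φ t • (0 : WithLp 2 (L2 T n × L2 T n)).snd t = 0 := by
      apply integral_eq_zero_of_ae
      filter_upwards [Lp.coeFn_zero (Euc n) 2 (volume.restrict (Ioo 0 T))] with t ht
      rw [WithLp.zero_snd, ht]; simp
    rw [h1, h2, neg_zero]
  smul_mem' := by
    intro c a ha φ hφ
    have h1 : ∫ t in Ioo 0 T, deriv φ t • (c • a).fst t =
        ∫ t in Ioo 0 T, c • deriv φ t • a.fst t := by
      apply integral_congr_ae
      filter_upwards [Lp.coeFn_smul c a.fst] with t ht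
      rw [WithLp.smul_fst, ht, Pi.smul_apply, smul_comm]
    have h2 : ∫ t in Ioo 0 T, φ t • (c • a).snd t = ∫ t in Ioo 0 T, c • φ t • a.snd t := by
      apply integral_congr_ae
      filter_upwards [Lp.coeFn_smul c a.snd] with t ht
      rw [WithLp.smul_snd, ht, Pi.smul_apply, smul_comm]
    rw [h1, h2, integral_smul, integral_smul, ha φ hφ, smul_neg]

/-- `W_T` as a normed space. -/
abbrev WT (T : ℝ) (n : ℕ) : Type := sobolev T n

namespace WT

/-- The distributional derivative `ẏ ∈ L²(I; ℝⁿ)` of `y ∈ W_T`. -/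
def dot {T : ℝ} {n : ℕ} (y : WT T n) : L2 T n := y.1.snd

/-- The elements of `W_T` are, up to null sets, primitives of their derivatives. -/
theorem exists_primitive {T : ℝ} {n : ℕ} (y : WT T n) :
    ∃ c : Euc n, ∀ᵐ t ∂(volume.restrict (Ioo 0 T)),
      y.1.fst t = c + ∫ s in (0 : ℝ)..t, y.dot s := by
  rcases le_or_gt T 0 with hT | hT
  · exact ⟨0, by simp [Ioo_eq_empty (not_lt.2 hT)]⟩
  have hv : IntegrableOn y.dot (Ioo 0 T) := L2.integrableOn _
  have hcont : ContinuousOn (fun t => ∫ s in (0 : ℝ)..t, y.dot s) (Icc 0 T) := by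
    have := intervalIntegral.continuousOn_primitive_interval (μ := volume) (f := y.dot)
      (a := 0) (b := T) (by
        rw [uIcc_of_le hT.le]
        exact (integrableOn_Icc_iff_integrableOn_Ioo).2 hv)
    rwa [uIcc_of_le hT.le] at this
  have hV : IntegrableOn (fun t => ∫ s in (0 : ℝ)..t, y.dot s) (Ioo 0 T) :=
    hcont.integrableOn_Icc.mono_set Ioo_subset_Icc_self
  have hy : IntegrableOn y.1.fst (Ioo 0 T) := L2.integrableOn _
  obtain ⟨c, hc⟩ := ae_const_of_test hT (hy.sub hV) (by
    intro φ hφ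
    have h1 := y.2 φ hφ
    have h2 := test_primitive hv hφ
    have h3 : ∫ t in Ioo 0 T, deriv φ t • (y.1.fst t - ∫ s in (0 : ℝ)..t, y.dot s) = 0 := by
      simp_rw [smul_sub]
      rw [integral_sub ((isTestFun_deriv hφ).integrableOn_smul hy) ((isTestFun_deriv hφ).integrableOn_smul hV), h2, h1]
      simp [dot]
    exact h3)
  refine ⟨c, ?_⟩
  filter_upwards [hc] with t ht
  rw [← sub_eq_iff_eq_add]
  exact ht

/-- The values `y(t)`, `t ∈ [0, T]`, of `y ∈ W_T`, i.e. its continuous representative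
(the embedding of `W_T` into `C([0, T]; ℝⁿ)`). -/
def val {T : ℝ} {n : ℕ} (y : WT T n) (t : ℝ) : Euc n :=
  y.exists_primitive.choose + ∫ s in (0 : ℝ)..t, y.dot s

theorem val_ae_eq {T : ℝ} {n : ℕ} (y : WT T n) :
    ∀ᵐ t ∂(volume.restrict (Ioo 0 T)), y.1.fst t = y.val t :=
  y.exists_primitive.choose_spec

instance {T : ℝ} {n : ℕ} : CoeFun (WT T n) (fun _ => ℝ → Euc n) := ⟨val⟩

end WT

/-- The data of the finite-ensemble learning problem with state space `ℝⁿ`, control space `ℝᵐ`,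
`N` initial conditions and parameter space `R`, together with their standing assumptions. Matrices
are written as linear maps, and adjoints (with respect to the given inner products) are their
transposes. -/
structure LearningProblem (n m N : ℕ) (R : Type*) [NormedAddCommGroup R]
    [InnerProductSpace ℝ R] where
  /-- time horizon -/
  T : ℝ
  T_pos : 0 < T
  /-- drift -/
  f : ℝ → Euc n → Euc n
  f_smooth : ContDiffOn ℝ 2 (fun x : ℝ × Euc n => f x.1 x.2) (Icc 0 T ×ˢ univ)
  /-- control matrix -/
  g : ℝ → Euc n → (Euc m →L[ℝ] Euc n)
  g_smooth : ContDiffOn ℝ 2 (fun x : ℝ × Euc n => g x.1 x.2) (Icc 0 T ×ˢ univ)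
  /-- parametrised approximate value functions `V θ t y` -/
  V : R → ℝ → Euc n → ℝ
  V_smooth : ContDiff ℝ 4 (fun x : R × ℝ × Euc n => V x.1 x.2.1 x.2.2)
  /-- weights and desired states in the tracking functional -/
  Q₁ : Euc n →L[ℝ] Euc n
  Q₂ : Euc n →L[ℝ] Euc n
  yd : L2 T n
  ydT : Euc n
  /-- control cost -/
  β : ℝ
  β_pos : 0 < β
  /-- penalty parameters -/
  γ₁ : ℝ
  γ₁_nonneg : 0 ≤ γ₁
  γ₂ : ℝ
  γ₂_nonneg : 0 ≤ γ₂
  /-- regularisation parameter `γ_ε` -/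
  γ : ℝ
  γ_pos : 0 < γ
  /-- initial conditions and their weights -/
  y₀ : Fin N → Euc n
  wt : Fin N → ℝ
  wt_pos : ∀ i, 0 < wt i

namespace LearningProblem

open ContinuousLinearMap (adjoint)

variable {n m N : ℕ} {R : Type*} [NormedAddCommGroup R] [InnerProductSpace ℝ R]
  [FiniteDimensional ℝ R] (P : LearningProblem n m N R)

/-- The gradient `∂_y V_θ(t, y)`. -/
def gradV (θ : R) (t : ℝ) (y : Euc n) : Euc n := gradient (P.V θ t) y

/-- The Hessian `D_yy V_θ(t, y)`. -/
def hessV (θ : R) (t : ℝ) (y : Euc n) : Euc n →L[ℝ] Euc n := fderiv ℝ (P.gradV θ t) y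

/-- The mixed derivative `D_yθ V_θ(t, y)`, i.e. the derivative of `θ ↦ ∂_y V_θ(t, y)`. -/
def dθgradV (θ : R) (t : ℝ) (y : Euc n) : R →L[ℝ] Euc n := fderiv ℝ (fun η => P.gradV η t y) θ

/-- The gradient of `θ ↦ V_θ(t, y)`. -/
def gradθV (θ : R) (t : ℝ) (y : Euc n) : R := gradient (fun η => P.V η t y) θ

/-- The feedback law `F_θ(t, y) = -(1/β) g(t, y)ᵀ ∂_y V_θ(t, y)`. -/
def F (θ : R) (t : ℝ) (y : Euc n) : Euc m := -(1 / P.β) • adjoint (P.g t y) (P.gradV θ t y)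

def dyF (θ : R) (t : ℝ) (y : Euc n) : Euc n →L[ℝ] Euc m := fderiv ℝ (P.F θ t) y

def dθF (θ : R) (t : ℝ) (y : Euc n) : R →L[ℝ] Euc m := fderiv ℝ (fun η => P.F η t y) θ

/-- `A(t, y, θ) = D_y f(t, y)ᵀ + [D_y g(t, y)ᵀ F_θ(t, y)]`, the transpose of
`δy ↦ D_y f(t, y) δy + [D_y g(t, y) δy] F_θ(t, y)`. -/
def A (θ : R) (t : ℝ) (y : Euc n) : Euc n →L[ℝ] Euc n :=
  adjoint (fderiv ℝ (P.f t) y + (fderiv ℝ (P.g t) y).flip (P.F θ t y))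

/-- For fixed `p`, the map `δy ↦ [D_y A(t, y, θ) δy] p`; the derivative also acts on `F_θ(t, y)`. -/
def dyA (θ : R) (t : ℝ) (y p : Euc n) : Euc n →L[ℝ] Euc n :=
  (fderiv ℝ (P.A θ t) y).flip p

/-- The pair `(y, p)` solves the closed loop state equation with initial value `y₀ i` and the
adjoint equation, for the parameter `θ`. -/
def IsStateAdjoint (i : Fin N) (θ : R) (y p : WT P.T n) : Prop :=
  (∀ᵐ t ∂(volume.restrict (Ioo 0 P.T)),
      y.dot t = P.f t (y t) + P.g t (y t) (P.F θ t (y t))) ∧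
  (∀ᵐ t ∂(volume.restrict (Ioo 0 P.T)),
      -p.dot t = P.A θ t (y t) (p t) + adjoint P.Q₁ (P.Q₁ (y t - P.yd t))) ∧
  y 0 = P.y₀ i ∧
  p P.T = adjoint P.Q₂ (P.Q₂ (y P.T - P.ydT))

/-- The cost-to-go `J_t(y, u)`. -/
def costToGo (y : WT P.T n) (u : ℝ → Euc m) (t : ℝ) : ℝ :=
  (1 / 2) * (∫ s in t..P.T, (‖P.Q₁ (y s - P.yd s)‖ ^ 2 + P.β * ‖u s‖ ^ 2)) +
    (1 / 2) * ‖P.Q₂ (y P.T - P.ydT)‖ ^ 2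

/-- The feedback control `𝓕_θ(y)`. -/
def feedback (θ : R) (y : WT P.T n) : ℝ → Euc m := fun t => P.F θ t (y t)

/-- The mismatch `V_θ(t, y(t)) - J_t(y, 𝓕_θ(y))`. -/
def mismatch (θ : R) (y : WT P.T n) (t : ℝ) : ℝ :=
  P.V θ t (y t) - P.costToGo y (P.feedback θ y) t

/-- The augmented objective `J_ε(y, p, θ)`. -/
def augmentedCost (y p : WT P.T n) (θ : R) : ℝ :=
  P.costToGo y (P.feedback θ y) 0 +
    ∫ t in (0 : ℝ)..P.T, (P.γ₁ / 2 * |P.mismatch θ y t| ^ 2 +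
      P.γ₂ / 2 * ‖P.gradV θ t (y t) - p t‖ ^ 2)

/-- The reduced objective `𝒥_N` built from parameter-to-state maps `Y i` and parameter-to-adjoint
maps `Z i`. -/
def reducedObjective (Y Z : Fin N → R → WT P.T n) (θ : R) : ℝ :=
  (∑ i, P.wt i * P.augmentedCost (Y i θ) (Z i θ) θ) + P.γ / 2 * ‖θ‖ ^ 2

/-- On the open neighbourhood `U` of `θ₀`, the `Y i` and `Z i` are `C¹` maps into `W_T` that take
the values `y i`, `p i` at `θ₀` and solve the state and adjoint equations. -/
structure IsParamToState (y p : Fin N → WT P.T n) (θ₀ : R) (U : Set R)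
    (Y Z : Fin N → R → WT P.T n) : Prop where
  isOpen : IsOpen U
  mem : θ₀ ∈ U
  state_base : ∀ i, Y i θ₀ = y i
  adjoint_base : ∀ i, Z i θ₀ = p i
  state_smooth : ∀ i, ContDiffOn ℝ 1 (Y i) U
  adjoint_smooth : ∀ i, ContDiffOn ℝ 1 (Z i) U
  solves : ∀ i, ∀ θ ∈ U, P.IsStateAdjoint i θ (Y i θ) (Z i θ)

/-- `Φ(t) = ∫₀ᵗ (V_θ(s, y(s)) - J_s(y, 𝓕_θ(y))) ds`. -/
def Φ (θ : R) (y : WT P.T n) (t : ℝ) : ℝ := ∫ s in (0 : ℝ)..t, P.mismatch θ y s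

/-- `ŷ(t)`. -/
def yHat (θ : R) (y p : WT P.T n) (t : ℝ) : Euc n :=
  (1 - P.γ₁ * P.Φ θ y t) • adjoint P.Q₁ (P.Q₁ (y t - P.yd t)) +
    (P.β * (1 - P.γ₁ * P.Φ θ y t)) • adjoint (P.dyF θ t (y t)) (P.F θ t (y t)) +
    (P.γ₁ * P.mismatch θ y t) • P.gradV θ t (y t) +
    P.γ₂ • P.hessV θ t (y t) (P.gradV θ t (y t) - p t)

/-- `ŷᵀ`, the terminal contribution. -/
def yHatT (θ : R) (y : WT P.T n) : Euc n :=
  (1 - P.γ₁ * P.Φ θ y P.T) • adjoint P.Q₂ (P.Q₂ (y P.T - P.ydT))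

/-- `p̂(t)`. -/
def pHat (θ : R) (y p : WT P.T n) (t : ℝ) : Euc n := P.γ₂ • (p t - P.gradV θ t (y t))

/-- `θ̂`. -/
def θHat (θ : R) (y p : WT P.T n) : R :=
  P.γ₁ • (∫ t in (0 : ℝ)..P.T, P.mismatch θ y t • P.gradθV θ t (y t)) +
    ∫ t in (0 : ℝ)..P.T,
      ((P.β * (1 - P.γ₁ * P.Φ θ y t)) • adjoint (P.dθF θ t (y t)) (P.F θ t (y t)) +
        P.γ₂ • adjoint (P.dθgradV θ t (y t)) (P.gradV θ t (y t) - p t))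

/-- The costate equations for `(ζ, κ)`. -/
def IsCostate (θ : R) (y p ζ κ : WT P.T n) : Prop :=
  (∀ᵐ t ∂(volume.restrict (Ioo 0 P.T)),
      -ζ.dot t = P.A θ t (y t) (ζ t) +
        adjoint (P.dyF θ t (y t)) (adjoint (P.g t (y t)) (ζ t)) +
        adjoint (P.dyA θ t (y t) (p t)) (κ t) +
        adjoint P.Q₁ (P.Q₁ (κ t)) + P.yHat θ y p t) ∧
  (∀ᵐ t ∂(volume.restrict (Ioo 0 P.T)),
      κ.dot t = adjoint (P.A θ t (y t)) (κ t) + P.pHat θ y p t) ∧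
  ζ P.T = adjoint P.Q₂ (P.Q₂ (κ P.T)) + P.yHatT θ y ∧
  κ 0 = 0

/-- The element `D_θ𝓕_θ(y)ᵀ w = ∫₀ᵀ D_θF_θ(t, y(t))ᵀ w(t) dt` of `R`: the adjoint of the derivative
of `θ ↦ 𝓕_θ(y) ∈ L²(I; ℝᵐ)`, applied to `w`. -/
def dθFeedbackAdjoint (θ : R) (y : WT P.T n) (w : ℝ → Euc m) : R :=
  ∫ t in (0 : ℝ)..P.T, adjoint (P.dθF θ t (y t)) (w t)

/-- The claimed gradient of the reduced objective at `θ`. -/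
def gradientFormula (θ : R) (y p ζ κ : Fin N → WT P.T n) : R :=
  (∑ i, P.wt i • (P.dθFeedbackAdjoint θ (y i) (fun t =>
      adjoint (P.g t (y i t)) (ζ i t) + adjoint (fderiv ℝ (P.g t) (y i t) (κ i t)) (p i t)) +
    P.θHat θ (y i) (p i))) + P.γ • θ

end LearningProblem

end LearnFeedback

end

/-! The analysis takes place in the continuous functions on `[0, T]`. There superposition operators
`u ↦ H(·, u(·))` are `C¹` as soon as `H` is continuously differentiable in the state
(`hasFDerivAt_nem`), with no growth conditions. Moreover, linear Volterra operators `1 - ∫ B` are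
invertible for every continuous coefficient `B` and every horizon, because their iterates decay
factorially (`isUnit_one_sub_volterra`). The space `W_T` is `ℝⁿ × L²` through initial value and
derivative (`mkWT`), so a solution found among continuous functions is lifted to `W_T` by
integrating its right-hand side.

For (a), the implicit function theorem applies to the integrated state equation: its partial
derivative in the state is a Volterra operator (`exists_state_map`). The adjoint equation is linear
in `p`, so `p` is the value of a solution operator that depends in a `C¹` way on coefficient,
forcing and terminal value (`contDiff_bwdSol`). Hence `p` is a `C¹` function of parameter and state
(`contDiff_adjState`).

For (b), the augmented cost is a `C¹` function `objC` of parameter, state and adjoint state, and the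
reduced objective is a composition. The derivatives of the solution maps solve the linearised
equations (`isLinearised_fderiv`). In the derivative of the cost the mismatch multiplies the tail
integrals of the running cost. Fubini moves these onto the primitive `Φ` of the mismatch, and the
weight `1 - γ₁ Φ` appears (`DobjC_eq_integral`). The sources `ŷ`, `p̂`, `ŷᵀ` are the coefficients of
the resulting linear form in the two linearised variables.

The costate system is triangular: `κ` is found forward in time without `ζ`, then `ζ` backward
(`existsUnique_isCostate`). Pairing the linearised equations with the costates cancels all
coefficient terms and leaves total time derivatives plus terms in `δθ` (`costate_identity`).
Integration by parts (`WT.integral_inner_dot`) and the end conditions remove the former, and what is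
left is the inner product of the gradient formula with `δθ` (`DobjC_eq_inner`). -/

set_option linter.unusedSectionVars false

noncomputable section

open MeasureTheory Set
open scoped ContDiff Topology

namespace LearnFeedback

/-! ### Superposition operators on continuous functions -/

section Nemytskii

variable {K X F : Type*} [TopologicalSpace K] [TopologicalSpace X] [TopologicalSpace F] [Zero F]

/-- The superposition (Nemytskii) operator `u ↦ H(·, u(·))` of a continuous map `H`. -/
def nem (H : K → X → F) (u : C(K, X)) : C(K, F) :=
  open Classical in
  -- The value `0` for discontinuous `H` makes `nem` total, so a family of derivatives can be
  -- inserted before its continuity is known.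
  if h : Continuous (Function.uncurry H) then
    ⟨fun k => H k (u k), h.comp (continuous_id.prodMk u.continuous)⟩
  else 0

theorem nem_apply {H : K → X → F} (h : Continuous (Function.uncurry H)) (u : C(K, X)) (k : K) :
    nem H u k = H k (u k) := by
  rw [nem, dif_pos h]
  rfl

end Nemytskii

section FunctionSpace

variable {K X Y F : Type*} [TopologicalSpace K] [CompactSpace K]
  [NormedAddCommGroup X] [NormedSpace ℝ X] [NormedAddCommGroup Y] [NormedSpace ℝ Y]
  [NormedAddCommGroup F] [NormedSpace ℝ F]

/-- Pointwise application of a continuous family of operators to a continuous function. -/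
def mulC : C(K, X →L[ℝ] F) →L[ℝ] C(K, X) →L[ℝ] C(K, F) :=
  LinearMap.mkContinuous₂
    (LinearMap.mk₂ ℝ (fun (B : C(K, X →L[ℝ] F)) (u : C(K, X)) =>
        (⟨fun k => B k (u k), by fun_prop⟩ : C(K, F)))
      (by intros; ext; simp) (by intros; ext; simp) (by intros; ext; simp) (by intros; ext; simp))
    1 (by
      intro B u
      rw [one_mul, ContinuousMap.norm_le _ (by positivity)]
      intro k
      exact ((B k).le_opNorm _).trans (mul_le_mul (B.norm_coe_le_norm k) (u.norm_coe_le_norm k)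
        (norm_nonneg _) (norm_nonneg B)))

@[simp] theorem mulC_apply (B : C(K, X →L[ℝ] F)) (u : C(K, X)) (k : K) :
    mulC B u k = B k (u k) := rfl

/-- The pairing of two continuous functions. -/
def pairC : C(K, X) × C(K, Y) →L[ℝ] C(K, X × Y) :=
  LinearMap.mkContinuous
    { toFun := fun u => u.1.prodMk u.2
      map_add' := by intros; rfl
      map_smul' := by intros; rfl } 1 (by
      intro u
      rw [one_mul, ContinuousMap.norm_le _ (by positivity)]
      intro k
      exact max_le_max (u.1.norm_coe_le_norm k) (u.2.norm_coe_le_norm k))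

/-- Constant functions. -/
def constC : F →L[ℝ] C(K, F) :=
  LinearMap.mkContinuous
    { toFun := fun c => ContinuousMap.const K c
      map_add' := by intros; rfl
      map_smul' := by intros; rfl } 1 (by
      intro c
      rw [one_mul, ContinuousMap.norm_le _ (by positivity)]
      intro k
      rfl)

@[simp] theorem constC_apply (c : F) (k : K) : (constC c : C(K, F)) k = c := rfl

/-- Evaluation at a point. -/
def evalC (k : K) : C(K, F) →L[ℝ] F :=
  LinearMap.mkContinuous
    { toFun := fun u => u k
      map_add' := by intros; rfl
      map_smul' := by intros; rfl } 1 (by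
      intro u
      rw [one_mul]
      exact u.norm_coe_le_norm k)

/-- Post-composition with the uncurried `H` and the map `u ↦ (id, u)` are continuous for the
compact-open topology, which is the sup-norm topology because `K` is compact. -/
theorem continuous_nem {H : K → X → F} (h : Continuous (Function.uncurry H)) :
    Continuous (nem H) := by
  have h1 : nem H = fun u => (⟨Function.uncurry H, h⟩ : C(K × X, F)).comp
      ((ContinuousMap.id K).prodMk u) := by
    funext u
    ext k
    simp [nem_apply h]
  rw [h1]
  refine (ContinuousMap.continuous_postcomp _).comp ?_
  exact ContinuousMap.continuous_of_continuous_uncurry _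
    (by dsimp [Function.uncurry]; fun_prop)

/-- The mean value inequality on the segment from `u k` to `v k` needs `H' k` to be close to `H' k
(u k)` there, uniformly in `k`. This uniformity is the continuity of `nem H'` at `u`. -/
theorem hasFDerivAt_nem {H : K → X → F} {H' : K → X → X →L[ℝ] F}
    (h : Continuous (Function.uncurry H)) (h' : Continuous (Function.uncurry H'))
    (hd : ∀ k x, HasFDerivAt (H k) (H' k x) x) (u : C(K, X)) :
    HasFDerivAt (nem H) (mulC (nem H' u)) u := by
  rw [hasFDerivAt_iff_isLittleO, Asymptotics.isLittleO_iff]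
  intro ε hε
  obtain ⟨δ, hδ, hδ'⟩ := Metric.continuousAt_iff.1 (continuous_nem h').continuousAt ε hε
  filter_upwards [Metric.ball_mem_nhds u hδ] with v hv
  rw [ContinuousMap.norm_le _ (by positivity)]
  intro k
  have key := (convex_segment (𝕜 := ℝ) (u k) (v k)).norm_image_sub_le_of_norm_hasFDerivWithin_le'
    (f := H k) (f' := H' k) (φ := H' k (u k)) (C := ε) (fun x _ => (hd k x).hasFDerivWithinAt)
    (by
      rintro x ⟨a, b, ha, hb, hab, rfl⟩
      -- The point of the segment is the value at `k` of the function `a • u + b • v`, which lies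
      -- within `δ` of `u` in the sup norm. So no compactness in `X` is needed.
      have hw : dist (a • u + b • v) u < δ := by
        have e : a • u + b • v - u = b • (v - u) := by
          rw [← eq_sub_iff_add_eq] at hab
          subst hab
          module
        rw [dist_eq_norm, e, norm_smul, Real.norm_of_nonneg hb]
        rw [Metric.mem_ball, dist_eq_norm] at hv
        calc b * ‖v - u‖ ≤ 1 * ‖v - u‖ := by gcongr; linarith
          _ < δ := by rwa [one_mul]
      have h3 := (hδ' hw).le
      rw [dist_eq_norm] at h3
      have h4 := ((nem H' (a • u + b • v) - nem H' u).norm_coe_le_norm k).trans h3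
      simpa [nem_apply h'] using h4)
    (left_mem_segment ℝ _ _) (right_mem_segment ℝ _ _)
  calc ‖(nem H v - nem H u - mulC (nem H' u) (v - u)) k‖
      = ‖H k (v k) - H k (u k) - H' k (u k) (v k - u k)‖ := by
        simp [nem_apply h, nem_apply h']
    _ ≤ ε * ‖v k - u k‖ := key
    _ ≤ ε * ‖v - u‖ := by gcongr; exact (v - u).norm_coe_le_norm k

theorem contDiff_nem {H : K → X → F} {H' : K → X → X →L[ℝ] F}
    (h : Continuous (Function.uncurry H)) (h' : Continuous (Function.uncurry H'))
    (hd : ∀ k x, HasFDerivAt (H k) (H' k x) x) : ContDiff ℝ 1 (nem H) :=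
  contDiff_one_iff_hasFDerivAt.2 ⟨fun u => mulC (nem H' u),
    mulC.continuous.comp (continuous_nem h'), hasFDerivAt_nem h h' hd⟩

end FunctionSpace

/-! ### Primitives as operators into continuous functions -/

section Primitive

variable {T : ℝ} {X F : Type*}
  [NormedAddCommGroup X] [NormedSpace ℝ X] [NormedAddCommGroup F] [NormedSpace ℝ F]

theorem intervalIntegrable_of_Ioo {v : ℝ → F} (hv : IntegrableOn v (Ioo 0 T)) {a b : ℝ}
    (ha : a ∈ Icc 0 T) (hb : b ∈ Icc 0 T) : IntervalIntegrable v volume a b := by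
  rw [intervalIntegrable_iff]
  refine ((integrableOn_Icc_iff_integrableOn_Ioo).2 hv).mono_set ?_
  exact uIoc_subset_uIcc.trans (uIcc_subset_Icc ha hb)

theorem ae_restrict_uIoc {q : ℝ → Prop} (h : ∀ᵐ t ∂(volume.restrict (Ioo 0 T)), q t) {a b : ℝ}
    (ha : a ∈ Icc 0 T) (hb : b ∈ Icc 0 T) : ∀ᵐ t ∂volume, t ∈ uIoc a b → q t := by
  rw [ae_restrict_iff' measurableSet_Ioo] at h
  -- `uIoc a b` may contain the endpoint `T`, which `Ioo 0 T` does not; it is discarded as a null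
  -- set.
  filter_upwards [h, Measure.ae_ne volume T] with t ht hne hm
  exact ht ⟨(le_min ha.1 hb.1).trans_lt hm.1, (hm.2.trans (max_le ha.2 hb.2)).lt_of_ne hne⟩

/-- The primitive `t ↦ ∫₀ᵗ v` on `[0, T]` of a function that is integrable on `(0, T)`. -/
def prim (v : ℝ → F) : C(Icc (0 : ℝ) T, F) :=
  open Classical in
  if h : IntegrableOn v (Ioo 0 T) ∧ 0 < T then
    ⟨fun t => ∫ s in (0 : ℝ)..t, v s, by
      have := intervalIntegral.continuousOn_primitive_interval (μ := volume) (f := v)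
        (a := 0) (b := T) (by
          rw [uIcc_of_le h.2.le]
          exact (integrableOn_Icc_iff_integrableOn_Ioo).2 h.1)
      rw [uIcc_of_le h.2.le] at this
      exact this.domRestrict⟩
  else 0

theorem prim_apply (hT : 0 < T) {v : ℝ → F} (hv : IntegrableOn v (Ioo 0 T)) (t : Icc (0 : ℝ) T) :
    prim v t = ∫ s in (0 : ℝ)..t, v s := by
  rw [prim, dif_pos ⟨hv, hT⟩]
  rfl

theorem prim_add (hT : 0 < T) {v w : ℝ → F} (hv : IntegrableOn v (Ioo 0 T)) (hw : IntegrableOn w (Ioo 0 T)) :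
    prim (T := T) (v + w) = prim v + prim w := by
  ext t
  rw [ContinuousMap.add_apply, prim_apply hT hv, prim_apply hT hw, prim_apply hT (hv.add hw),
    ← intervalIntegral.integral_add (intervalIntegrable_of_Ioo hv ⟨le_rfl, hT.le⟩ t.2)
      (intervalIntegrable_of_Ioo hw ⟨le_rfl, hT.le⟩ t.2)]
  rfl

theorem prim_smul (hT : 0 < T) {v : ℝ → F} (hv : IntegrableOn v (Ioo 0 T)) (c : ℝ) :
    prim (T := T) (c • v) = c • prim v := by
  ext t
  rw [ContinuousMap.smul_apply, prim_apply hT hv, prim_apply hT (hv.smul c),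
    ← intervalIntegral.integral_smul]
  rfl

theorem prim_congr (hT : 0 < T) {v w : ℝ → F} (h : v =ᵐ[volume.restrict (Ioo 0 T)] w) :
    prim (T := T) v = prim w := by
  by_cases hv : IntegrableOn v (Ioo 0 T)
  · ext t
    have hw : IntegrableOn w (Ioo 0 T) := Integrable.congr hv h
    rw [prim_apply hT hv, prim_apply hT hw]
    exact intervalIntegral.integral_congr_ae (ae_restrict_uIoc h ⟨le_rfl, hT.le⟩ t.2)
  · have hw : ¬ IntegrableOn w (Ioo 0 T) := fun hw => hv (Integrable.congr hw h.symm)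
    rw [prim, prim, dif_neg (fun h => hv h.1), dif_neg (fun h => hw h.1)]

theorem norm_prim_le (hT : 0 < T) {v : ℝ → F} (hv : IntegrableOn v (Ioo 0 T)) :
    ‖prim (T := T) v‖ ≤ ∫ s in Ioo 0 T, ‖v s‖ := by
  rw [ContinuousMap.norm_le _ (integral_nonneg fun _ => norm_nonneg _)]
  intro t
  rw [prim_apply hT hv, ← integral_Ioc_eq_integral_Ioo, ← intervalIntegral.integral_of_le hT.le]
  refine (intervalIntegral.norm_integral_le_integral_norm t.2.1).trans ?_
  exact intervalIntegral.integral_mono_interval le_rfl t.2.1 t.2.2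
    (Filter.Eventually.of_forall fun _ => norm_nonneg _)
    (intervalIntegrable_of_Ioo hv ⟨le_rfl, hT.le⟩ ⟨hT.le, le_rfl⟩).norm

/-- The constant extension to `ℝ` of a function on `[0, T]`. -/
def ext (hT : 0 < T) (u : C(Icc (0 : ℝ) T, F)) : ℝ → F := IccExtend hT.le u

theorem ext_apply (hT : 0 < T) (u : C(Icc (0 : ℝ) T, F)) {t : ℝ} (ht : t ∈ Icc 0 T) :
    ext hT u t = u ⟨t, ht⟩ :=
  IccExtend_of_mem _ _ ht

theorem continuous_ext (hT : 0 < T) (u : C(Icc (0 : ℝ) T, F)) : Continuous (ext hT u) :=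
  u.continuous.Icc_extend'

theorem norm_ext_le (hT : 0 < T) (u : C(Icc (0 : ℝ) T, F)) (t : ℝ) : ‖ext hT u t‖ ≤ ‖u‖ :=
  u.norm_coe_le_norm _

theorem integrableOn_ext (hT : 0 < T) (u : C(Icc (0 : ℝ) T, F)) :
    IntegrableOn (ext hT u) (Ioo 0 T) :=
  (continuous_ext hT u).integrableOn_Icc.mono_set Ioo_subset_Icc_self

theorem integrableOn_clm_ext (hT : 0 < T) {b : ℝ → X →L[ℝ] F} (hb : IntegrableOn b (Ioo 0 T))
    (u : C(Icc (0 : ℝ) T, X)) : IntegrableOn (fun s => b s (ext hT u s)) (Ioo 0 T) := by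
  refine Integrable.mono' (hb.norm.mul_const ‖u‖) ?_ (ae_of_all _ fun s => ?_)
  · exact (ContinuousLinearMap.id ℝ (X →L[ℝ] F)).aestronglyMeasurable_comp₂ hb.1
      (continuous_ext hT u).aestronglyMeasurable
  · exact ((b s).le_opNorm _).trans (by gcongr; exact norm_ext_le hT u s)

/-- The operator `u ↦ (t ↦ ∫₀ᵗ b(s) u(s) ds)` for an integrable operator function `b`. -/
def volt (hT : 0 < T) {b : ℝ → X →L[ℝ] F} (hb : IntegrableOn b (Ioo 0 T)) :
    C(Icc (0 : ℝ) T, X) →L[ℝ] C(Icc (0 : ℝ) T, F) :=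
  LinearMap.mkContinuous
    { toFun := fun u => prim fun s => b s (ext hT u s)
      map_add' := by
        intro u w
        rw [← prim_add hT (integrableOn_clm_ext hT hb u) (integrableOn_clm_ext hT hb w)]
        congr 1
        funext s
        exact map_add (b s) _ _
      map_smul' := by
        intro c u
        rw [RingHom.id_apply, ← prim_smul hT (integrableOn_clm_ext hT hb u)]
        congr 1
        funext s
        exact map_smul (b s) _ _ }
    (∫ s in Ioo 0 T, ‖b s‖) (by
      intro u
      refine (norm_prim_le hT (integrableOn_clm_ext hT hb u)).trans ?_
      rw [← integral_mul_const]
      refine integral_mono (integrableOn_clm_ext hT hb u).norm (hb.norm.mul_const _) fun s => ?_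
      exact ((b s).le_opNorm _).trans (by gcongr; exact norm_ext_le hT u s))

theorem integrableOn_Ioo_const (c : F) : IntegrableOn (fun _ : ℝ => c) (Ioo 0 T) :=
  integrableOn_const (by simp)

/-- The primitive vanishing at `0` as an operator on continuous functions. -/
def fprim (hT : 0 < T) : C(Icc (0 : ℝ) T, F) →L[ℝ] C(Icc (0 : ℝ) T, F) :=
  volt hT (integrableOn_Ioo_const (ContinuousLinearMap.id ℝ F))

theorem fprim_apply (hT : 0 < T) (u : C(Icc (0 : ℝ) T, F)) (t : Icc (0 : ℝ) T) :
    fprim hT u t = ∫ s in (0 : ℝ)..t, ext hT u s :=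
  prim_apply hT (integrableOn_ext hT u) t

/-- The operator `u ↦ u(T) - u`. -/
def flipC (hT : 0 < T) : C(Icc (0 : ℝ) T, F) →L[ℝ] C(Icc (0 : ℝ) T, F) :=
  constC ∘L evalC (⟨T, hT.le, le_rfl⟩ : Icc (0 : ℝ) T) - ContinuousLinearMap.id ℝ _

@[simp] theorem flipC_apply (hT : 0 < T) (u : C(Icc (0 : ℝ) T, F)) (t : Icc (0 : ℝ) T) :
    flipC hT u t = u ⟨T, hT.le, le_rfl⟩ - u t := rfl

theorem flipC_prim (hT : 0 < T) {v : ℝ → F} (hv : IntegrableOn v (Ioo 0 T)) (t : Icc (0 : ℝ) T) :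
    flipC hT (prim v) t = ∫ s in (t : ℝ)..T, v s := by
  rw [flipC_apply, prim_apply hT hv, prim_apply hT hv, sub_eq_iff_eq_add, add_comm]
  exact (intervalIntegral.integral_add_adjacent_intervals
    (intervalIntegrable_of_Ioo hv ⟨le_rfl, hT.le⟩ t.2)
    (intervalIntegrable_of_Ioo hv t.2 ⟨hT.le, le_rfl⟩)).symm

/-- The primitive `t ↦ ∫ₜᵀ u` vanishing at `T`. -/
def bprim (hT : 0 < T) : C(Icc (0 : ℝ) T, F) →L[ℝ] C(Icc (0 : ℝ) T, F) := flipC hT ∘L fprim hT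

theorem bprim_apply (hT : 0 < T) (u : C(Icc (0 : ℝ) T, F)) (t : Icc (0 : ℝ) T) :
    bprim hT u t = ∫ s in (t : ℝ)..T, ext hT u s :=
  flipC_prim hT (integrableOn_ext hT u) t

end Primitive

/-! ### Invertibility of Volterra operators -/

section Volterra

variable {T : ℝ} (hT : 0 < T) {F : Type*} [NormedAddCommGroup F] [NormedSpace ℝ F]

/-- `1 - a ^ k` is the product of `1 - a` and a geometric sum. The factors commute, so each is a
unit when the product is. -/
theorem isUnit_one_sub_of_norm_pow_lt_one {A : Type*} [NormedRing A] [CompleteSpace A] {a : A}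
    {k : ℕ} (h : ‖a ^ k‖ < 1) : IsUnit (1 - a) := by
  have h1 : IsUnit (1 - a ^ k) := isUnit_one_sub_of_norm_lt_one h
  rw [← mul_neg_geom_sum] at h1
  have hc : Commute (1 - a) (∑ i ∈ Finset.range k, a ^ i) := by
    rw [Commute, SemiconjBy, mul_neg_geom_sum, geom_sum_mul_neg]
  exact (hc.isUnit_mul_iff.1 h1).1

/-- Each application of `L` turns a bound `C τ ^ k` into `C τ ^ (k + 1) / (k + 1)`. The `k`-th
iterate is therefore at most `(‖B‖ T) ^ k / k!`, which is eventually below `1` without any smallness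
of `B` or `T`. The function `τ` is the length of the interval of integration: `t` for forward
primitives, `T - t` for backward ones. -/
theorem isUnit_one_sub_volterra [CompleteSpace F]
    (L : C(Icc (0 : ℝ) T, F) →L[ℝ] C(Icc (0 : ℝ) T, F)) (τ : Icc (0 : ℝ) T → ℝ)
    (hτ0 : ∀ t, 0 ≤ τ t) (hτ : ∀ t, τ t ≤ T)
    (hL : ∀ (u : C(Icc (0 : ℝ) T, F)) (C : ℝ) (k : ℕ), (∀ t, ‖u t‖ ≤ C * τ t ^ k) → ∀ t, ‖L u t‖ ≤ C * (τ t ^ (k + 1) / (k + 1)))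
    (B : C(Icc (0 : ℝ) T, F →L[ℝ] F)) : IsUnit (1 - L ∘L mulC B) := by
  set M := ‖B‖ with hM
  have hM0 : 0 ≤ M := norm_nonneg B
  have key : ∀ (k : ℕ) (u : C(Icc (0 : ℝ) T, F)) (t : Icc (0 : ℝ) T),
      ‖((L ∘L mulC B) ^ k) u t‖ ≤ (M ^ k / k.factorial * ‖u‖) * τ t ^ k := by
    intro k
    induction k with
    | zero => intro u t; simpa using u.norm_coe_le_norm t
    | succ k ih =>
      intro u t
      rw [pow_succ']
      have := hL (mulC B (((L ∘L mulC B) ^ k) u)) (M * (M ^ k / k.factorial * ‖u‖)) k (by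
        intro s
        rw [mulC_apply, mul_assoc]
        refine ((B s).le_opNorm _).trans ?_
        exact mul_le_mul (B.norm_coe_le_norm s) (ih u s) (norm_nonneg _) hM0) t
      refine this.trans (le_of_eq ?_)
      rw [Nat.factorial_succ]
      push_cast
      field_simp
      ring
  have hlim := FloorSemiring.tendsto_pow_div_factorial_atTop (M * T)
  obtain ⟨k, hk⟩ := (hlim.eventually (gt_mem_nhds (show (0 : ℝ) < 1 / 2 by norm_num))).exists
  suffices h : ‖(L ∘L mulC B) ^ k‖ ≤ 1 / 2 from
    isUnit_one_sub_of_norm_pow_lt_one (A := C(Icc (0 : ℝ) T, F) →L[ℝ] C(Icc (0 : ℝ) T, F))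
      (a := L ∘L mulC B) (k := k) (h.trans_lt (by norm_num))
  refine ContinuousLinearMap.opNorm_le_bound _ (by norm_num) fun u => ?_
  rw [ContinuousMap.norm_le _ (by positivity)]
  intro t
  refine (key k u t).trans ?_
  calc M ^ k / k.factorial * ‖u‖ * τ t ^ k ≤ M ^ k / k.factorial * ‖u‖ * T ^ k := by
        have := hτ0 t
        have := hτ t
        gcongr
    _ = (M * T) ^ k / k.factorial * ‖u‖ := by rw [mul_pow]; ring
    _ ≤ 1 / 2 * ‖u‖ := by gcongr

theorem isUnit_one_sub_fprim [CompleteSpace F] (B : C(Icc (0 : ℝ) T, F →L[ℝ] F)) :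
    IsUnit (1 - fprim hT ∘L mulC B) := by
  refine isUnit_one_sub_volterra _ (fun t => t) (fun t => t.2.1) (fun t => t.2.2) ?_ B
  intro u C k hu t
  rw [fprim_apply]
  have h1 : ‖∫ s in (0 : ℝ)..t, ext hT u s‖ ≤ ∫ s in (0 : ℝ)..t, C * s ^ k := by
    refine intervalIntegral.norm_integral_le_of_norm_le t.2.1 (ae_of_all _ fun s hs => ?_)
      ((by fun_prop : Continuous fun s : ℝ => C * s ^ k).intervalIntegrable _ _)
    have hs' : s ∈ Icc 0 T := ⟨hs.1.le, hs.2.trans t.2.2⟩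
    rw [ext_apply hT u hs']
    exact hu ⟨s, hs'⟩
  refine h1.trans (le_of_eq ?_)
  rw [intervalIntegral.integral_const_mul, integral_pow]
  simp

theorem isUnit_one_sub_bprim [CompleteSpace F] (B : C(Icc (0 : ℝ) T, F →L[ℝ] F)) :
    IsUnit (1 - bprim hT ∘L mulC B) := by
  refine isUnit_one_sub_volterra _ (fun t => T - t) (fun t => sub_nonneg.2 t.2.2)
    (fun t => sub_le_self _ t.2.1) ?_ B
  intro u C k hu t
  rw [bprim_apply]
  have h1 : ‖∫ s in (t : ℝ)..T, ext hT u s‖ ≤ ∫ s in (t : ℝ)..T, C * (T - s) ^ k := by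
    refine intervalIntegral.norm_integral_le_of_norm_le t.2.2 (ae_of_all _ fun s hs => ?_)
      ((by fun_prop : Continuous fun s : ℝ => C * (T - s) ^ k).intervalIntegrable _ _)
    have hs' : s ∈ Icc 0 T := ⟨t.2.1.trans hs.1.le, hs.2⟩
    rw [ext_apply hT u hs']
    exact hu ⟨s, hs'⟩
  refine h1.trans (le_of_eq ?_)
  rw [intervalIntegral.integral_const_mul,
    intervalIntegral.integral_comp_sub_left (fun s => s ^ k) T, integral_pow]
  simp

end Volterra

/-! ### Fubini on a triangle -/

section IntegrationByParts

variable {T : ℝ} {F : Type*} [NormedAddCommGroup F] [InnerProductSpace ℝ F] [CompleteSpace F]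

/-- Integration by parts for primitives of integrable functions. -/
theorem integral_inner_prim (hT : 0 ≤ T) {a b : ℝ → F} (ha : IntegrableOn a (Ioo 0 T))
    (hb : IntegrableOn b (Ioo 0 T)) :
    ∫ t in (0 : ℝ)..T, inner ℝ (a t) (∫ s in t..T, b s) =
      ∫ s in (0 : ℝ)..T, inner ℝ (∫ t in (0 : ℝ)..s, a t) (b s) := by
  have hint : Integrable (fun q : ℝ × ℝ => inner ℝ (a q.1) (b q.2))
      ((volume.restrict (Ioo 0 T)).prod (volume.restrict (Ioo 0 T))) := by
    refine Integrable.op_fst_snd (op := fun x y => inner ℝ x y) continuous_inner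
      ⟨1, fun x y => ?_⟩ ha hb
    rw [one_mul]
    exact norm_inner_le_norm x y
  -- Both sides are the double integral of `⟨a(t), b(s)⟩` over the triangle `t < s`; the indicator
  -- of the triangle lets Fubini act on the full square.
  have hind : Integrable (fun q : ℝ × ℝ => {q : ℝ × ℝ | q.1 < q.2}.indicator
      (fun q => inner ℝ (a q.1) (b q.2)) q)
      ((volume.restrict (Ioo 0 T)).prod (volume.restrict (Ioo 0 T))) :=
    hint.indicator (measurableSet_lt measurable_fst measurable_snd)
  rw [intervalIntegral.integral_of_le hT, intervalIntegral.integral_of_le hT,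
    integral_Ioc_eq_integral_Ioo, integral_Ioc_eq_integral_Ioo]
  have e1 : ∀ t ∈ Ioo 0 T, inner ℝ (a t) (∫ s in t..T, b s) =
      ∫ s in Ioo 0 T, {q : ℝ × ℝ | q.1 < q.2}.indicator
        (fun q => inner ℝ (a q.1) (b q.2)) (t, s) := by
    intro t ht
    have h1 : Ioo 0 T ∩ Ioi t = Ioo t T := by
      ext s
      exact ⟨fun hs => ⟨hs.2, hs.1.2⟩, fun hs => ⟨⟨ht.1.trans hs.1, hs.2⟩, hs.1⟩⟩
    rw [intervalIntegral.integral_of_le ht.2.le, integral_Ioc_eq_integral_Ioo, ← h1,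
      ← integral_inner ((hb.mono_set inter_subset_left)), ← setIntegral_indicator measurableSet_Ioi]
    rfl
  have e2 : ∀ s ∈ Ioo 0 T, inner ℝ (∫ t in (0 : ℝ)..s, a t) (b s) =
      ∫ t in Ioo 0 T, {q : ℝ × ℝ | q.1 < q.2}.indicator
        (fun q => inner ℝ (a q.1) (b q.2)) (t, s) := by
    intro s hs
    have h1 : Ioo 0 T ∩ Iio s = Ioo 0 s := by
      ext t
      exact ⟨fun ht => ⟨ht.1.1, ht.2⟩, fun ht => ⟨⟨ht.1, ht.2.trans hs.2⟩, ht.2⟩⟩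
    rw [intervalIntegral.integral_of_le hs.1.le, integral_Ioc_eq_integral_Ioo, ← h1,
      real_inner_comm, ← integral_inner ((ha.mono_set inter_subset_left)),
      ← setIntegral_indicator measurableSet_Iio]
    refine integral_congr_ae (ae_of_all _ fun t => ?_)
    dsimp only
    by_cases hts : t < s
    · rw [indicator_of_mem (show t ∈ Iio s from hts), indicator_of_mem (by exact hts),
        real_inner_comm]
    · rw [indicator_of_notMem (show t ∉ Iio s from hts), indicator_of_notMem (by exact hts)]
  rw [setIntegral_congr_fun measurableSet_Ioo e1, setIntegral_congr_fun measurableSet_Ioo e2]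
  exact integral_integral_swap hind

end IntegrationByParts

/-! ### `W_T` as initial values and derivatives -/

section Sobolev

variable {T : ℝ} {n : ℕ}

theorem memLp_ext (hT : 0 < T) (u : C(Icc (0 : ℝ) T, Euc n)) :
    MemLp (ext hT u) 2 (volume.restrict (Ioo 0 T)) :=
  MemLp.of_bound (continuous_ext hT u).aestronglyMeasurable ‖u‖
    (ae_of_all _ (norm_ext_le hT u))

/-- The embedding of the continuous functions into `L²`. -/
def toL2 (hT : 0 < T) : C(Icc (0 : ℝ) T, Euc n) →L[ℝ] L2 T n :=
  LinearMap.mkContinuous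
    { toFun := fun u => (memLp_ext hT u).toLp
      map_add' := fun u w => MemLp.toLp_add (memLp_ext hT u) (memLp_ext hT w)
      map_smul' := fun c u => MemLp.toLp_const_smul c (memLp_ext hT u) }
    ((measureUnivNNReal (volume.restrict (Ioo 0 T)) : ℝ) ^ (2 : ENNReal).toReal⁻¹) (by
      intro u
      refine Lp.norm_le_of_ae_bound (norm_nonneg u) ?_
      filter_upwards [(memLp_ext hT u).coeFn_toLp] with t ht
      change ‖(memLp_ext hT u).toLp (ext hT u) t‖ ≤ ‖u‖
      rw [ht]
      exact norm_ext_le hT u t)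

theorem toL2_ae (hT : 0 < T) (u : C(Icc (0 : ℝ) T, Euc n)) :
    toL2 hT u =ᵐ[volume.restrict (Ioo 0 T)] ext hT u :=
  (memLp_ext hT u).coeFn_toLp

/-- Hölder's inequality on a set of finite measure; it bounds the primitive from `L²` into the
continuous functions. -/
theorem integral_norm_L2_le (v : L2 T n) :
    ∫ s in Ioo 0 T, ‖v s‖ ≤ (volume.restrict (Ioo 0 T) univ).toReal ^ (1 / 2 : ℝ) * ‖v‖ := by
  have h1 := eLpNorm_le_eLpNorm_mul_rpow_measure_univ (p := 1) (q := 2) (by norm_num)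
    (Lp.memLp v).1
  rw [eLpNorm_one_eq_lintegral_enorm] at h1
  rw [integral_norm_eq_lintegral_enorm (Lp.memLp v).1, Lp.norm_def, mul_comm,
    ENNReal.toReal_rpow, ← ENNReal.toReal_mul]
  refine ENNReal.toReal_mono ?_ (h1.trans (le_of_eq ?_))
  · refine ENNReal.mul_ne_top (Lp.eLpNorm_ne_top v) ?_
    exact ENNReal.rpow_ne_top_of_nonneg (by norm_num) (measure_ne_top _ _)
  · norm_num

/-- The primitive vanishing at `0` as an operator on `L²`. -/
def primL2 (hT : 0 < T) : L2 T n →L[ℝ] C(Icc (0 : ℝ) T, Euc n) :=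
  LinearMap.mkContinuous
    { toFun := fun v => prim v
      map_add' := fun v w => by
        rw [prim_congr hT (Lp.coeFn_add v w), prim_add hT (L2.integrableOn v) (L2.integrableOn w)]
      map_smul' := fun c v => by
        rw [prim_congr hT (Lp.coeFn_smul c v), prim_smul hT (L2.integrableOn v), RingHom.id_apply] }
    _ (fun v => (norm_prim_le hT (L2.integrableOn v)).trans (integral_norm_L2_le v))

theorem primL2_apply (hT : 0 < T) (v : L2 T n) (t : Icc (0 : ℝ) T) :
    primL2 hT v t = ∫ s in (0 : ℝ)..t, v s :=
  prim_apply hT (L2.integrableOn v) t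

theorem primL2_toL2 (hT : 0 < T) (u : C(Icc (0 : ℝ) T, Euc n)) :
    primL2 hT (toL2 hT u) = fprim hT u :=
  prim_congr hT (toL2_ae hT u)

theorem WT.val_eq (y : WT T n) (t : ℝ) : y t = y 0 + ∫ s in (0 : ℝ)..t, y.dot s := by
  simp [WT.val]

/-- `val` rests on a chosen constant. Any other constant that works almost everywhere agrees with
it, since `(0, T)` is not null and one common point suffices. -/
theorem WT.val_zero_eq (hT : 0 < T) (y : WT T n) (c : Euc n)
    (h : ∀ᵐ t ∂(volume.restrict (Ioo 0 T)), y.1.fst t = c + ∫ s in (0 : ℝ)..t, y.dot s) :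
    y 0 = c := by
  have : (ae (volume.restrict (Ioo 0 T))).NeBot := by
    rw [ae_neBot, Ne, Measure.restrict_eq_zero, Real.volume_Ioo]
    simpa using hT
  obtain ⟨t, h1, h2⟩ := (h.and y.val_ae_eq).exists
  rw [h1, WT.val_eq] at h2
  exact (add_right_cancel h2).symm

theorem WT.val_ae_eq' (hT : 0 < T) (y : WT T n) :
    y.1.fst = toL2 hT (constC (y 0) + primL2 hT y.dot) := by
  apply Lp.ext
  filter_upwards [y.val_ae_eq, toL2_ae hT (constC (y 0) + primL2 hT y.dot),
    ae_restrict_mem measurableSet_Ioo] with t h1 h2 ht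
  rw [h1, h2, ext_apply hT _ (Ioo_subset_Icc_self ht), WT.val_eq]
  simp [primL2_apply]

/-- The constant drops out because a test function vanishes at both ends of the interval; the
primitive is covered by `test_primitive`. -/
theorem isWeakDeriv_mk (hT : 0 < T) (c : Euc n) (v : L2 T n) :
    IsWeakDeriv T (toL2 hT (constC c + primL2 hT v)) v := by
  intro φ hφ
  have h1 : ∫ t in Ioo 0 T, deriv φ t • toL2 hT (constC c + primL2 hT v) t =
      ∫ t in Ioo 0 T, (deriv φ t • c + deriv φ t • ∫ s in (0 : ℝ)..t, v s) := by
    apply integral_congr_ae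
    filter_upwards [toL2_ae hT (constC c + primL2 hT v), ae_restrict_mem measurableSet_Ioo]
      with t h2 ht
    rw [h2, ext_apply hT _ (Ioo_subset_Icc_self ht)]
    simp [primL2_apply]
  have hI : IntegrableOn (fun t => ∫ s in (0 : ℝ)..t, v s) (Ioo 0 T) := by
    refine IntegrableOn.congr_fun (integrableOn_ext hT (primL2 hT v)) (fun t ht => ?_)
      measurableSet_Ioo
    rw [ext_apply hT _ (Ioo_subset_Icc_self ht), primL2_apply]
  have h3 : ∫ t in Ioo 0 T, deriv φ t • c = 0 := by
    have hd := hφ.1.differentiable (by simp)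
    have hc : Continuous (deriv φ) := (contDiff_infty_iff_deriv.1 hφ.1).2.continuous
    rw [integral_smul_const, ← integral_Ioc_eq_integral_Ioo, ← intervalIntegral.integral_of_le hT.le,
      intervalIntegral.integral_deriv_eq_sub (fun x _ => hd x) (hc.intervalIntegrable _ _),
      image_eq_zero_of_notMem_tsupport (f := φ) (x := T) fun h' => (hφ.2.2 h').2.ne rfl,
      image_eq_zero_of_notMem_tsupport (f := φ) (x := 0) fun h' => (hφ.2.2 h').1.ne rfl]
    simp
  rw [h1, integral_add ((isTestFun_deriv hφ).integrableOn_smul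
    (integrableOn_const (by simp))) ((isTestFun_deriv hφ).integrableOn_smul hI), h3, zero_add,
    test_primitive (L2.integrableOn v) hφ]

/-- The pair of the primitive of `v` with initial value `c` and of `v`. -/
def primPair (hT : 0 < T) : Euc n × L2 T n →L[ℝ] WithLp 2 (L2 T n × L2 T n) :=
  (WithLp.prodContinuousLinearEquiv 2 ℝ (L2 T n) (L2 T n)).symm.toContinuousLinearMap ∘L
    ((toL2 hT ∘L (constC ∘L ContinuousLinearMap.fst ℝ (Euc n) (L2 T n) +
      primL2 hT ∘L ContinuousLinearMap.snd ℝ (Euc n) (L2 T n))).prod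
        (ContinuousLinearMap.snd ℝ (Euc n) (L2 T n)))

theorem primPair_fst (hT : 0 < T) (w : Euc n × L2 T n) :
    (primPair hT w).fst = toL2 hT (constC w.1 + primL2 hT w.2) := rfl

theorem primPair_snd (hT : 0 < T) (w : Euc n × L2 T n) : (primPair hT w).snd = w.2 := rfl

theorem primPair_mem (hT : 0 < T) (w : Euc n × L2 T n) : primPair hT w ∈ sobolev T n := by
  have h := isWeakDeriv_mk hT w.1 w.2
  rw [← primPair_fst, ← primPair_snd hT w] at h
  exact h

/-- The element of `W_T` with given initial value and given derivative. -/
def mkWT (hT : 0 < T) : Euc n × L2 T n →L[ℝ] WT T n :=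
  (primPair hT).codRestrict (sobolev T n) (primPair_mem hT)

theorem mkWT_fst (hT : 0 < T) (w : Euc n × L2 T n) :
    (mkWT hT w).1.fst = toL2 hT (constC w.1 + primL2 hT w.2) := rfl

theorem mkWT_dot (hT : 0 < T) (w : Euc n × L2 T n) : (mkWT hT w).dot = w.2 := rfl

theorem mkWT_zero (hT : 0 < T) (w : Euc n × L2 T n) : mkWT hT w 0 = w.1 := by
  refine WT.val_zero_eq hT _ _ ?_
  filter_upwards [toL2_ae hT (constC w.1 + primL2 hT w.2), ae_restrict_mem measurableSet_Ioo]
    with t h2 ht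
  rw [mkWT_dot, mkWT_fst, h2, ext_apply hT _ (Ioo_subset_Icc_self ht)]
  simp [primL2_apply]

/-- With `mkWT_zero` and `mkWT_dot` this makes `mkWT` a bijection from `ℝⁿ × L²`, so an element of
`W_T` is determined by its initial value and its derivative. -/
theorem mkWT_eta (hT : 0 < T) (y : WT T n) : mkWT hT (y 0, y.dot) = y := by
  apply Subtype.ext
  apply WithLp.ofLp_injective
  refine Prod.ext ?_ rfl
  exact (WT.val_ae_eq' hT y).symm

/-- The initial value as a continuous linear functional on `W_T`. -/
def val0 (hT : 0 < T) : WT T n →L[ℝ] Euc n :=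
  LinearMap.mkContinuous
    { toFun := fun y => y 0
      map_add' := fun y z => by
        -- The initial value comes from a choice and is not visibly linear; linearity is inherited
        -- from `mkWT`.
        have h : y + z = mkWT hT (y 0 + z 0, y.dot + z.dot) := by
          rw [← Prod.mk_add_mk, map_add, mkWT_eta, mkWT_eta]
        rw [h, mkWT_zero]
      map_smul' := fun c y => by
        have h : c • y = mkWT hT (c • y 0, c • y.dot) := by
          rw [← Prod.smul_mk, map_smul, mkWT_eta]
        rw [h, mkWT_zero]
        rfl }
    -- The constant function `y 0` is `y` minus the primitive of its derivative, and its `L²` norm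
    -- is `T ^ (1 / 2)` times `‖y 0‖`. This yields the bound.
    ((1 + ‖toL2 hT ∘L primL2 (n := n) hT‖) / T ^ (1 / 2 : ℝ)) (fun y => by
      have h1 : Lp.const 2 (volume.restrict (Ioo 0 T)) (y 0) =
          y.1.fst - (toL2 hT ∘L primL2 hT) y.dot := by
        rw [WT.val_ae_eq' hT y, map_add, ContinuousLinearMap.comp_apply, add_sub_cancel_right]
        apply Lp.ext
        filter_upwards [toL2_ae hT (constC (y 0)), Lp.coeFn_const 2 (volume.restrict (Ioo 0 T))
          (y 0)] with t h1 h2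
        rw [h1, h2]
        rfl
      have h2 : ‖y.1.fst‖ ≤ ‖y‖ := WithLp.norm_fst_le _ y.1
      have h3 : ‖y.dot‖ ≤ ‖y‖ := WithLp.norm_snd_le _ y.1
      have h4 : ‖Lp.const 2 (volume.restrict (Ioo 0 T)) (y 0)‖ ≤
          (1 + ‖toL2 hT ∘L primL2 (n := n) hT‖) * ‖y‖ := by
        rw [h1, add_mul, one_mul]
        refine (norm_sub_le _ _).trans (add_le_add h2 ?_)
        exact (ContinuousLinearMap.le_opNorm _ _).trans (by gcongr)
      have h6 := Lp.norm_const' (E := Euc n) (p := 2) (μ := volume.restrict (Ioo 0 T)) (c := y 0)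
        (by norm_num) (by norm_num)
      replace h4 := h6.symm.trans_le h4
      have h5 : (volume.restrict (Ioo 0 T)).real univ = T := by
        simp [hT.le]
      rw [h5] at h4
      rw [div_mul_eq_mul_div, le_div_iff₀ (by positivity)]
      simpa using h4)

/-- The derivative as a continuous linear operator on `W_T`. -/
def dotL : WT T n →L[ℝ] L2 T n :=
  ContinuousLinearMap.snd ℝ _ _ ∘L
    (WithLp.prodContinuousLinearEquiv 2 ℝ (L2 T n) (L2 T n)).toContinuousLinearMap ∘L
      (sobolev T n).subtypeL

/-- The embedding of `W_T` into the continuous functions on `[0, T]`. -/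
def toC (hT : 0 < T) : WT T n →L[ℝ] C(Icc (0 : ℝ) T, Euc n) :=
  constC ∘L val0 hT + primL2 hT ∘L dotL

theorem toC_eq (hT : 0 < T) (y : WT T n) : toC hT y = constC (y 0) + primL2 hT y.dot := rfl

theorem toC_apply (hT : 0 < T) (y : WT T n) (t : Icc (0 : ℝ) T) : toC hT y t = y t := by
  rw [toC_eq, WT.val_eq y t]
  simp [primL2_apply]

theorem ext_toC (hT : 0 < T) (y : WT T n) {t : ℝ} (ht : t ∈ Icc 0 T) :
    ext hT (toC hT y) t = y t := by
  rw [ext_apply hT _ ht, toC_apply]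

theorem toC_mkWT (hT : 0 < T) (w : Euc n × L2 T n) :
    toC hT (mkWT hT w) = constC w.1 + primL2 hT w.2 := by
  rw [toC_eq, mkWT_zero, mkWT_dot]

end Sobolev

/-! ### Differentiability on the slab `[0, T] × X` -/

section Slab

variable {T : ℝ} {W X Y F : Type*}
  [NormedAddCommGroup W] [NormedSpace ℝ W]
  [NormedAddCommGroup X] [NormedSpace ℝ X] [NormedAddCommGroup Y] [NormedSpace ℝ Y]
  [NormedAddCommGroup F] [NormedSpace ℝ F]

/-- `H` is of class `C^k` on `[0, T] × X`. -/
def SlabDiff (T : ℝ) (k : ℕ∞ω) (H : ℝ → X → F) : Prop :=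
  ContDiffOn ℝ k (fun x : ℝ × X => H x.1 x.2) (Icc 0 T ×ˢ univ)

namespace SlabDiff

theorem of_le {k l : ℕ∞ω} {H : ℝ → X → F} (h : SlabDiff T l H) (hkl : k ≤ l) : SlabDiff T k H :=
  ContDiffOn.of_le h hkl

theorem comp {k : ℕ∞ω} {H : ℝ → Y → F} {G : ℝ → X → Y} (h : SlabDiff T k H)
    (hG : SlabDiff T k G) : SlabDiff T k (fun t x => H t (G t x)) :=
  ContDiffOn.comp (s := Icc 0 T ×ˢ univ) h (contDiff_fst.contDiffOn.prodMk hG)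
    fun _ hx => ⟨hx.1, mem_univ _⟩

theorem clm (k : ℕ∞ω) (L : X →L[ℝ] F) : SlabDiff T k (fun _ x => L x) :=
  (L.contDiff.comp contDiff_snd).contDiffOn

theorem clm_comp {k : ℕ∞ω} {G : ℝ → X → Y} (L : Y →L[ℝ] F) (hG : SlabDiff T k G) :
    SlabDiff T k (fun t x => L (G t x)) :=
  L.contDiff.comp_contDiffOn hG

theorem clm_apply {k : ℕ∞ω} {B : ℝ → W → X →L[ℝ] F} {G : ℝ → W → X} (hB : SlabDiff T k B)
    (hG : SlabDiff T k G) : SlabDiff T k (fun t x => B t x (G t x)) :=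
  ContDiffOn.clm_apply hB hG

theorem add {k : ℕ∞ω} {H G : ℝ → X → F} (h : SlabDiff T k H) (hG : SlabDiff T k G) :
    SlabDiff T k (fun t x => H t x + G t x) :=
  ContDiffOn.add h hG

theorem contDiff {k : ℕ∞ω} {H : ℝ → X → F} (h : SlabDiff T k H) {t : ℝ} (ht : t ∈ Icc 0 T) :
    ContDiff ℝ k (H t) := by
  rw [← contDiffOn_univ]
  exact ContDiffOn.comp (s := univ) h (f := fun x => (t, x)) (by fun_prop)
    fun x _ => ⟨ht, mem_univ _⟩

theorem hasFDerivAt {k : ℕ∞ω} {H : ℝ → X → F} (h : SlabDiff T k H) (hk : 1 ≤ k) {t : ℝ}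
    (ht : t ∈ Icc 0 T) (x : X) : HasFDerivAt (H t) (fderiv ℝ (H t) x) x :=
  (((h.of_le hk).contDiff ht).differentiable one_ne_zero x).hasFDerivAt

/-- On the closed slab only the derivative within the set is available, and it is `C^k` because the
slab has unique differentials. A slice at fixed time is all of `X`, so restricting this derivative
to the state directions gives the ordinary derivative in the state, also at `t = 0` and `t = T`. -/
theorem fderiv (hT : 0 < T) {k l : ℕ∞ω} {H : ℝ → X → F} (h : SlabDiff T l H) (hk : k + 1 ≤ l) :
    SlabDiff T k (fun t x => fderiv ℝ (H t) x) := by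
  have hS : UniqueDiffOn ℝ (Icc 0 T ×ˢ (univ : Set X)) :=
    (uniqueDiffOn_Icc hT).prod uniqueDiffOn_univ
  have h1 := ContDiffOn.fderivWithin h hS hk
  have h2 : ContDiffOn ℝ k (fun x : ℝ × X =>
      (fderivWithin ℝ (fun x : ℝ × X => H x.1 x.2) (Icc 0 T ×ˢ univ) x) ∘L
        ContinuousLinearMap.inr ℝ ℝ X) (Icc 0 T ×ˢ univ) :=
    h1.clm_comp contDiffOn_const
  refine ContDiffOn.congr h2 fun x hx => ?_
  have hd : DifferentiableOn ℝ (fun x : ℝ × X => H x.1 x.2) (Icc 0 T ×ˢ univ) :=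
    ContDiffOn.differentiableOn (h.of_le ((le_add_self).trans hk)) one_ne_zero
  have h3 := (hd x hx).hasFDerivWithinAt.comp (s := univ) x.2
    (f := fun y => (x.1, y)) (f' := ContinuousLinearMap.inr ℝ ℝ X)
    ((hasFDerivAt_prodMk_right x.1 x.2).hasFDerivWithinAt) fun y _ => ⟨hx.1, mem_univ _⟩
  rw [hasFDerivWithinAt_univ] at h3
  exact h3.fderiv

theorem continuous_uncurry {k : ℕ∞ω} {H : ℝ → X → F} (h : SlabDiff T k H) :
    Continuous (Function.uncurry fun (t : Icc (0 : ℝ) T) x => H t x) := by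
  have h1 : ContinuousOn (fun x : ℝ × X => H x.1 x.2) (Icc 0 T ×ˢ univ) := ContDiffOn.continuousOn h
  exact h1.comp_continuous (f := fun x : Icc (0 : ℝ) T × X => ((x.1 : ℝ), x.2)) (by fun_prop)
    fun x => ⟨x.1.2, mem_univ _⟩

theorem fderiv_right (hT : 0 < T) {k l : ℕ∞ω} {H : ℝ → X × Y → F} (h : SlabDiff T l H)
    (hk : k + 1 ≤ l) :
    SlabDiff T k (fun t (q : X × Y) => _root_.fderiv ℝ (fun y => H t (q.1, y)) q.2) := by
  have h1 : SlabDiff T k (fun t q => (_root_.fderiv ℝ (H t) q) ∘L ContinuousLinearMap.inr ℝ X Y) :=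
    ContDiffOn.clm_comp (h.fderiv hT hk) contDiffOn_const
  refine ContDiffOn.congr h1 fun x hx => ?_
  exact ((h.hasFDerivAt ((le_add_self).trans hk) hx.1 x.2).comp x.2.2
    (hasFDerivAt_prodMk_right x.2.1 x.2.2)).fderiv

theorem fderiv_left (hT : 0 < T) {k l : ℕ∞ω} {H : ℝ → X × Y → F} (h : SlabDiff T l H)
    (hk : k + 1 ≤ l) :
    SlabDiff T k (fun t (q : X × Y) => _root_.fderiv ℝ (fun x => H t (x, q.2)) q.1) := by
  have h1 : SlabDiff T k (fun t q => (_root_.fderiv ℝ (H t) q) ∘L ContinuousLinearMap.inl ℝ X Y) :=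
    ContDiffOn.clm_comp (h.fderiv hT hk) contDiffOn_const
  refine ContDiffOn.congr h1 fun x hx => ?_
  exact ((h.hasFDerivAt ((le_add_self).trans hk) hx.1 x.2).comp x.2.1
    (hasFDerivAt_prodMk_left x.2.1 x.2.2)).fderiv

theorem fderiv_apply {k : ℕ∞ω} {H : ℝ → X × Y → F} (h : SlabDiff T k H) (hk : 1 ≤ k)
    {t : ℝ} (ht : t ∈ Icc 0 T) (q δ : X × Y) :
    _root_.fderiv ℝ (H t) q δ = _root_.fderiv ℝ (fun x => H t (x, q.2)) q.1 δ.1 +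
      _root_.fderiv ℝ (fun y => H t (q.1, y)) q.2 δ.2 := by
  have h1 := h.hasFDerivAt hk ht q
  have e1 : HasFDerivAt (fun x => H t (x, q.2)) _ q.1 :=
    h1.comp q.1 (hasFDerivAt_prodMk_left q.1 q.2)
  have e2 : HasFDerivAt (fun y => H t (q.1, y)) _ q.2 :=
    h1.comp q.2 (hasFDerivAt_prodMk_right q.1 q.2)
  rw [e1.fderiv, e2.fderiv]
  simp [← map_add]

theorem nem_apply {k : ℕ∞ω} {H : ℝ → X → F} (h : SlabDiff T k H) (u : C(Icc (0 : ℝ) T, X))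
    (t : Icc (0 : ℝ) T) : nem (fun (t : Icc (0 : ℝ) T) => H t) u t = H t (u t) :=
  LearnFeedback.nem_apply h.continuous_uncurry u t

theorem ext_nem {k : ℕ∞ω} {H : ℝ → X → F} (hT : 0 < T) (h : SlabDiff T k H)
    (u : C(Icc (0 : ℝ) T, X)) {t : ℝ} (ht : t ∈ Icc 0 T) :
    ext hT (nem (fun (t : Icc (0 : ℝ) T) => H t) u) t = H t (ext hT u t) := by
  rw [ext_apply hT _ ht, ext_apply hT _ ht, h.nem_apply]

theorem hasFDerivAt_nem (hT : 0 < T) {k : ℕ∞ω} {H : ℝ → X → F} (h : SlabDiff T k H) (hk : 1 ≤ k)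
    (u : C(Icc (0 : ℝ) T, X)) :
    HasFDerivAt (nem (fun (t : Icc (0 : ℝ) T) => H t))
      (mulC (nem (fun (t : Icc (0 : ℝ) T) => _root_.fderiv ℝ (H t)) u)) u :=
  LearnFeedback.hasFDerivAt_nem h.continuous_uncurry
    (h.fderiv (k := 0) hT (by simpa using hk)).continuous_uncurry
    (fun t x => h.hasFDerivAt hk t.2 x) u

theorem contDiff_nem (hT : 0 < T) {k : ℕ∞ω} {H : ℝ → X → F} (h : SlabDiff T k H) (hk : 1 ≤ k) :
    ContDiff ℝ 1 (nem (fun (t : Icc (0 : ℝ) T) => H t)) :=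
  LearnFeedback.contDiff_nem h.continuous_uncurry
    (h.fderiv (k := 0) hT (by simpa using hk)).continuous_uncurry
    (fun t x => h.hasFDerivAt hk t.2 x)

end SlabDiff

end Slab

/-! ### Adjoint, Riesz map and flip as real-linear operators -/

section Adjoint

variable {X Y : Type*} [NormedAddCommGroup X] [InnerProductSpace ℝ X] [CompleteSpace X]
  [NormedAddCommGroup Y] [InnerProductSpace ℝ Y] [CompleteSpace Y]

/-- The adjoint as a linear operator. -/
def adjL : (X →L[ℝ] Y) →L[ℝ] (Y →L[ℝ] X) :=
  LinearMap.mkContinuous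
    { toFun := fun B => ContinuousLinearMap.adjoint B
      map_add' := fun B C => map_add _ B C
      map_smul' := fun c B => by simp } 1 (fun B => by simp)

theorem adjL_apply (B : X →L[ℝ] Y) : adjL B = ContinuousLinearMap.adjoint B := rfl

/-- The Riesz isomorphism from functionals to vectors as a linear operator. -/
def rieszL : (X →L[ℝ] ℝ) →L[ℝ] X :=
  LinearMap.mkContinuous
    { toFun := fun l => (InnerProductSpace.toDual ℝ X).symm l
      map_add' := fun l k => map_add _ l k
      map_smul' := fun c l => by simp } 1 (fun l => by simp)

theorem inner_gradient (f : X → ℝ) (x δ : X) : inner ℝ (gradient f x) δ = fderiv ℝ f x δ := by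
  simp [gradient]

/-- Exchanging the arguments of a bilinear map as a linear operator. -/
def flipL {X Y Z : Type*} [NormedAddCommGroup X] [NormedSpace ℝ X] [NormedAddCommGroup Y]
    [NormedSpace ℝ Y] [NormedAddCommGroup Z] [NormedSpace ℝ Z] :
    (X →L[ℝ] Y →L[ℝ] Z) →L[ℝ] (Y →L[ℝ] X →L[ℝ] Z) :=
  LinearMap.mkContinuous
    { toFun := fun B : X →L[ℝ] Y →L[ℝ] Z => B.flip
      map_add' := fun _ _ => rfl
      map_smul' := fun _ _ => rfl } 1 (fun B => by
      rw [one_mul]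
      exact (ContinuousLinearMap.opNorm_flip B).le)

end Adjoint

/-! ### Regularity of the data -/

namespace LearningProblem

open ContinuousLinearMap (adjoint)

variable {n m N : ℕ} {R : Type*} [NormedAddCommGroup R] [InnerProductSpace ℝ R]
  [FiniteDimensional ℝ R] (P : LearningProblem n m N R)

/-- The derivative count starts here. `V` of class `C⁴` gives `∂_y V` of class `C³`; `f` and `g` of
class `C²` limit `F` to `C²` and `A` to `C¹`, which is just enough for the superposition operator of
`A` to be `C¹`. -/
theorem slabDiff_V : SlabDiff P.T 4 (fun t (q : R × Euc n) => P.V q.1 t q.2) :=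
  (P.V_smooth.comp (f := fun x : ℝ × R × Euc n => (x.2.1, x.1, x.2.2))
    (by fun_prop)).contDiffOn

theorem slabDiff_gradV : SlabDiff P.T 3 (fun t (q : R × Euc n) => P.gradV q.1 t q.2) :=
  (P.slabDiff_V.fderiv_right P.T_pos (k := 3) (by norm_num)).clm_comp rieszL

theorem slabDiff_gradθV : SlabDiff P.T 3 (fun t (q : R × Euc n) => P.gradθV q.1 t q.2) :=
  (P.slabDiff_V.fderiv_left P.T_pos (k := 3) (by norm_num)).clm_comp rieszL

theorem slabDiff_hessV : SlabDiff P.T 2 (fun t (q : R × Euc n) => P.hessV q.1 t q.2) :=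
  P.slabDiff_gradV.fderiv_right P.T_pos (k := 2) (by norm_num)

theorem slabDiff_dθgradV : SlabDiff P.T 2 (fun t (q : R × Euc n) => P.dθgradV q.1 t q.2) :=
  P.slabDiff_gradV.fderiv_left P.T_pos (k := 2) (by norm_num)

theorem slabDiff_f : SlabDiff P.T 2 (fun t (q : R × Euc n) => P.f t q.2) :=
  SlabDiff.comp (H := P.f) P.f_smooth (SlabDiff.clm 2 (ContinuousLinearMap.snd ℝ R (Euc n)))

theorem slabDiff_g : SlabDiff P.T 2 (fun t (q : R × Euc n) => P.g t q.2) :=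
  SlabDiff.comp (H := P.g) P.g_smooth (SlabDiff.clm 2 (ContinuousLinearMap.snd ℝ R (Euc n)))

theorem slabDiff_Df : SlabDiff P.T 1 (fun t (q : R × Euc n) => fderiv ℝ (P.f t) q.2) :=
  P.slabDiff_f.fderiv_right P.T_pos (k := 1) (by norm_num)

theorem slabDiff_Dg : SlabDiff P.T 1 (fun t (q : R × Euc n) => fderiv ℝ (P.g t) q.2) :=
  P.slabDiff_g.fderiv_right P.T_pos (k := 1) (by norm_num)

theorem slabDiff_F : SlabDiff P.T 2 (fun t (q : R × Euc n) => P.F q.1 t q.2) :=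
  ((P.slabDiff_g.clm_comp adjL).clm_apply (P.slabDiff_gradV.of_le (by norm_num))).clm_comp
    (-(1 / P.β) • ContinuousLinearMap.id ℝ (Euc m))

theorem slabDiff_dyF : SlabDiff P.T 1 (fun t (q : R × Euc n) => P.dyF q.1 t q.2) :=
  P.slabDiff_F.fderiv_right P.T_pos (k := 1) (by norm_num)

theorem slabDiff_dθF : SlabDiff P.T 1 (fun t (q : R × Euc n) => P.dθF q.1 t q.2) :=
  P.slabDiff_F.fderiv_left P.T_pos (k := 1) (by norm_num)

/-- The right-hand side of the closed loop state equation. -/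
def rhs (t : ℝ) (q : R × Euc n) : Euc n := P.f t q.2 + P.g t q.2 (P.F q.1 t q.2)

theorem slabDiff_rhs : SlabDiff P.T 2 P.rhs :=
  P.slabDiff_f.add (P.slabDiff_g.clm_apply P.slabDiff_F)

/-- The map `δy ↦ D_y f(t, y) δy + [D_y g(t, y) δy] F_θ(t, y)`. -/
def At (t : ℝ) (q : R × Euc n) : Euc n →L[ℝ] Euc n :=
  fderiv ℝ (P.f t) q.2 + (fderiv ℝ (P.g t) q.2).flip (P.F q.1 t q.2)

theorem A_eq (θ : R) (t : ℝ) (y : Euc n) : P.A θ t y = adjL (P.At t (θ, y)) := rfl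

theorem adjoint_A (θ : R) (t : ℝ) (y : Euc n) : adjoint (P.A θ t y) = P.At t (θ, y) := by
  rw [A_eq, adjL_apply, ContinuousLinearMap.adjoint_adjoint]

theorem slabDiff_At : SlabDiff P.T 1 P.At := by
  have h : SlabDiff P.T 1 (fun t (q : R × Euc n) => (fderiv ℝ (P.g t) q.2).flip) :=
    SlabDiff.clm_comp (F := Euc m →L[ℝ] Euc n →L[ℝ] Euc n) flipL P.slabDiff_Dg
  exact P.slabDiff_Df.add (h.clm_apply (P.slabDiff_F.of_le (by norm_num)))

theorem slabDiff_A : SlabDiff P.T 1 (fun t (q : R × Euc n) => P.A q.1 t q.2) :=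
  P.slabDiff_At.clm_comp adjL

theorem slabDiff_DA : SlabDiff P.T 0 (fun t (q : R × Euc n) => fderiv ℝ (P.A q.1 t) q.2) :=
  P.slabDiff_A.fderiv_right P.T_pos (k := 0) (by norm_num)

variable {P}

/-- `At` gathers the terms in which the feedback value is frozen. The reaction of the feedback to
the state is kept apart, since it is the source of the term `D_yFᵀ gᵀ ζ` in the costate equation. -/
theorem fderiv_rhs {t : ℝ} (ht : t ∈ Icc 0 P.T) (q δ : R × Euc n) :
    fderiv ℝ (P.rhs t) q δ = P.At t q δ.2 + P.g t q.2 (P.dyF q.1 t q.2 δ.2) +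
      P.g t q.2 (P.dθF q.1 t q.2 δ.1) := by
  have hf := (SlabDiff.hasFDerivAt (H := P.f) P.f_smooth (by norm_num) ht q.2).comp q hasFDerivAt_snd
  have hg := (SlabDiff.hasFDerivAt (H := P.g) P.g_smooth (by norm_num) ht q.2).comp q hasFDerivAt_snd
  have hF := P.slabDiff_F.hasFDerivAt (by norm_num) ht q
  have h := hf.add (hg.clm_apply hF)
  have h' : HasFDerivAt (P.rhs t) _ q := h
  rw [h'.fderiv]
  have e := P.slabDiff_F.fderiv_apply (by norm_num) ht q δ
  simp only [add_apply, ContinuousLinearMap.comp_apply,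
    ContinuousLinearMap.flip_apply, At, e, map_add, ContinuousLinearMap.coe_snd', dyF, dθF,
    Function.comp_apply]
  abel

/-- The parameter enters `A` only through the feedback, and `A` is affine in the feedback value. The
state derivative is left unexpanded, in the form used by `dyA`. -/
theorem fderiv_A {t : ℝ} (ht : t ∈ Icc 0 P.T) (q δ : R × Euc n) :
    fderiv ℝ (fun q : R × Euc n => P.A q.1 t q.2) q δ = fderiv ℝ (P.A q.1 t) q.2 δ.2 +
      adjL ((fderiv ℝ (P.g t) q.2).flip (P.dθF q.1 t q.2 δ.1)) := by
  rw [P.slabDiff_A.fderiv_apply le_rfl ht q δ, add_comm]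
  congr 1
  have hF := P.slabDiff_F.hasFDerivAt (by norm_num) ht q
  have hF' : HasFDerivAt (fun θ => P.F θ t q.2) (P.dθF q.1 t q.2) q.1 :=
    (HasFDerivAt.comp (f := fun θ => (θ, q.2)) q.1 hF
      (hasFDerivAt_prodMk_left q.1 q.2)).differentiableAt.hasFDerivAt
  have h := (adjL (X := Euc n) (Y := Euc n)).hasFDerivAt.comp q.1
    (((fderiv ℝ (P.g t) q.2).flip.hasFDerivAt.comp q.1 hF').const_add (fderiv ℝ (P.f t) q.2))
  have h' : HasFDerivAt (fun θ => P.A θ t q.2) _ q.1 := h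
  rw [h'.fderiv]
  rfl

end LearningProblem

/-! ### Smoothness of linear operators on spaces of continuous functions -/

section OperatorSmoothness

variable {K X F G : Type*} [TopologicalSpace K] [CompactSpace K]
  [NormedAddCommGroup X] [NormedSpace ℝ X] [NormedAddCommGroup F] [NormedSpace ℝ F]
  [NormedAddCommGroup G] [NormedSpace ℝ G] {k : ℕ∞ω}

theorem contDiff_fromC (L : C(K, X) →L[ℝ] G) : ContDiff ℝ k L :=
  ContinuousLinearMap.contDiff (E := C(K, X)) (F := G) L

theorem contDiff_intoC (L : G →L[ℝ] C(K, F)) : ContDiff ℝ k L :=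
  ContinuousLinearMap.contDiff (E := G) (F := C(K, F)) L

theorem contDiff_betweenC (L : C(K, X) →L[ℝ] C(K, F)) : ContDiff ℝ k L :=
  ContinuousLinearMap.contDiff (E := C(K, X)) (F := C(K, F)) L

theorem hasFDerivAt_fromC (L : C(K, X) →L[ℝ] G) (u : C(K, X)) : HasFDerivAt L L u :=
  ContinuousLinearMap.hasFDerivAt (E := C(K, X)) (F := G) L

theorem hasFDerivAt_intoC (L : G →L[ℝ] C(K, F)) (u : G) : HasFDerivAt L L u :=
  ContinuousLinearMap.hasFDerivAt (E := G) (F := C(K, F)) L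

theorem hasFDerivAt_betweenC (L : C(K, X) →L[ℝ] C(K, F)) (u : C(K, X)) : HasFDerivAt L L u :=
  ContinuousLinearMap.hasFDerivAt (E := C(K, X)) (F := C(K, F)) L

theorem contDiff_mulC : ContDiff ℝ k (mulC : C(K, X →L[ℝ] F) →L[ℝ] C(K, X) →L[ℝ] C(K, F)) := by
  have h := ContinuousLinearMap.contDiff (𝕜 := ℝ) (n := k) (E := C(K, X →L[ℝ] F))
    (F := C(K, X) →L[ℝ] C(K, F)) (mulC (K := K) (X := X) (F := F))
  exact h

end OperatorSmoothness

/-! ### Linear differential equations with terminal or initial values -/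

section LinearODE

variable {T : ℝ} {n : ℕ}

/-- The space of continuous functions on `[0, T]` with values in `ℝⁿ`. -/
abbrev CE (T : ℝ) (n : ℕ) : Type := C(Icc (0 : ℝ) T, Euc n)

/-- Continuous operator functions on `[0, T]`. -/
abbrev CO (T : ℝ) (n : ℕ) : Type := C(Icc (0 : ℝ) T, Euc n →L[ℝ] Euc n)

theorem inverse_apply_of_isUnit {E : Type*} [NormedAddCommGroup E] [NormedSpace ℝ E]
    {L : E →L[ℝ] E} (h : IsUnit L) (x : E) : L (Ring.inverse L x) = x := by
  rw [← mul_apply_eq_comp, Ring.mul_inverse_cancel _ h]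
  rfl

theorem eq_inverse_apply_of_isUnit {E : Type*} [NormedAddCommGroup E] [NormedSpace ℝ E]
    {L : E →L[ℝ] E} (h : IsUnit L) {x y : E} (hx : L x = y) : x = Ring.inverse L y := by
  rw [← hx, ← mul_apply_eq_comp, Ring.inverse_mul_cancel _ h]
  rfl

theorem isInvertible_of_isUnit {E : Type*} [NormedAddCommGroup E] [NormedSpace ℝ E]
    {L : E →L[ℝ] E} (h : IsUnit L) : L.IsInvertible := by
  obtain ⟨u, rfl⟩ := h
  exact ⟨ContinuousLinearEquiv.unitsEquiv ℝ E u, rfl⟩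

/-- The solution of the Volterra equation `w(t) = c + ∫ₜᵀ (B w + b)`. -/
def bwdC (hT : 0 < T) (B : CO T n) (b : L2 T n) (c : Euc n) : CE T n :=
  Ring.inverse (1 - bprim hT ∘L mulC B) (constC c + flipC hT (primL2 hT b))

theorem bwdC_spec (hT : 0 < T) (B : CO T n) (b : L2 T n) (c : Euc n) :
    bwdC hT B b c - flipC hT (primL2 hT (toL2 hT (mulC B (bwdC hT B b c)) + b)) = constC c := by
  have h := inverse_apply_of_isUnit (isUnit_one_sub_bprim hT B)
    (constC c + flipC hT (primL2 hT b))
  change bwdC hT B b c - flipC hT (fprim hT (mulC B (bwdC hT B b c))) = _ at h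
  rw [map_add, map_add, primL2_toL2, ← sub_sub, h, add_sub_cancel_right]

/-- The solution of `-ẇ = B w + b`, `w(T) = c`. -/
def bwdSol (hT : 0 < T) (B : CO T n) (b : L2 T n) (c : Euc n) : WT T n :=
  mkWT hT (bwdC hT B b c ⟨0, le_rfl, hT.le⟩, -(toL2 hT (mulC B (bwdC hT B b c)) + b))

/-- `bwdSol` is assembled from its value at `0`, while the data are terminal. Comparing `bwdC_spec`
at `0` and at `t` eliminates the terminal value. -/
theorem toC_bwdSol (hT : 0 < T) (B : CO T n) (b : L2 T n) (c : Euc n) :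
    toC hT (bwdSol hT B b c) = bwdC hT B b c := by
  have h := bwdC_spec hT B b c
  have h0 := congrArg (fun u : CE T n => u ⟨0, le_rfl, hT.le⟩) h
  ext1 t
  have ht := congrArg (fun u : CE T n => u t) h
  simp only [ContinuousMap.sub_apply, flipC_apply, constC_apply] at h0 ht
  have hz : primL2 hT (toL2 hT (mulC B (bwdC hT B b c)) + b) ⟨0, le_rfl, hT.le⟩ = 0 := by
    rw [primL2_apply]
    simp
  rw [hz, sub_zero, sub_eq_iff_eq_add] at h0
  rw [sub_eq_iff_eq_add] at ht
  rw [bwdSol, toC_mkWT, map_neg]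
  simp only [ContinuousMap.add_apply, ContinuousMap.neg_apply, constC_apply]
  rw [h0, ht]
  abel

theorem bwdSol_dot (hT : 0 < T) (B : CO T n) (b : L2 T n) (c : Euc n) :
    ∀ᵐ t ∂(volume.restrict (Ioo 0 T)),
      -(bwdSol hT B b c).dot t = ext hT B t (bwdSol hT B b c t) + b t := by
  rw [bwdSol, mkWT_dot, ← bwdSol]
  filter_upwards [Lp.coeFn_neg (toL2 hT (mulC B (bwdC hT B b c)) + b),
    Lp.coeFn_add (toL2 hT (mulC B (bwdC hT B b c))) b,
    toL2_ae hT (mulC B (bwdC hT B b c)), ae_restrict_mem measurableSet_Ioo] with t h1 h2 h3 ht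
  have ht' := Ioo_subset_Icc_self ht
  rw [h1, Pi.neg_apply, h2, Pi.add_apply, h3, neg_neg, ext_apply hT _ ht', ext_apply hT _ ht',
    mulC_apply, ← toC_bwdSol, toC_apply]

theorem bwdSol_end (hT : 0 < T) (B : CO T n) (b : L2 T n) (c : Euc n) :
    bwdSol hT B b c T = c := by
  have h := congrArg (fun u : CE T n => u ⟨T, hT.le, le_rfl⟩) (bwdC_spec hT B b c)
  simp only [ContinuousMap.sub_apply, flipC_apply, constC_apply, sub_self, sub_zero] at h
  rw [← toC_bwdSol, toC_apply] at h
  exact h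

/-- A solution in `W_T` satisfies the integrated equation, whose operator is invertible. So its
continuous representative is `bwdC`, and this fixes both its initial value and its derivative. -/
theorem eq_bwdSol (hT : 0 < T) {B : CO T n} {b : L2 T n} {c : Euc n} {w : WT T n}
    (h : ∀ᵐ t ∂(volume.restrict (Ioo 0 T)), -w.dot t = ext hT B t (w t) + b t)
    (hc : w T = c) : w = bwdSol hT B b c := by
  have hd : w.dot = -(toL2 hT (mulC B (toC hT w)) + b) := by
    apply Lp.ext
    filter_upwards [h, Lp.coeFn_neg (toL2 hT (mulC B (toC hT w)) + b),
      Lp.coeFn_add (toL2 hT (mulC B (toC hT w))) b,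
      toL2_ae hT (mulC B (toC hT w)), ae_restrict_mem measurableSet_Ioo] with t h0 h1 h2 h3 ht
    have ht' := Ioo_subset_Icc_self ht
    rw [h1, Pi.neg_apply, h2, Pi.add_apply, h3, ext_apply hT _ ht', mulC_apply, toC_apply,
      ← ext_apply hT B ht', ← h0, neg_neg]
  have hw : toC hT w = bwdC hT B b c := by
    refine eq_inverse_apply_of_isUnit (isUnit_one_sub_bprim hT B) ?_
    have h1 : flipC hT (toC hT w) = flipC hT (primL2 hT w.dot) := by
      ext1 t
      simp [toC_eq]
    have h2 : flipC hT (toC hT w) = constC c - toC hT w := by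
      ext1 t
      rw [flipC_apply, toC_apply, ContinuousMap.sub_apply, constC_apply, ← hc]
    change toC hT w - flipC hT (fprim hT (mulC B (toC hT w))) = _
    rw [← primL2_toL2, sub_eq_iff_eq_add, add_assoc, ← map_add, ← map_add, add_comm b,
      ← neg_neg (toL2 hT (mulC B (toC hT w)) + b), ← hd, map_neg, map_neg, ← h1, h2]
    abel
  have h0 : w 0 = bwdC hT B b c ⟨0, le_rfl, hT.le⟩ := by
    rw [← hw, toC_apply]
  rw [← mkWT_eta hT w, hd, hw, h0, bwdSol]

/-- The solution of the Volterra equation `w(t) = c + ∫₀ᵗ (B w + b)`. -/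
def fwdC (hT : 0 < T) (B : CO T n) (b : L2 T n) (c : Euc n) : CE T n :=
  Ring.inverse (1 - fprim hT ∘L mulC B) (constC c + primL2 hT b)

/-- The solution of `ẇ = B w + b`, `w(0) = c`. -/
def fwdSol (hT : 0 < T) (B : CO T n) (b : L2 T n) (c : Euc n) : WT T n :=
  mkWT hT (c, toL2 hT (mulC B (fwdC hT B b c)) + b)

theorem toC_fwdSol (hT : 0 < T) (B : CO T n) (b : L2 T n) (c : Euc n) :
    toC hT (fwdSol hT B b c) = fwdC hT B b c := by
  have h := inverse_apply_of_isUnit (isUnit_one_sub_fprim hT B) (constC c + primL2 hT b)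
  change fwdC hT B b c - fprim hT (mulC B (fwdC hT B b c)) = _ at h
  rw [fwdSol, toC_mkWT, map_add, primL2_toL2]
  rw [sub_eq_iff_eq_add] at h
  refine Eq.trans ?_ h.symm
  dsimp only
  abel

theorem fwdSol_dot (hT : 0 < T) (B : CO T n) (b : L2 T n) (c : Euc n) :
    ∀ᵐ t ∂(volume.restrict (Ioo 0 T)),
      (fwdSol hT B b c).dot t = ext hT B t (fwdSol hT B b c t) + b t := by
  rw [fwdSol, mkWT_dot, ← fwdSol]
  filter_upwards [Lp.coeFn_add (toL2 hT (mulC B (fwdC hT B b c))) b,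
    toL2_ae hT (mulC B (fwdC hT B b c)), ae_restrict_mem measurableSet_Ioo] with t h2 h3 ht
  have ht' := Ioo_subset_Icc_self ht
  rw [h2, Pi.add_apply, h3, ext_apply hT _ ht', ext_apply hT _ ht',
    mulC_apply, ← toC_fwdSol, toC_apply]

theorem fwdSol_zero (hT : 0 < T) (B : CO T n) (b : L2 T n) (c : Euc n) :
    fwdSol hT B b c 0 = c :=
  mkWT_zero hT _

theorem eq_fwdSol (hT : 0 < T) {B : CO T n} {b : L2 T n} {c : Euc n} {w : WT T n}
    (h : ∀ᵐ t ∂(volume.restrict (Ioo 0 T)), w.dot t = ext hT B t (w t) + b t)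
    (hc : w 0 = c) : w = fwdSol hT B b c := by
  have hd : w.dot = toL2 hT (mulC B (toC hT w)) + b := by
    apply Lp.ext
    filter_upwards [h, Lp.coeFn_add (toL2 hT (mulC B (toC hT w))) b,
      toL2_ae hT (mulC B (toC hT w)), ae_restrict_mem measurableSet_Ioo] with t h0 h2 h3 ht
    have ht' := Ioo_subset_Icc_self ht
    rw [h2, Pi.add_apply, h3, ext_apply hT _ ht', mulC_apply, toC_apply,
      ← ext_apply hT B ht', ← h0]
  have hw : toC hT w = fwdC hT B b c := by
    refine eq_inverse_apply_of_isUnit (isUnit_one_sub_fprim hT B) ?_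
    change toC hT w - fprim hT (mulC B (toC hT w)) = _
    rw [← primL2_toL2, sub_eq_iff_eq_add, add_assoc, ← map_add, add_comm b, ← hd, ← hc, toC_eq]
  rw [← mkWT_eta hT w, hd, hw, hc, fwdSol]

/-- `1 - bprim ∘ mulC B` is affine in `B` and always a unit, and inversion is smooth at units. So
the dependence is `C¹` on the whole space, with no restriction to small coefficients. -/
theorem contDiff_bwdC (hT : 0 < T) :
    ContDiff ℝ 1 (fun x : CO T n × L2 T n × Euc n => bwdC hT x.1 x.2.1 x.2.2) := by
  have h1 : ContDiff ℝ 1 (fun x : CO T n × L2 T n × Euc n =>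
      (1 - bprim hT ∘L mulC x.1 : CE T n →L[ℝ] CE T n)) :=
    contDiff_const.sub (contDiff_const.clm_comp (contDiff_mulC.comp contDiff_fst))
  have h2 : ContDiff ℝ 1 (fun x : CO T n × L2 T n × Euc n =>
      (constC x.2.2 + flipC hT (primL2 hT x.2.1) : CE T n)) :=
    ((contDiff_intoC constC).comp (contDiff_snd.comp contDiff_snd)).add
      ((contDiff_intoC (flipC hT ∘L primL2 hT)).comp (contDiff_fst.comp contDiff_snd))
  have h3 : ContDiff ℝ 1 (fun x : CO T n × L2 T n × Euc n =>
      Ring.inverse (1 - bprim hT ∘L mulC x.1 : CE T n →L[ℝ] CE T n)) := by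
    rw [contDiff_iff_contDiffAt]
    intro x
    obtain ⟨a, ha⟩ := isUnit_one_sub_bprim hT x.1
    have h4 : ContDiffAt ℝ 1 Ring.inverse (1 - bprim hT ∘L mulC x.1 : CE T n →L[ℝ] CE T n) := by
      rw [← ha]
      exact contDiffAt_ringInverse ℝ (R := CE T n →L[ℝ] CE T n) a
    exact ContDiffAt.comp x h4 h1.contDiffAt
  exact h3.clm_apply h2

theorem contDiff_bwdSol (hT : 0 < T) :
    ContDiff ℝ 1 (fun x : CO T n × L2 T n × Euc n => bwdSol hT x.1 x.2.1 x.2.2) := by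
  have h := contDiff_bwdC (n := n) hT
  have h1 : ContDiff ℝ 1 (fun x : CO T n × L2 T n × Euc n =>
      mulC x.1 (bwdC hT x.1 x.2.1 x.2.2)) :=
    ContDiff.clm_apply (F := CE T n) (G := CE T n)
      ((contDiff_mulC (K := Icc (0 : ℝ) T) (X := Euc n) (F := Euc n)).comp contDiff_fst) h
  have h2 : ContDiff ℝ 1 (fun x : CO T n × L2 T n × Euc n =>
      (bwdC hT x.1 x.2.1 x.2.2 ⟨0, le_rfl, hT.le⟩,
        -(toL2 hT (mulC x.1 (bwdC hT x.1 x.2.1 x.2.2)) + x.2.1))) :=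
    ((contDiff_fromC (evalC _)).comp h).prodMk
      (((contDiff_fromC (toL2 hT)).comp h1).add (contDiff_fst.comp contDiff_snd)).neg
  exact (mkWT hT).contDiff.comp h2

end LinearODE

/-! ### Pairing a constant parameter with a state -/

section WithParam

variable {T : ℝ} {R : Type*} [NormedAddCommGroup R] [NormedSpace ℝ R] {n : ℕ}

/-- The function `t ↦ (θ, u(t))`. -/
def withParam : R × CE T n →L[ℝ] C(Icc (0 : ℝ) T, R × Euc n) :=
  pairC ∘L ((constC ∘L ContinuousLinearMap.fst ℝ R (CE T n)).prod
    (ContinuousLinearMap.snd ℝ R (CE T n)))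

@[simp] theorem withParam_apply (q : R × CE T n) (t : Icc (0 : ℝ) T) :
    withParam q t = (q.1, q.2 t) := rfl

theorem contDiff_withParam {k : ℕ∞ω} : ContDiff ℝ k (withParam (T := T) (R := R) (n := n)) :=
  ContinuousLinearMap.contDiff (E := R × CE T n) (F := C(Icc (0 : ℝ) T, R × Euc n))
    (withParam (T := T) (R := R) (n := n))

theorem hasFDerivAt_withParam (q : R × CE T n) : HasFDerivAt withParam withParam q :=
  ContinuousLinearMap.hasFDerivAt (E := R × CE T n) (F := C(Icc (0 : ℝ) T, R × Euc n))
    (withParam (T := T) (R := R) (n := n))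

end WithParam

/-! ### Part (a): the parameter-to-state and parameter-to-adjoint maps -/

namespace LearningProblem

open ContinuousLinearMap (adjoint)

variable {n m N : ℕ} {R : Type*} [NormedAddCommGroup R] [InnerProductSpace ℝ R]
  [FiniteDimensional ℝ R] (P : LearningProblem n m N R)

/-- The superposition operator of the right-hand side of the state equation. -/
def rhsC (q : R × CE P.T n) : CE P.T n := nem (fun (t : Icc (0 : ℝ) P.T) => P.rhs t) (withParam q)

theorem rhsC_apply (q : R × CE P.T n) (t : Icc (0 : ℝ) P.T) :
    P.rhsC q t = P.rhs t (q.1, q.2 t) := by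
  rw [rhsC, P.slabDiff_rhs.nem_apply, withParam_apply]

theorem contDiff_rhsC : ContDiff ℝ 1 P.rhsC :=
  (P.slabDiff_rhs.contDiff_nem P.T_pos (by norm_num)).comp contDiff_withParam

/-- The derivative of `rhsC`. -/
def DrhsC (q : R × CE P.T n) : R × CE P.T n →L[ℝ] CE P.T n :=
  mulC (nem (fun (t : Icc (0 : ℝ) P.T) => fderiv ℝ (P.rhs t)) (withParam q)) ∘L withParam

theorem hasFDerivAt_rhsC (q : R × CE P.T n) : HasFDerivAt P.rhsC (P.DrhsC q) q :=
  (P.slabDiff_rhs.hasFDerivAt_nem P.T_pos (by norm_num) (withParam q)).comp q (hasFDerivAt_withParam q)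

theorem DrhsC_apply (q δ : R × CE P.T n) (t : Icc (0 : ℝ) P.T) :
    P.DrhsC q δ t = fderiv ℝ (P.rhs t) (q.1, q.2 t) (δ.1, δ.2 t) := by
  have h := P.slabDiff_rhs.fderiv P.T_pos (k := 1) (by norm_num)
  change (nem (fun (t : Icc (0 : ℝ) P.T) => fderiv ℝ (P.rhs t)) (withParam q)) t
    (withParam δ t) = _
  rw [h.nem_apply, withParam_apply, withParam_apply]

/-- The superposition operator of `A`. -/
def AC (q : R × CE P.T n) : CO P.T n :=
  nem (fun (t : Icc (0 : ℝ) P.T) (q : R × Euc n) => P.A q.1 t q.2) (withParam q)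

theorem AC_apply (q : R × CE P.T n) (t : Icc (0 : ℝ) P.T) :
    P.AC q t = P.A q.1 t (q.2 t) := by
  rw [AC, P.slabDiff_A.nem_apply, withParam_apply]

theorem contDiff_AC : ContDiff ℝ 1 P.AC :=
  (P.slabDiff_A.contDiff_nem P.T_pos le_rfl).comp contDiff_withParam

/-- The residual of the integrated state equation. -/
def stateResidual (c : Euc n) (q : R × CE P.T n) : CE P.T n :=
  q.2 - constC c - fprim P.T_pos (P.rhsC q)

/-- The implicit function theorem for the integrated equation. It is posed for continuous functions,
where `rhsC` is `C¹` and the linearisation is the identity minus a Volterra operator. -/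
theorem exists_state_map (c : Euc n) {θ₀ : R} {u : CE P.T n}
    (h : P.stateResidual c (θ₀, u) = 0) :
    ∃ S : R → CE P.T n, ContDiffAt ℝ 1 S θ₀ ∧ S θ₀ = u ∧
      ∀ᶠ θ in 𝓝 θ₀, P.stateResidual c (θ, S θ) = 0 := by
  have : CompleteSpace R := FiniteDimensional.complete ℝ R
  have hC : ContDiff ℝ 1 (P.stateResidual c) :=
    (contDiff_snd.sub contDiff_const).sub ((contDiff_betweenC (fprim P.T_pos)).comp P.contDiff_rhsC)
  have hD : HasFDerivAt (P.stateResidual c)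
      (ContinuousLinearMap.snd ℝ R (CE P.T n) - fprim P.T_pos ∘L P.DrhsC (θ₀, u)) (θ₀, u) :=
    (hasFDerivAt_snd.sub_const _).sub
      ((hasFDerivAt_betweenC (fprim P.T_pos) _).comp (θ₀, u) (P.hasFDerivAt_rhsC (θ₀, u)))
  have hinv : (fderiv ℝ (P.stateResidual c) (θ₀, u) ∘L
      ContinuousLinearMap.inr ℝ R (CE P.T n)).IsInvertible := by
    -- `B` is the state derivative of the right-hand side along `u`, the coefficient of the
    -- linearised state equation.
    let B : CO P.T n := ⟨fun t =>
      (nem (fun (t : Icc (0 : ℝ) P.T) => fderiv ℝ (P.rhs t)) (withParam (θ₀, u)) t) ∘L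
        ContinuousLinearMap.inr ℝ R (Euc n), by fun_prop⟩
    have e : fderiv ℝ (P.stateResidual c) (θ₀, u) ∘L ContinuousLinearMap.inr ℝ R (CE P.T n) =
        1 - fprim P.T_pos ∘L mulC B := by
      rw [hD.fderiv]
      rfl
    rw [e]
    exact isInvertible_of_isUnit (isUnit_one_sub_fprim P.T_pos B)
  have hA := hC.contDiffAt (x := (θ₀, u))
  refine ⟨hA.implicitFunction one_ne_zero hinv, hA.contDiffAt_implicitFunction one_ne_zero hinv,
    hA.implicitFunction_apply_self one_ne_zero hinv, ?_⟩
  have := hA.eventually_apply_implicitFunction one_ne_zero hinv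
  rwa [h] at this

variable {P}

theorem ae_state_iff {θ : R} {y : WT P.T n} :
    (∀ᵐ t ∂(volume.restrict (Ioo 0 P.T)),
      y.dot t = P.f t (y t) + P.g t (y t) (P.F θ t (y t))) ↔
    y.dot = toL2 P.T_pos (P.rhsC (θ, toC P.T_pos y)) := by
  have key : ∀ᵐ t ∂(volume.restrict (Ioo 0 P.T)),
      toL2 P.T_pos (P.rhsC (θ, toC P.T_pos y)) t =
        P.f t (y t) + P.g t (y t) (P.F θ t (y t)) := by
    filter_upwards [toL2_ae P.T_pos (P.rhsC (θ, toC P.T_pos y)), ae_restrict_mem measurableSet_Ioo]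
      with t h1 ht
    rw [h1, ext_apply P.T_pos _ (Ioo_subset_Icc_self ht), rhsC_apply, toC_apply]
    rfl
  constructor
  · intro h
    apply Lp.ext
    filter_upwards [h, key] with t h1 h2
    rw [h1, h2]
  · intro h
    rw [h]
    exact key

theorem stateResidual_eq_zero {θ : R} {y : WT P.T n}
    (h : ∀ᵐ t ∂(volume.restrict (Ioo 0 P.T)),
      y.dot t = P.f t (y t) + P.g t (y t) (P.F θ t (y t))) :
    P.stateResidual (y 0) (θ, toC P.T_pos y) = 0 := by
  rw [stateResidual, ← primL2_toL2, ← ae_state_iff.1 h]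
  dsimp only
  rw [toC_eq, add_sub_cancel_left, sub_self]

variable (P)

/-- The forcing term `Q₁ᵀ Q₁ (u - y_d)` of the adjoint equation. -/
def adjForce (u : CE P.T n) : L2 P.T n :=
  (adjoint P.Q₁ ∘L P.Q₁).compLpL 2 _ (toL2 P.T_pos u - P.yd)

theorem contDiff_adjForce : ContDiff ℝ 1 P.adjForce :=
  ((adjoint P.Q₁ ∘L P.Q₁).compLpL 2 (volume.restrict (Ioo 0 P.T))).contDiff.comp
    ((contDiff_fromC (toL2 P.T_pos)).sub contDiff_const)

/-- The terminal value of the adjoint state. -/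
def adjEnd (u : CE P.T n) : Euc n :=
  adjoint P.Q₂ (P.Q₂ (u ⟨P.T, P.T_pos.le, le_rfl⟩ - P.ydT))

theorem contDiff_adjEnd : ContDiff ℝ 1 P.adjEnd :=
  (adjoint P.Q₂ ∘L P.Q₂).contDiff.comp ((contDiff_fromC (evalC _)).sub contDiff_const)

/-- The adjoint state belonging to the state `u`. -/
def adjState (q : R × CE P.T n) : WT P.T n :=
  bwdSol P.T_pos (P.AC q) (P.adjForce q.2) (P.adjEnd q.2)

theorem contDiff_adjState : ContDiff ℝ 1 P.adjState := by
  have h : ContDiff ℝ 1 (fun q : R × CE P.T n => (P.AC q, P.adjForce q.2, P.adjEnd q.2)) :=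
    P.contDiff_AC.prodMk ((P.contDiff_adjForce.comp contDiff_snd).prodMk
      (P.contDiff_adjEnd.comp contDiff_snd))
  have h' := ContDiff.comp (𝕜 := ℝ) (n := 1) (F := CO P.T n × L2 P.T n × Euc n)
    (g := fun x : CO P.T n × L2 P.T n × Euc n => bwdSol P.T_pos x.1 x.2.1 x.2.2)
    (contDiff_bwdSol P.T_pos) h
  have e : P.adjState = (fun x : CO P.T n × L2 P.T n × Euc n =>
      bwdSol P.T_pos x.1 x.2.1 x.2.2) ∘
      fun q : R × CE P.T n => (P.AC q, P.adjForce q.2, P.adjEnd q.2) := by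
    funext q
    rw [adjState, Function.comp_apply]
  rw [e]
  exact h'

variable {P}

theorem adjForce_ae (y : WT P.T n) : ∀ᵐ t ∂(volume.restrict (Ioo 0 P.T)),
    P.adjForce (toC P.T_pos y) t = adjoint P.Q₁ (P.Q₁ (y t - P.yd t)) := by
  filter_upwards [ContinuousLinearMap.coeFn_compLpL (adjoint P.Q₁ ∘L P.Q₁)
      (toL2 P.T_pos (toC P.T_pos y) - P.yd), Lp.coeFn_sub (toL2 P.T_pos (toC P.T_pos y)) P.yd,
      toL2_ae P.T_pos (toC P.T_pos y), ae_restrict_mem measurableSet_Ioo] with t h1 h2 h3 ht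
  rw [adjForce, h1, h2, Pi.sub_apply, h3, ext_toC P.T_pos y (Ioo_subset_Icc_self ht)]
  rfl

theorem ext_AC {θ : R} (y : WT P.T n) {t : ℝ} (ht : t ∈ Ioo 0 P.T) :
    ext P.T_pos (P.AC (θ, toC P.T_pos y)) t = P.A θ t (y t) := by
  rw [ext_apply P.T_pos _ (Ioo_subset_Icc_self ht), AC_apply, toC_apply]

/-- The adjoint equation is linear in `p` and uniquely solvable, so the system is an operator
equation for `y` alone together with a formula for `p`. In this form it can be differentiated in the
parameter. -/
theorem isStateAdjoint_iff {i : Fin N} {θ : R} {y p : WT P.T n} :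
    P.IsStateAdjoint i θ y p ↔ y.dot = toL2 P.T_pos (P.rhsC (θ, toC P.T_pos y)) ∧ y 0 = P.y₀ i ∧
      p = P.adjState (θ, toC P.T_pos y) := by
  have hend : toC P.T_pos y ⟨P.T, P.T_pos.le, le_rfl⟩ = y P.T := toC_apply _ _ _
  constructor
  · rintro ⟨h1, h2, h3, h4⟩
    refine ⟨ae_state_iff.1 h1, h3, eq_bwdSol P.T_pos ?_ (by rw [h4, adjEnd, hend])⟩
    filter_upwards [h2, adjForce_ae y, ae_restrict_mem measurableSet_Ioo] with t a1 a2 ht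
    rw [a1, a2, ext_AC y ht]
  · rintro ⟨h1, h2, h3⟩
    refine ⟨ae_state_iff.2 h1, ?_, h2, ?_⟩
    · filter_upwards [bwdSol_dot P.T_pos (P.AC (θ, toC P.T_pos y)) (P.adjForce (toC P.T_pos y))
        (P.adjEnd (toC P.T_pos y)),
        adjForce_ae y, ae_restrict_mem measurableSet_Ioo] with t a1 a2 ht
      rw [h3, ← a2, ← ext_AC y ht]
      exact a1
    · rw [h3, ← hend]
      exact bwdSol_end _ _ _ _

theorem exists_isParamToState (y p : Fin N → WT P.T n) (θ₀ : R)
    (hadm : ∀ i, P.IsStateAdjoint i θ₀ (y i) (p i)) :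
    ∃ (U : Set R) (Y Z : Fin N → R → WT P.T n), P.IsParamToState y p θ₀ U Y Z := by
  have hS := fun i => P.exists_state_map (P.y₀ i) (θ₀ := θ₀) (u := toC P.T_pos (y i)) (by
    rw [← (hadm i).2.2.1]
    exact stateResidual_eq_zero (hadm i).1)
  choose S hS1 hS2 hS3 using hS
  have hV : ∀ i, ∃ V, IsOpen V ∧ θ₀ ∈ V ∧ ContDiffOn ℝ 1 (S i) V ∧
      ∀ θ ∈ V, P.stateResidual (P.y₀ i) (θ, S i θ) = 0 := by
    intro i
    obtain ⟨V₁, hV₁, hc⟩ := (hS1 i).contDiffOn le_rfl (by simp)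
    obtain ⟨V, hV, hVo, hVm⟩ := mem_nhds_iff.1 (Filter.inter_mem hV₁ (hS3 i))
    exact ⟨V, hVo, hVm, hc.mono fun x hx => (hV hx).1, fun x hx => (hV hx).2⟩
  choose V hV1 hV2 hV3 hV4 using hV
  -- The implicit function takes values in the continuous functions. Integrating the right-hand side
  -- along it gives an element of `W_T` that is `C¹` in the parameter and has `S i θ` as its
  -- representative.
  let Y : Fin N → R → WT P.T n := fun i θ =>
    mkWT P.T_pos (P.y₀ i, toL2 P.T_pos (P.rhsC (θ, S i θ)))
  have hY : ∀ i, ∀ θ ∈ V i, toC P.T_pos (Y i θ) = S i θ := by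
    intro i θ hθ
    have h := hV4 i θ hθ
    rw [stateResidual, sub_sub, sub_eq_zero] at h
    rw [toC_mkWT, primL2_toL2]
    exact h.symm
  have hsol : ∀ i, ∀ θ ∈ V i, P.IsStateAdjoint i θ (Y i θ) (P.adjState (θ, S i θ)) := by
    intro i θ hθ
    rw [isStateAdjoint_iff, hY i θ hθ]
    exact ⟨rfl, mkWT_zero P.T_pos _, rfl⟩
  have hY1 : ∀ i, ContDiffOn ℝ 1 (Y i) (V i) := fun i =>
    ((mkWT P.T_pos).contDiff.comp (contDiff_const.prodMk ((contDiff_fromC (toL2 P.T_pos)).comp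
      P.contDiff_rhsC))).comp_contDiffOn (contDiffOn_id.prodMk (hV3 i))
  have hbase : ∀ i, Y i θ₀ = y i := by
    intro i
    have h := isStateAdjoint_iff.1 (hadm i)
    rw [← mkWT_eta P.T_pos (y i), h.1, h.2.1, ← hS2 i]
  refine ⟨⋂ i, V i, Y, fun i θ => P.adjState (θ, S i θ), isOpen_iInter_of_finite hV1,
    mem_iInter.2 hV2, hbase, ?_, fun i => (hY1 i).mono (iInter_subset _ i), ?_,
    fun i θ hθ => hsol i θ (mem_iInter.1 hθ i)⟩
  · intro i
    rw [(isStateAdjoint_iff.1 (hadm i)).2.2, hS2 i]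
  · exact fun i => (P.contDiff_adjState.comp_contDiffOn (contDiffOn_id.prodMk (hV3 i))).mono
      (iInter_subset _ i)

end LearningProblem

/-! ### Quadratic functionals -/

section HalfNormSq

variable {T : ℝ} {F : Type*} [NormedAddCommGroup F] [InnerProductSpace ℝ F]

/-- The inner product as a bilinear map. -/
def innerL : F →L[ℝ] F →L[ℝ] ℝ :=
  (innerₗ F).mkContinuous₂ 1 (fun x y => by
    rw [one_mul]
    exact norm_inner_le_norm x y)

@[simp] theorem innerL_apply (x y : F) : innerL x y = inner ℝ x y := rfl

theorem hasFDerivAt_half_norm_sq (x : F) :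
    HasFDerivAt (fun x : F => 1 / 2 * ‖x‖ ^ 2) (innerL x) x := by
  have h := (hasStrictFDerivAt_norm_sq x).hasFDerivAt.const_mul (1 / 2 : ℝ)
  have e : innerL x = (1 / 2 : ℝ) • (2 : ℕ) • (innerSL ℝ x : F →L[ℝ] ℝ) := by
    ext y
    simp
  rw [e]
  exact h

theorem slabDiff_half_norm_sq {k : ℕ∞ω} :
    SlabDiff T k (fun _ (x : F) => 1 / 2 * ‖x‖ ^ 2) :=
  (contDiff_const.mul ((contDiff_norm_sq ℝ).comp contDiff_snd)).contDiffOn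

/-- The integral over `[0, T]` of a continuous function. -/
def endInt (hT : 0 < T) : C(Icc (0 : ℝ) T, ℝ) →L[ℝ] ℝ :=
  evalC (⟨T, hT.le, le_rfl⟩ : Icc (0 : ℝ) T) ∘L fprim hT

theorem endInt_apply (hT : 0 < T) (u : C(Icc (0 : ℝ) T, ℝ)) :
    endInt hT u = ∫ t in (0 : ℝ)..T, ext hT u t :=
  fprim_apply hT u _

/-- The functional `w ↦ ½ ∫₀ᵀ |w|²`. -/
def sqC (hT : 0 < T) (w : C(Icc (0 : ℝ) T, F)) : ℝ :=
  endInt hT (nem (fun (_ : Icc (0 : ℝ) T) (x : F) => 1 / 2 * ‖x‖ ^ 2) w)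

/-- The bilinear form `∫₀ᵀ ⟨w, δ⟩`. -/
def DsqC (hT : 0 < T) (w : C(Icc (0 : ℝ) T, F)) : C(Icc (0 : ℝ) T, F) →L[ℝ] ℝ :=
  endInt hT ∘L
    mulC (nem (fun (_ : Icc (0 : ℝ) T) => fderiv ℝ (fun (x : F) => 1 / 2 * ‖x‖ ^ 2)) w)

theorem sqC_apply (hT : 0 < T) (w : C(Icc (0 : ℝ) T, F)) :
    sqC hT w = ∫ t in (0 : ℝ)..T, 1 / 2 * ‖ext hT w t‖ ^ 2 := by
  rw [sqC, endInt_apply]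
  refine intervalIntegral.integral_congr fun t ht => ?_
  rw [uIcc_of_le hT.le] at ht
  exact SlabDiff.ext_nem (k := 1) hT slabDiff_half_norm_sq w ht

theorem hasFDerivAt_sqC (hT : 0 < T) (w : C(Icc (0 : ℝ) T, F)) :
    HasFDerivAt (sqC hT) (DsqC hT w) w :=
  (hasFDerivAt_fromC (endInt hT) _).comp w
    ((slabDiff_half_norm_sq (k := 1)).hasFDerivAt_nem hT le_rfl w)

theorem contDiff_sqC (hT : 0 < T) : ContDiff ℝ 1 (sqC (F := F) hT) :=
  (contDiff_fromC (endInt hT)).comp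
    ((slabDiff_half_norm_sq (k := 1)).contDiff_nem hT le_rfl)

theorem DsqC_apply (hT : 0 < T) (w δ : C(Icc (0 : ℝ) T, F)) :
    DsqC hT w δ = ∫ t in (0 : ℝ)..T, inner ℝ (ext hT w t) (ext hT δ t) := by
  rw [DsqC, ContinuousLinearMap.comp_apply, endInt_apply]
  refine intervalIntegral.integral_congr fun t ht => ?_
  rw [uIcc_of_le hT.le] at ht
  have h := (slabDiff_half_norm_sq (T := T) (F := F) (k := 2)).fderiv hT (k := 1) (by norm_num)
  rw [ext_apply hT _ ht, ext_apply hT _ ht, ext_apply hT _ ht, mulC_apply, h.nem_apply,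
    (hasFDerivAt_half_norm_sq _).fderiv, innerL_apply]

end HalfNormSq

/-! ### The cost as a `C¹` function of parameter, state and adjoint state -/

namespace LearningProblem

open ContinuousLinearMap (adjoint)

variable {n m N : ℕ} {R : Type*} [NormedAddCommGroup R] [InnerProductSpace ℝ R]
  [FiniteDimensional ℝ R] (P : LearningProblem n m N R)

/-- The part of the running cost that does not involve the desired state. -/
def runCost (t : ℝ) (q : R × Euc n) : ℝ :=
  1 / 2 * ‖P.Q₁ q.2‖ ^ 2 + P.β * (1 / 2 * ‖P.F q.1 t q.2‖ ^ 2)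

/-- The desired state is only square integrable, so the tracking integrand need not be continuous in
time and cannot be fed to `nem`. Expanding the square splits it into this smooth part, a part linear
in the state with the integrable coefficient `crossOp`, and a part independent of the state. -/
theorem slabDiff_runCost : SlabDiff P.T 2 P.runCost := by
  have h1 : SlabDiff P.T 2 (fun _ (q : R × Euc n) => 1 / 2 * ‖P.Q₁ q.2‖ ^ 2) :=
    SlabDiff.comp (H := fun _ (x : Euc n) => 1 / 2 * ‖x‖ ^ 2) slabDiff_half_norm_sq
      (SlabDiff.clm 2 (P.Q₁ ∘L ContinuousLinearMap.snd ℝ R _))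
  have h2 : SlabDiff P.T 2 (fun t (q : R × Euc n) => 1 / 2 * ‖P.F q.1 t q.2‖ ^ 2) :=
    SlabDiff.comp (H := fun _ (x : Euc m) => 1 / 2 * ‖x‖ ^ 2) slabDiff_half_norm_sq P.slabDiff_F
  exact h1.add (contDiffOn_const.mul h2)

theorem fderiv_runCost {t : ℝ} (ht : t ∈ Icc 0 P.T) (q δ : R × Euc n) :
    fderiv ℝ (P.runCost t) q δ = inner ℝ (P.Q₁ q.2) (P.Q₁ δ.2) +
      P.β * inner ℝ (P.F q.1 t q.2) (P.dθF q.1 t q.2 δ.1 + P.dyF q.1 t q.2 δ.2) := by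
  have hF := P.slabDiff_F.hasFDerivAt (by norm_num) ht q
  have h1 := (hasFDerivAt_half_norm_sq (P.Q₁ q.2)).comp q
    (P.Q₁ ∘L ContinuousLinearMap.snd ℝ R _).hasFDerivAt
  have h2 := ((hasFDerivAt_half_norm_sq (P.F q.1 t q.2)).comp q hF).const_mul P.β
  have h : HasFDerivAt (P.runCost t) _ q := h1.add h2
  have e := P.slabDiff_F.fderiv_apply (by norm_num) ht q δ
  rw [h.fderiv]
  simp only [add_apply, smul_apply, ContinuousLinearMap.comp_apply, e, innerL_apply, smul_eq_mul]
  rfl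

/-- The operator function of the part of the running cost that is linear in the state. -/
def crossOp (s : ℝ) : Euc n →L[ℝ] ℝ := -innerL (adjoint P.Q₁ (P.Q₁ (P.yd s)))

theorem integrableOn_crossOp : IntegrableOn P.crossOp (Ioo 0 P.T) :=
  ((innerL ∘L adjoint P.Q₁ ∘L P.Q₁).integrable_comp (L2.integrableOn P.yd)).neg

theorem integrableOn_yd_sq : IntegrableOn (fun s => 1 / 2 * ‖P.Q₁ (P.yd s)‖ ^ 2) (Ioo 0 P.T) := by
  have h : MemLp (fun s => P.Q₁ (P.yd s)) 2 (volume.restrict (Ioo 0 P.T)) :=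
    P.Q₁.comp_memLp' (Lp.memLp P.yd)
  exact (h.integrable_norm_pow (p := 2) (by norm_num)).const_mul _

/-- The primitive of the running cost, as a function of the parameter and the state. -/
def runPrim (q : R × CE P.T n) : C(Icc (0 : ℝ) P.T, ℝ) :=
  fprim P.T_pos (nem (fun (t : Icc (0 : ℝ) P.T) => P.runCost t) (withParam q)) +
    volt P.T_pos P.integrableOn_crossOp q.2 + prim fun s => 1 / 2 * ‖P.Q₁ (P.yd s)‖ ^ 2

/-- The terminal cost. -/
def endCost (u : CE P.T n) : ℝ :=
  1 / 2 * ‖P.Q₂ (u ⟨P.T, P.T_pos.le, le_rfl⟩ - P.ydT)‖ ^ 2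

/-- The cost-to-go as a function of the parameter and the state. -/
def costC (q : R × CE P.T n) : C(Icc (0 : ℝ) P.T, ℝ) :=
  flipC P.T_pos (P.runPrim q) + constC (P.endCost q.2)

/-- The derivative of `runPrim`. -/
def DrunPrim (q : R × CE P.T n) : R × CE P.T n →L[ℝ] C(Icc (0 : ℝ) P.T, ℝ) :=
  fprim P.T_pos ∘L
      mulC (nem (fun (t : Icc (0 : ℝ) P.T) => fderiv ℝ (P.runCost t)) (withParam q)) ∘L withParam +
    volt P.T_pos P.integrableOn_crossOp ∘L ContinuousLinearMap.snd ℝ R (CE P.T n)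

/-- The derivative of `endCost`. -/
def DendCost (u : CE P.T n) : CE P.T n →L[ℝ] ℝ :=
  innerL (P.Q₂ (u ⟨P.T, P.T_pos.le, le_rfl⟩ - P.ydT)) ∘L P.Q₂ ∘L
    evalC ⟨P.T, P.T_pos.le, le_rfl⟩

theorem hasFDerivAt_endCost (u : CE P.T n) : HasFDerivAt P.endCost (P.DendCost u) u := by
  have h1 : HasFDerivAt (fun u : CE P.T n => P.Q₂ (u ⟨P.T, P.T_pos.le, le_rfl⟩ - P.ydT))
      (P.Q₂ ∘L evalC ⟨P.T, P.T_pos.le, le_rfl⟩) u :=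
    P.Q₂.hasFDerivAt.comp u ((hasFDerivAt_fromC (evalC _) u).sub_const P.ydT)
  exact (hasFDerivAt_half_norm_sq _).comp u h1

theorem contDiff_endCost : ContDiff ℝ 1 P.endCost := by
  have h1 : ContDiff ℝ 1 (fun u : CE P.T n => P.Q₂ (u ⟨P.T, P.T_pos.le, le_rfl⟩ - P.ydT)) :=
    P.Q₂.contDiff.comp ((contDiff_fromC (evalC _)).sub contDiff_const)
  exact contDiff_const.mul ((contDiff_norm_sq ℝ).comp h1)

theorem hasFDerivAt_runPrim (q : R × CE P.T n) : HasFDerivAt P.runPrim (P.DrunPrim q) q := by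
  have h1 := (hasFDerivAt_betweenC (fprim P.T_pos) _).comp q
    ((P.slabDiff_runCost.hasFDerivAt_nem P.T_pos (by norm_num) (withParam q)).comp q
      (hasFDerivAt_withParam q))
  have h2 : HasFDerivAt (fun q : R × CE P.T n => volt P.T_pos P.integrableOn_crossOp q.2)
      (volt P.T_pos P.integrableOn_crossOp ∘L ContinuousLinearMap.snd ℝ R (CE P.T n)) q :=
    (hasFDerivAt_betweenC (volt P.T_pos P.integrableOn_crossOp) q.2).comp q hasFDerivAt_snd
  exact (h1.add h2).add_const _

theorem contDiff_runPrim : ContDiff ℝ 1 P.runPrim := by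
  have h1 := (contDiff_betweenC (k := 1) (fprim P.T_pos)).comp
    ((P.slabDiff_runCost.contDiff_nem P.T_pos (by norm_num)).comp contDiff_withParam)
  have h2 : ContDiff ℝ 1 (fun q : R × CE P.T n => volt P.T_pos P.integrableOn_crossOp q.2) :=
    (contDiff_betweenC (volt P.T_pos P.integrableOn_crossOp)).comp contDiff_snd
  exact (h1.add h2).add contDiff_const

/-- The derivative of `costC`. -/
def DcostC (q : R × CE P.T n) : R × CE P.T n →L[ℝ] C(Icc (0 : ℝ) P.T, ℝ) :=
  flipC P.T_pos ∘L P.DrunPrim q +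
    constC ∘L P.DendCost q.2 ∘L ContinuousLinearMap.snd ℝ R (CE P.T n)

theorem hasFDerivAt_costC (q : R × CE P.T n) : HasFDerivAt P.costC (P.DcostC q) q := by
  have h1 := (hasFDerivAt_betweenC (flipC P.T_pos) _).comp q (P.hasFDerivAt_runPrim q)
  have h2 : HasFDerivAt (fun q : R × CE P.T n => P.endCost q.2)
      (P.DendCost q.2 ∘L ContinuousLinearMap.snd ℝ R (CE P.T n)) q :=
    (P.hasFDerivAt_endCost q.2).comp q hasFDerivAt_snd
  exact h1.add ((hasFDerivAt_intoC constC _).comp q h2)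

theorem contDiff_costC : ContDiff ℝ 1 P.costC := by
  have h1 := (contDiff_betweenC (k := 1) (flipC P.T_pos)).comp P.contDiff_runPrim
  have h2 : ContDiff ℝ 1 (fun q : R × CE P.T n => P.endCost q.2) :=
    P.contDiff_endCost.comp contDiff_snd
  exact h1.add ((contDiff_intoC constC).comp h2)

/-- The mismatch as a function of the parameter and the state. -/
def mismatchC (q : R × CE P.T n) : C(Icc (0 : ℝ) P.T, ℝ) :=
  nem (fun (t : Icc (0 : ℝ) P.T) (q : R × Euc n) => P.V q.1 t q.2) (withParam q) - P.costC q

/-- The derivative of `mismatchC`. -/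
def DmismatchC (q : R × CE P.T n) : R × CE P.T n →L[ℝ] C(Icc (0 : ℝ) P.T, ℝ) :=
  mulC (nem (fun (t : Icc (0 : ℝ) P.T) => fderiv ℝ fun q : R × Euc n => P.V q.1 t q.2)
    (withParam q)) ∘L withParam - P.DcostC q

theorem hasFDerivAt_mismatchC (q : R × CE P.T n) :
    HasFDerivAt P.mismatchC (P.DmismatchC q) q :=
  ((P.slabDiff_V.hasFDerivAt_nem P.T_pos (by norm_num) (withParam q)).comp q
    (hasFDerivAt_withParam q)).sub (P.hasFDerivAt_costC q)

theorem contDiff_mismatchC : ContDiff ℝ 1 P.mismatchC :=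
  ((P.slabDiff_V.contDiff_nem P.T_pos (by norm_num)).comp contDiff_withParam).sub P.contDiff_costC

/-- The gradient `∂_y V_θ` along the state. -/
def gradVC (q : R × CE P.T n) : CE P.T n :=
  nem (fun (t : Icc (0 : ℝ) P.T) (q : R × Euc n) => P.gradV q.1 t q.2) (withParam q)

/-- The derivative of `gradVC`. -/
def DgradVC (q : R × CE P.T n) : R × CE P.T n →L[ℝ] CE P.T n :=
  mulC (nem (fun (t : Icc (0 : ℝ) P.T) => fderiv ℝ fun q : R × Euc n => P.gradV q.1 t q.2)
    (withParam q)) ∘L withParam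

theorem hasFDerivAt_gradVC (q : R × CE P.T n) : HasFDerivAt P.gradVC (P.DgradVC q) q :=
  (P.slabDiff_gradV.hasFDerivAt_nem P.T_pos (by norm_num) (withParam q)).comp q
    (hasFDerivAt_withParam q)

theorem contDiff_gradVC : ContDiff ℝ 1 P.gradVC :=
  (P.slabDiff_gradV.contDiff_nem P.T_pos (by norm_num)).comp contDiff_withParam

/-- The augmented objective as a function of the parameter, the state and the adjoint state. -/
def objC (x : (R × CE P.T n) × CE P.T n) : ℝ :=
  P.costC x.1 ⟨0, le_rfl, P.T_pos.le⟩ + (P.γ₁ * sqC P.T_pos (P.mismatchC x.1) +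
    P.γ₂ * sqC P.T_pos (P.gradVC x.1 - x.2))

/-- The derivative of `objC`. -/
def DobjC (x : (R × CE P.T n) × CE P.T n) : (R × CE P.T n) × CE P.T n →L[ℝ] ℝ :=
  evalC ⟨0, le_rfl, P.T_pos.le⟩ ∘L P.DcostC x.1 ∘L ContinuousLinearMap.fst ℝ _ _ +
    (P.γ₁ • (DsqC P.T_pos (P.mismatchC x.1) ∘L P.DmismatchC x.1 ∘L
        ContinuousLinearMap.fst ℝ _ _) +
      P.γ₂ • (DsqC P.T_pos (P.gradVC x.1 - x.2) ∘L
        (P.DgradVC x.1 ∘L ContinuousLinearMap.fst ℝ _ _ - ContinuousLinearMap.snd ℝ _ _)))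

theorem hasFDerivAt_objC (x : (R × CE P.T n) × CE P.T n) :
    HasFDerivAt P.objC (P.DobjC x) x := by
  have h1 := (hasFDerivAt_fromC (evalC ⟨0, le_rfl, P.T_pos.le⟩) _).comp x
    ((P.hasFDerivAt_costC x.1).comp x hasFDerivAt_fst)
  have h2 := ((hasFDerivAt_sqC P.T_pos (P.mismatchC x.1)).comp x
    ((P.hasFDerivAt_mismatchC x.1).comp x hasFDerivAt_fst)).const_mul P.γ₁
  have h3 := ((hasFDerivAt_sqC P.T_pos (P.gradVC x.1 - x.2)).comp x
    (((P.hasFDerivAt_gradVC x.1).comp x hasFDerivAt_fst).sub hasFDerivAt_snd)).const_mul P.γ₂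
  exact h1.add (h2.add h3)

theorem contDiff_objC : ContDiff ℝ 1 P.objC := by
  have h1 := (contDiff_fromC (k := 1) (evalC ⟨0, le_rfl, P.T_pos.le⟩)).comp
    (P.contDiff_costC.comp (contDiff_fst (F := CE P.T n)))
  have h2 := (contDiff_sqC P.T_pos).comp
    (P.contDiff_mismatchC.comp (contDiff_fst (F := CE P.T n)))
  have h3 := (contDiff_sqC P.T_pos).comp
    ((P.contDiff_gradVC.comp (contDiff_fst (F := CE P.T n))).sub contDiff_snd)
  exact h1.add ((contDiff_const.mul h2).add (contDiff_const.mul h3))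

end LearningProblem

/-! ### The abstract cost and its derivative in concrete form -/

namespace LearningProblem

open ContinuousLinearMap (adjoint)

variable {n m N : ℕ} {R : Type*} [NormedAddCommGroup R] [InnerProductSpace ℝ R]
  [FiniteDimensional ℝ R] {P : LearningProblem n m N R}

theorem ext_nem_withParam {F : Type*} [NormedAddCommGroup F] [NormedSpace ℝ F] {k : ℕ∞ω}
    {H : ℝ → R × Euc n → F} (h : SlabDiff P.T k H) (θ : R) (y : WT P.T n) {t : ℝ}
    (ht : t ∈ Icc 0 P.T) :
    ext P.T_pos (nem (fun (t : Icc (0 : ℝ) P.T) => H t) (withParam (θ, toC P.T_pos y))) t =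
      H t (θ, y t) := by
  rw [h.ext_nem P.T_pos _ ht, ext_apply P.T_pos _ ht, withParam_apply, toC_apply]

/-- The three pieces of the expanded square are put together again on `(0, T)`. Integrability is
recorded as well, since without it `prim` would be `0` by convention. -/
theorem runPrim_eq (θ : R) (y : WT P.T n) :
    IntegrableOn (fun s => 1 / 2 * (‖P.Q₁ (y s - P.yd s)‖ ^ 2 + P.β * ‖P.F θ s (y s)‖ ^ 2))
        (Ioo 0 P.T) ∧
      P.runPrim (θ, toC P.T_pos y) =
        prim fun s => 1 / 2 * (‖P.Q₁ (y s - P.yd s)‖ ^ 2 + P.β * ‖P.F θ s (y s)‖ ^ 2) := by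
  have h1 := integrableOn_ext P.T_pos
    (nem (fun (t : Icc (0 : ℝ) P.T) => P.runCost t) (withParam (θ, toC P.T_pos y)))
  have h2 := integrableOn_clm_ext P.T_pos P.integrableOn_crossOp (toC P.T_pos y)
  have h12 := h1.add h2
  have h123 := h12.add P.integrableOn_yd_sq
  have e : (ext P.T_pos (nem (fun (t : Icc (0 : ℝ) P.T) => P.runCost t)
      (withParam (θ, toC P.T_pos y))) + fun s => P.crossOp s (ext P.T_pos (toC P.T_pos y) s)) +
      (fun s => 1 / 2 * ‖P.Q₁ (P.yd s)‖ ^ 2) =ᵐ[volume.restrict (Ioo 0 P.T)]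
      fun s => 1 / 2 * (‖P.Q₁ (y s - P.yd s)‖ ^ 2 + P.β * ‖P.F θ s (y s)‖ ^ 2) := by
    filter_upwards [ae_restrict_mem measurableSet_Ioo] with s hs
    have hs' := Ioo_subset_Icc_self hs
    rw [Pi.add_apply, Pi.add_apply, ext_nem_withParam P.slabDiff_runCost θ y hs', ext_toC _ _ hs',
      map_sub, norm_sub_sq_real, runCost, crossOp, neg_apply, innerL_apply,
      ContinuousLinearMap.adjoint_inner_left, real_inner_comm (P.Q₁ (y s))]
    ring
  refine ⟨Integrable.congr h123 e, ?_⟩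
  rw [← prim_congr P.T_pos e, prim_add P.T_pos h12 P.integrableOn_yd_sq, prim_add P.T_pos h1 h2]
  rfl

theorem costC_apply (θ : R) (y : WT P.T n) (t : Icc (0 : ℝ) P.T) :
    P.costC (θ, toC P.T_pos y) t = P.costToGo y (P.feedback θ y) t := by
  obtain ⟨h1, h2⟩ := runPrim_eq θ y
  rw [costC, ContinuousMap.add_apply, h2, flipC_prim P.T_pos h1, constC_apply, endCost, toC_apply,
    intervalIntegral.integral_const_mul, costToGo]
  rfl

theorem mismatchC_apply (θ : R) (y : WT P.T n) (t : Icc (0 : ℝ) P.T) :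
    P.mismatchC (θ, toC P.T_pos y) t = P.mismatch θ y t := by
  rw [mismatchC, ContinuousMap.sub_apply, costC_apply, P.slabDiff_V.nem_apply, withParam_apply,
    toC_apply, mismatch]

theorem ext_mismatchC (θ : R) (y : WT P.T n) {t : ℝ} (ht : t ∈ Icc 0 P.T) :
    ext P.T_pos (P.mismatchC (θ, toC P.T_pos y)) t = P.mismatch θ y t := by
  rw [ext_apply P.T_pos _ ht, mismatchC_apply]

theorem gradVC_apply (θ : R) (y : WT P.T n) (t : Icc (0 : ℝ) P.T) :
    P.gradVC (θ, toC P.T_pos y) t = P.gradV θ t (y t) := by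
  rw [gradVC, P.slabDiff_gradV.nem_apply, withParam_apply, toC_apply]

theorem fprim_mismatchC (θ : R) (y : WT P.T n) (t : Icc (0 : ℝ) P.T) :
    fprim P.T_pos (P.mismatchC (θ, toC P.T_pos y)) t = P.Φ θ y t := by
  rw [fprim_apply, Φ]
  refine intervalIntegral.integral_congr fun s hs => ?_
  rw [uIcc_of_le t.2.1] at hs
  exact ext_mismatchC θ y ⟨hs.1, hs.2.trans t.2.2⟩

theorem objC_eq (θ : R) (y p : WT P.T n) :
    P.objC ((θ, toC P.T_pos y), toC P.T_pos p) = P.augmentedCost y p θ := by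
  have h1 : ∀ t ∈ uIcc 0 P.T, P.γ₁ / 2 * |P.mismatch θ y t| ^ 2 +
      P.γ₂ / 2 * ‖P.gradV θ t (y t) - p t‖ ^ 2 =
      P.γ₁ * (1 / 2 * ‖ext P.T_pos (P.mismatchC (θ, toC P.T_pos y)) t‖ ^ 2) +
      P.γ₂ * (1 / 2 *
        ‖ext P.T_pos (P.gradVC (θ, toC P.T_pos y) - toC P.T_pos p) t‖ ^ 2) := by
    intro t ht
    rw [uIcc_of_le P.T_pos.le] at ht
    rw [ext_mismatchC θ y ht, ext_apply P.T_pos _ ht, ContinuousMap.sub_apply, gradVC_apply,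
      toC_apply, Real.norm_eq_abs]
    ring
  have c1 := continuous_ext P.T_pos (P.mismatchC (θ, toC P.T_pos y))
  have c2 := continuous_ext P.T_pos (P.gradVC (θ, toC P.T_pos y) - toC P.T_pos p)
  have i1 : IntervalIntegrable (fun t => P.γ₁ * (1 / 2 *
      ‖ext P.T_pos (P.mismatchC (θ, toC P.T_pos y)) t‖ ^ 2)) volume 0 P.T :=
    (continuous_const.mul (continuous_const.mul (c1.norm.pow 2))).intervalIntegrable _ _
  have i2 : IntervalIntegrable (fun t => P.γ₂ * (1 / 2 *
      ‖ext P.T_pos (P.gradVC (θ, toC P.T_pos y) - toC P.T_pos p) t‖ ^ 2)) volume 0 P.T :=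
    (continuous_const.mul (continuous_const.mul (c2.norm.pow 2))).intervalIntegrable _ _
  rw [objC, costC_apply, augmentedCost, sqC_apply, sqC_apply, intervalIntegral.integral_congr h1,
    intervalIntegral.integral_add i1 i2]
  simp only [intervalIntegral.integral_const_mul]

/-- The derivative of the running cost along the state. -/
def dRun (θ : R) (y : WT P.T n) (δ : R × CE P.T n) (s : ℝ) : ℝ :=
  inner ℝ (P.Q₁ (y s - P.yd s)) (P.Q₁ (ext P.T_pos δ.2 s)) +
    P.β * inner ℝ (P.F θ s (y s))
      (P.dθF θ s (y s) δ.1 + P.dyF θ s (y s) (ext P.T_pos δ.2 s))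

/-- The derivative of the terminal cost. -/
def dEnd (y : WT P.T n) (δ : R × CE P.T n) : ℝ :=
  inner ℝ (P.Q₂ (y P.T - P.ydT)) (P.Q₂ (δ.2 ⟨P.T, P.T_pos.le, le_rfl⟩))

/-- The cross term with `y_d` recombines with the derivative of `½ ‖Q₁ y‖²` to the derivative of the
full tracking term. -/
theorem DrunPrim_eq (θ : R) (y : WT P.T n) (δ : R × CE P.T n) :
    IntegrableOn (dRun θ y δ) (Ioo 0 P.T) ∧
      P.DrunPrim (θ, toC P.T_pos y) δ = prim (dRun θ y δ) := by
  have h1 := integrableOn_ext P.T_pos (mulC (nem (fun (t : Icc (0 : ℝ) P.T) =>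
    fderiv ℝ (P.runCost t)) (withParam (θ, toC P.T_pos y))) (withParam δ))
  have h2 := integrableOn_clm_ext P.T_pos P.integrableOn_crossOp δ.2
  have h12 := h1.add h2
  have hD := P.slabDiff_runCost.fderiv P.T_pos (k := 1) (by norm_num)
  have e : (ext P.T_pos (mulC (nem (fun (t : Icc (0 : ℝ) P.T) =>
      fderiv ℝ (P.runCost t)) (withParam (θ, toC P.T_pos y))) (withParam δ)) +
      fun s => P.crossOp s (ext P.T_pos δ.2 s)) =ᵐ[volume.restrict (Ioo 0 P.T)] dRun θ y δ := by
    filter_upwards [ae_restrict_mem measurableSet_Ioo] with s hs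
    have hs' := Ioo_subset_Icc_self hs
    rw [Pi.add_apply, ext_apply P.T_pos _ hs', mulC_apply, hD.nem_apply, withParam_apply,
      withParam_apply, fderiv_runCost _ hs', dRun, ext_apply P.T_pos _ hs', crossOp,
      neg_apply, innerL_apply, ContinuousLinearMap.adjoint_inner_left, toC_apply, map_sub,
      inner_sub_left]
    ring
  refine ⟨Integrable.congr h12 e, ?_⟩
  rw [← prim_congr P.T_pos e, prim_add P.T_pos h1 h2]
  rfl

theorem DcostC_apply (θ : R) (y : WT P.T n) (δ : R × CE P.T n) (t : Icc (0 : ℝ) P.T) :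
    P.DcostC (θ, toC P.T_pos y) δ t = (∫ s in (t : ℝ)..P.T, dRun θ y δ s) + dEnd y δ := by
  obtain ⟨h1, h2⟩ := DrunPrim_eq θ y δ
  rw [← flipC_prim P.T_pos h1, ← h2, DcostC, add_apply, ContinuousMap.add_apply]
  congr 1
  change inner ℝ (P.Q₂ (toC P.T_pos y ⟨P.T, _⟩ - P.ydT)) _ = _
  rw [toC_apply]
  rfl

/-- The derivative of the value function along the state. -/
def dVal (θ : R) (y : WT P.T n) (δ : R × CE P.T n) (t : ℝ) : ℝ :=
  inner ℝ (P.gradθV θ t (y t)) δ.1 + inner ℝ (P.gradV θ t (y t)) (ext P.T_pos δ.2 t)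

theorem DmismatchC_apply (θ : R) (y : WT P.T n) (δ : R × CE P.T n) (t : Icc (0 : ℝ) P.T) :
    P.DmismatchC (θ, toC P.T_pos y) δ t =
      dVal θ y δ t - ((∫ s in (t : ℝ)..P.T, dRun θ y δ s) + dEnd y δ) := by
  have hD := P.slabDiff_V.fderiv P.T_pos (k := 1) (by norm_num)
  rw [DmismatchC, sub_apply, ContinuousMap.sub_apply, DcostC_apply]
  congr 1
  rw [ContinuousLinearMap.comp_apply, mulC_apply, hD.nem_apply, withParam_apply, withParam_apply,
    P.slabDiff_V.fderiv_apply (by norm_num) t.2, toC_apply, dVal, gradV, gradθV, inner_gradient,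
    inner_gradient, ext_apply P.T_pos _ t.2]

/-- The derivative of `∂_y V_θ - p` along the state. -/
def dGrad (θ : R) (y : WT P.T n) (δ : R × CE P.T n) (π : CE P.T n) (t : ℝ) : Euc n :=
  P.dθgradV θ t (y t) δ.1 + P.hessV θ t (y t) (ext P.T_pos δ.2 t) - ext P.T_pos π t

theorem ext_DgradVC_sub (θ : R) (y : WT P.T n) (δ : R × CE P.T n) (π : CE P.T n) {t : ℝ}
    (ht : t ∈ Icc 0 P.T) :
    ext P.T_pos (P.DgradVC (θ, toC P.T_pos y) δ - π) t = dGrad θ y δ π t := by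
  have hD := P.slabDiff_gradV.fderiv P.T_pos (k := 1) (by norm_num)
  rw [ext_apply P.T_pos _ ht, ContinuousMap.sub_apply, DgradVC, ContinuousLinearMap.comp_apply,
    mulC_apply, hD.nem_apply, withParam_apply, withParam_apply,
    P.slabDiff_gradV.fderiv_apply (by norm_num) ht, toC_apply, dGrad, ext_apply P.T_pos _ ht,
    ext_apply P.T_pos _ ht]
  rfl

theorem DobjC_apply (θ : R) (y p : WT P.T n) (δ : R × CE P.T n) (π : CE P.T n) :
    P.DobjC ((θ, toC P.T_pos y), toC P.T_pos p) (δ, π) =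
      (∫ s in (0 : ℝ)..P.T, dRun θ y δ s) + dEnd y δ +
      (P.γ₁ * (∫ t in (0 : ℝ)..P.T, P.mismatch θ y t *
          (dVal θ y δ t - ((∫ s in t..P.T, dRun θ y δ s) + dEnd y δ))) +
        P.γ₂ * ∫ t in (0 : ℝ)..P.T,
          inner ℝ (P.gradV θ t (y t) - p t) (dGrad θ y δ π t)) := by
  have h1 : DsqC P.T_pos (P.mismatchC (θ, toC P.T_pos y)) (P.DmismatchC (θ, toC P.T_pos y) δ) =
      ∫ t in (0 : ℝ)..P.T, P.mismatch θ y t *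
          (dVal θ y δ t - ((∫ s in t..P.T, dRun θ y δ s) + dEnd y δ)) := by
    rw [DsqC_apply]
    refine intervalIntegral.integral_congr fun t ht => ?_
    rw [uIcc_of_le P.T_pos.le] at ht
    beta_reduce
    rw [ext_mismatchC θ y ht, ext_apply P.T_pos _ ht, DmismatchC_apply]
    exact mul_comm _ _
  have h2 : DsqC P.T_pos (P.gradVC (θ, toC P.T_pos y) - toC P.T_pos p)
      (P.DgradVC (θ, toC P.T_pos y) δ - π) =
      ∫ t in (0 : ℝ)..P.T, inner ℝ (P.gradV θ t (y t) - p t) (dGrad θ y δ π t) := by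
    rw [DsqC_apply]
    refine intervalIntegral.integral_congr fun t ht => ?_
    rw [uIcc_of_le P.T_pos.le] at ht
    beta_reduce
    rw [ext_DgradVC_sub θ y δ π ht, ext_apply P.T_pos _ ht, ContinuousMap.sub_apply, gradVC_apply,
      toC_apply]
  rw [← h1, ← h2, ← DcostC_apply θ y δ ⟨0, le_rfl, P.T_pos.le⟩]
  rfl

end LearningProblem

/-! ### Integration by parts in `W_T` -/

section IntegrationByParts

variable {T : ℝ} {n : ℕ}

theorem WT.continuousOn (hT : 0 < T) (a : WT T n) : ContinuousOn a (Icc 0 T) :=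
  (continuous_ext hT (toC hT a)).continuousOn.congr fun _ ht => (ext_toC hT a ht).symm

/-- Inner products of `L²` functions with elements of `W_T` are integrable. -/
theorem integrableOn_inner_val (hT : 0 < T) {v : ℝ → Euc n} (hv : IntegrableOn v (Ioo 0 T))
    (a : WT T n) : IntegrableOn (fun t => inner ℝ (v t) (a t)) (Ioo 0 T) := by
  have h := integrableOn_clm_ext hT ((innerL (F := Euc n)).integrable_comp hv) (toC hT a)
  refine Integrable.congr h ?_
  filter_upwards [ae_restrict_mem measurableSet_Ioo] with t ht
  rw [ext_toC hT a (Ioo_subset_Icc_self ht), innerL_apply]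

theorem WT.val_sub_val (hT : 0 < T) (a : WT T n) {s t : ℝ} (hs : s ∈ Icc 0 T) (ht : t ∈ Icc 0 T) :
    a t - a s = ∫ r in s..t, a.dot r := by
  have h0 : (0 : ℝ) ∈ Icc 0 T := ⟨le_rfl, hT.le⟩
  rw [WT.val_eq a t, WT.val_eq a s, add_sub_add_left_eq_sub]
  exact intervalIntegral.integral_interval_sub_left
    (intervalIntegrable_of_Ioo (L2.integrableOn _) h0 ht)
    (intervalIntegrable_of_Ioo (L2.integrableOn _) h0 hs)

theorem inner_intervalIntegral {F : Type*} [NormedAddCommGroup F] [InnerProductSpace ℝ F]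
    [CompleteSpace F] {a b : ℝ} {v : ℝ → F} (hv : IntervalIntegrable v volume a b) (c : F) :
    inner ℝ c (∫ t in a..b, v t) = ∫ t in a..b, inner ℝ c (v t) :=
  ((innerL c).intervalIntegral_comp_comm hv).symm

/-- This is `integral_inner_prim` for the two derivatives, with the inner integrals read as `b(T) -
b(t)` and `a(t) - a(0)`. The constant parts integrate to the boundary terms. -/
theorem WT.integral_inner_dot (hT : 0 < T) (a b : WT T n) :
    (∫ t in (0 : ℝ)..T, inner ℝ (a.dot t) (b t)) + ∫ t in (0 : ℝ)..T, inner ℝ (b.dot t) (a t) =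
      inner ℝ (a T) (b T) - inner ℝ (a 0) (b 0) := by
  have h0 : (0 : ℝ) ∈ Icc 0 T := ⟨le_rfl, hT.le⟩
  have hTT : T ∈ Icc 0 T := ⟨hT.le, le_rfl⟩
  have ii : ∀ {F : Type} [NormedAddCommGroup F] [NormedSpace ℝ F] {v : ℝ → F}, IntegrableOn v (Ioo 0 T) →
      IntervalIntegrable v volume 0 T := fun hv => intervalIntegrable_of_Ioo hv h0 hTT
  have ha := L2.integrableOn a.dot
  have hb := L2.integrableOn b.dot
  have ia : IntegrableOn (fun t => inner ℝ (b T) (a.dot t)) (Ioo 0 T) :=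
    (innerL (b T)).integrable_comp ha
  have ib : IntegrableOn (fun t => inner ℝ (a 0) (b.dot t)) (Ioo 0 T) :=
    (innerL (a 0)).integrable_comp hb
  have h := integral_inner_prim hT.le ha hb
  have e1 : ∫ t in (0 : ℝ)..T, inner ℝ (a.dot t) (∫ s in t..T, b.dot s) =
      inner ℝ (a T - a 0) (b T) - ∫ t in (0 : ℝ)..T, inner ℝ (a.dot t) (b t) := by
    rw [WT.val_sub_val hT a h0 hTT, real_inner_comm, inner_intervalIntegral (ii ha),
      ← intervalIntegral.integral_sub (ii ia) (ii (integrableOn_inner_val hT ha b))]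
    refine intervalIntegral.integral_congr fun t ht => ?_
    rw [uIcc_of_le hT.le] at ht
    rw [← WT.val_sub_val hT b ht hTT, inner_sub_right, real_inner_comm]
  have e2 : ∫ t in (0 : ℝ)..T, inner ℝ (∫ s in (0 : ℝ)..t, a.dot s) (b.dot t) =
      (∫ t in (0 : ℝ)..T, inner ℝ (b.dot t) (a t)) - inner ℝ (a 0) (b T - b 0) := by
    rw [WT.val_sub_val hT b h0 hTT, inner_intervalIntegral (ii hb),
      ← intervalIntegral.integral_sub (ii (integrableOn_inner_val hT hb a)) (ii ib)]
    refine intervalIntegral.integral_congr fun t ht => ?_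
    rw [uIcc_of_le hT.le] at ht
    rw [← WT.val_sub_val hT a h0 ht, inner_sub_left, real_inner_comm]
  rw [e1, e2, inner_sub_left, inner_sub_right] at h
  linarith

end IntegrationByParts

/-! ### The linearised state and adjoint equations -/

namespace LearningProblem

open ContinuousLinearMap (adjoint)

variable {n m N : ℕ} {R : Type*} [NormedAddCommGroup R] [InnerProductSpace ℝ R]
  [FiniteDimensional ℝ R] (P : LearningProblem n m N R)

/-- The derivative of `AC`. -/
def DAC (q : R × CE P.T n) : R × CE P.T n →L[ℝ] CO P.T n :=
  mulC (nem (fun (t : Icc (0 : ℝ) P.T) => fderiv ℝ fun q : R × Euc n => P.A q.1 t q.2)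
    (withParam q)) ∘L withParam

theorem hasFDerivAt_AC (q : R × CE P.T n) : HasFDerivAt P.AC (P.DAC q) q :=
  (P.slabDiff_A.hasFDerivAt_nem P.T_pos le_rfl (withParam q)).comp q (hasFDerivAt_withParam q)

theorem DAC_apply (q δ : R × CE P.T n) (t : Icc (0 : ℝ) P.T) :
    P.DAC q δ t = fderiv ℝ (P.A q.1 t) (q.2 t) (δ.2 t) +
      adjL ((fderiv ℝ (P.g t) (q.2 t)).flip (P.dθF q.1 t (q.2 t) δ.1)) := by
  have h := P.slabDiff_A.fderiv P.T_pos (k := 0) (by norm_num)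
  rw [DAC, ContinuousLinearMap.comp_apply, mulC_apply, h.nem_apply, withParam_apply,
    withParam_apply, fderiv_A t.2]

/-- The linearised state and adjoint equations along `(y, p)` in the direction `δθ`. -/
structure IsLinearised (θ δθ : R) (y p δ π : WT P.T n) : Prop where
  state : ∀ᵐ t ∂(volume.restrict (Ioo 0 P.T)),
    δ.dot t = P.At t (θ, y t) (δ t) + P.g t (y t) (P.dyF θ t (y t) (δ t)) +
      P.g t (y t) (P.dθF θ t (y t) δθ)
  adj : ∀ᵐ t ∂(volume.restrict (Ioo 0 P.T)),
    -π.dot t = P.A θ t (y t) (π t) + (P.dyA θ t (y t) (p t) (δ t) +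
      adjoint ((fderiv ℝ (P.g t) (y t)).flip (P.dθF θ t (y t) δθ)) (p t)) +
      adjoint P.Q₁ (P.Q₁ (δ t))
  state_zero : δ 0 = 0
  adj_end : π P.T = adjoint P.Q₂ (P.Q₂ (δ P.T))

variable {P}

theorem dot_adjState (q : R × CE P.T n) :
    (P.adjState q).dot = -(toL2 P.T_pos (mulC (P.AC q) (toC P.T_pos (P.adjState q))) +
      P.adjForce q.2) := by
  rw [adjState, toC_bwdSol]
  rfl

/-- Both sides of the state equation are differentiable maps of the parameter into `L²` that agree
near `θ`, so their derivatives agree. The time derivative commutes with the parameter derivative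
because `dotL` is linear and continuous. -/
theorem linearised_state {Y : R → WT P.T n} {Y' : R →L[ℝ] WT P.T n} {θ : R}
    (hY : HasFDerivAt Y Y' θ)
    (h : ∀ᶠ η in 𝓝 θ, (Y η).dot = toL2 P.T_pos (P.rhsC (η, toC P.T_pos (Y η)))) (δθ : R) :
    (Y' δθ).dot =
      toL2 P.T_pos (P.DrhsC (θ, toC P.T_pos (Y θ)) (δθ, toC P.T_pos (Y' δθ))) := by
  have dYc : HasFDerivAt (fun η => toC P.T_pos (Y η)) (toC P.T_pos ∘L Y') θ :=
    (hasFDerivAt_intoC (toC P.T_pos) _).comp θ hY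
  have dq := (hasFDerivAt_id θ).prodMk dYc
  have s1 : HasFDerivAt (fun η => dotL (Y η)) (dotL ∘L Y') θ := dotL.hasFDerivAt.comp θ hY
  have s2 := (hasFDerivAt_fromC (toL2 P.T_pos) _).comp θ
      (HasFDerivAt.comp (g := P.rhsC) θ (P.hasFDerivAt_rhsC (θ, toC P.T_pos (Y θ))) dq)
  exact congrArg (fun L => L δθ) (s1.unique (s2.congr_of_eventuallyEq h))

theorem hasFDerivAt_adjForce (u : CE P.T n) :
    HasFDerivAt P.adjForce ((adjoint P.Q₁ ∘L P.Q₁).compLpL 2 (volume.restrict (Ioo 0 P.T)) ∘L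
      toL2 P.T_pos) u :=
  ((adjoint P.Q₁ ∘L P.Q₁).compLpL 2 (volume.restrict (Ioo 0 P.T))).hasFDerivAt.comp u
    ((hasFDerivAt_fromC (toL2 P.T_pos) u).sub_const P.yd)

theorem hasFDerivAt_adjEnd (u : CE P.T n) :
    HasFDerivAt P.adjEnd ((adjoint P.Q₂ ∘L P.Q₂) ∘L evalC ⟨P.T, P.T_pos.le, le_rfl⟩) u :=
  (adjoint P.Q₂ ∘L P.Q₂).hasFDerivAt.comp u ((hasFDerivAt_fromC
    (evalC (F := Euc n) (⟨P.T, P.T_pos.le, le_rfl⟩ : Icc (0 : ℝ) P.T)) u).sub_const P.ydT)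

theorem linearised_adjoint_end {Y Z : R → WT P.T n} {Y' Z' : R →L[ℝ] WT P.T n} {θ : R}
    (hY : HasFDerivAt Y Y' θ) (hZ : HasFDerivAt Z Z' θ)
    (h : ∀ᶠ η in 𝓝 θ, Z η = P.adjState (η, toC P.T_pos (Y η))) (δθ : R) :
    Z' δθ P.T = adjoint P.Q₂ (P.Q₂ (Y' δθ P.T)) := by
  have dYc : HasFDerivAt (fun η => toC P.T_pos (Y η)) (toC P.T_pos ∘L Y') θ :=
    (hasFDerivAt_intoC (toC P.T_pos) _).comp θ hY
  have dZc : HasFDerivAt (fun η => toC P.T_pos (Z η)) (toC P.T_pos ∘L Z') θ :=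
    (hasFDerivAt_intoC (toC P.T_pos) _).comp θ hZ
  let T' : Icc (0 : ℝ) P.T := ⟨P.T, P.T_pos.le, le_rfl⟩
  have e1 := (hasFDerivAt_fromC (evalC T') _).comp θ dZc
  have e2 := HasFDerivAt.comp (g := P.adjEnd) θ (hasFDerivAt_adjEnd (toC P.T_pos (Y θ))) dYc
  have he : (evalC T' ∘ fun η => toC P.T_pos (Z η)) =ᶠ[𝓝 θ]
      P.adjEnd ∘ fun η => toC P.T_pos (Y η) := h.mono fun η hη => by
    change toC P.T_pos (Z η) T' = _
    rw [hη, toC_apply]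
    exact bwdSol_end _ _ _ _
  have e3 := congrArg (fun L => L δθ) (e1.unique (e2.congr_of_eventuallyEq he))
  change toC P.T_pos (Z' δθ) T' = adjoint P.Q₂ (P.Q₂ (toC P.T_pos (Y' δθ) T')) at e3
  rw [toC_apply, toC_apply] at e3
  exact e3

theorem linearised_adjoint {Y Z : R → WT P.T n} {Y' Z' : R →L[ℝ] WT P.T n} {θ : R}
    (hY : HasFDerivAt Y Y' θ) (hZ : HasFDerivAt Z Z' θ)
    (h : ∀ᶠ η in 𝓝 θ, Z η = P.adjState (η, toC P.T_pos (Y η))) (δθ : R) :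
    (Z' δθ).dot = -(toL2 P.T_pos (mulC (P.AC (θ, toC P.T_pos (Y θ))) (toC P.T_pos (Z' δθ)) +
        mulC (P.DAC (θ, toC P.T_pos (Y θ)) (δθ, toC P.T_pos (Y' δθ))) (toC P.T_pos (Z θ))) +
      (adjoint P.Q₁ ∘L P.Q₁).compLpL 2 (volume.restrict (Ioo 0 P.T))
        (toL2 P.T_pos (toC P.T_pos (Y' δθ)))) := by
  have dYc : HasFDerivAt (fun η => toC P.T_pos (Y η)) (toC P.T_pos ∘L Y') θ :=
    (hasFDerivAt_intoC (toC P.T_pos) _).comp θ hY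
  have dZc : HasFDerivAt (fun η => toC P.T_pos (Z η)) (toC P.T_pos ∘L Z') θ :=
    (hasFDerivAt_intoC (toC P.T_pos) _).comp θ hZ
  have dq := (hasFDerivAt_id θ).prodMk dYc
  have a1 : HasFDerivAt (fun η => dotL (Z η)) (dotL ∘L Z') θ := dotL.hasFDerivAt.comp θ hZ
  have a2 := HasFDerivAt.comp (g := P.AC) θ (P.hasFDerivAt_AC (θ, toC P.T_pos (Y θ))) dq
  -- The product rule for `A` applied to the adjoint state gives two terms: `A` acting on the
  -- variation of `p`, and the variation of `A` acting on `p`.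
  have a3 := ContinuousLinearMap.hasFDerivAt_of_bilinear (E := CO P.T n) (F := CE P.T n)
    (G := CE P.T n) mulC a2 dZc
  have a4 := (hasFDerivAt_fromC (toL2 P.T_pos) _).comp θ a3
  have a5 := HasFDerivAt.comp (g := P.adjForce) θ
    (hasFDerivAt_adjForce (toC P.T_pos (Y θ))) dYc
  have a6 := (a4.add a5).neg
  refine congrArg (fun L => L δθ) (a1.unique (a6.congr_of_eventuallyEq (h.mono fun η hη => ?_)))
  have e := dot_adjState (P := P) (η, toC P.T_pos (Y η))
  rw [← hη] at e
  exact e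

/-- The derivatives of the parameter-to-state and parameter-to-adjoint maps solve the linearised
equations. -/
theorem isLinearised_fderiv {c : Euc n} {Y Z : R → WT P.T n} {Y' Z' : R →L[ℝ] WT P.T n} {θ : R}
    (hY : HasFDerivAt Y Y' θ) (hZ : HasFDerivAt Z Z' θ)
    (h : ∀ᶠ η in 𝓝 θ, (Y η).dot = toL2 P.T_pos (P.rhsC (η, toC P.T_pos (Y η))) ∧ Y η 0 = c ∧
      Z η = P.adjState (η, toC P.T_pos (Y η))) (δθ : R) :
    P.IsLinearised θ δθ (Y θ) (Z θ) (Y' δθ) (Z' δθ) := by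
  refine ⟨?_, ?_, ?_, linearised_adjoint_end hY hZ (h.mono fun η hη => hη.2.2) δθ⟩
  · rw [linearised_state hY (h.mono fun η hη => hη.1) δθ]
    filter_upwards [toL2_ae P.T_pos
        (P.DrhsC (θ, toC P.T_pos (Y θ)) (δθ, toC P.T_pos (Y' δθ))),
      ae_restrict_mem measurableSet_Ioo] with t h1 ht
    have ht' := Ioo_subset_Icc_self ht
    rw [h1, ext_apply P.T_pos _ ht', DrhsC_apply, fderiv_rhs ht', toC_apply, toC_apply]
  · rw [linearised_adjoint hY hZ (h.mono fun η hη => hη.2.2) δθ]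
    set v := toL2 P.T_pos (toC P.T_pos (Y' δθ)) with hv
    set w : CE P.T n := mulC (P.AC (θ, toC P.T_pos (Y θ))) (toC P.T_pos (Z' δθ)) +
      mulC (P.DAC (θ, toC P.T_pos (Y θ)) (δθ, toC P.T_pos (Y' δθ))) (toC P.T_pos (Z θ)) with hw
    set Q := (adjoint P.Q₁ ∘L P.Q₁).compLpL 2 (volume.restrict (Ioo 0 P.T)) with hQ
    filter_upwards [Lp.coeFn_neg (toL2 P.T_pos w + Q v), Lp.coeFn_add (toL2 P.T_pos w) (Q v),
      toL2_ae P.T_pos w, toL2_ae P.T_pos (toC P.T_pos (Y' δθ)),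
      ContinuousLinearMap.coeFn_compLpL (adjoint P.Q₁ ∘L P.Q₁) v,
      ae_restrict_mem measurableSet_Ioo] with t h1 h2 h3 h4 h5 ht
    have ht' := Ioo_subset_Icc_self ht
    rw [h1, Pi.neg_apply, h2, Pi.add_apply, neg_neg, h3, hQ, h5, hv, h4, ext_toC _ _ ht',
      ext_apply P.T_pos _ ht', hw, ContinuousMap.add_apply, mulC_apply, mulC_apply, AC_apply,
      DAC_apply, toC_apply, toC_apply, toC_apply, toC_apply]
    rfl
  -- The initial value is the same `c` for all nearby parameters, so its derivative vanishes.
  · have z1 : HasFDerivAt (fun η => val0 P.T_pos (Y η)) (val0 P.T_pos ∘L Y') θ :=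
      (val0 P.T_pos).hasFDerivAt.comp θ hY
    exact congrArg (fun L => L δθ)
      (z1.unique ((hasFDerivAt_const c θ).congr_of_eventuallyEq (h.mono fun η hη => hη.2.1)))

end LearningProblem

/-! ### Solvability of the costate equations -/

section Along

variable {T : ℝ} {n : ℕ}

theorem memLp_of_continuousOn {v : ℝ → Euc n} (hv : ContinuousOn v (Icc 0 T)) :
    MemLp v 2 (volume.restrict (Ioo 0 T)) := by
  obtain ⟨C, hC⟩ := isCompact_Icc.exists_bound_of_continuousOn hv
  refine MemLp.of_bound ((hv.mono Ioo_subset_Icc_self).aestronglyMeasurable measurableSet_Ioo) C ?_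
  filter_upwards [ae_restrict_mem measurableSet_Ioo] with t ht
  exact hC t (Ioo_subset_Icc_self ht)

theorem memLp_smul_of_continuousOn {c : ℝ → ℝ} (hc : ContinuousOn c (Icc 0 T)) {v : ℝ → Euc n}
    (hv : MemLp v 2 (volume.restrict (Ioo 0 T))) :
    MemLp (fun t => c t • v t) 2 (volume.restrict (Ioo 0 T)) := by
  obtain ⟨C, hC⟩ := isCompact_Icc.exists_bound_of_continuousOn hc
  refine hv.of_le_mul (c := C) (((hc.mono Ioo_subset_Icc_self).aestronglyMeasurable
    measurableSet_Ioo).smul hv.1) ?_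
  filter_upwards [ae_restrict_mem measurableSet_Ioo] with t ht
  rw [norm_smul]
  exact mul_le_mul_of_nonneg_right (hC t (Ioo_subset_Icc_self ht)) (norm_nonneg _)

theorem SlabDiff.continuousOn_along {X F : Type*} [NormedAddCommGroup X] [NormedSpace ℝ X]
    [NormedAddCommGroup F] [NormedSpace ℝ F] {k : ℕ∞ω} {H : ℝ → X × Euc n → F}
    (h : SlabDiff T k H) (hT : 0 < T) (x : X) (y : WT T n) :
    ContinuousOn (fun t => H t (x, y t)) (Icc 0 T) :=
  ContinuousOn.comp (ContDiffOn.continuousOn h)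
    (continuousOn_id.prodMk (continuousOn_const.prodMk (y.continuousOn hT)))
    fun _ ht => ⟨ht, mem_univ _⟩

end Along

namespace LearningProblem

open ContinuousLinearMap (adjoint)

variable {n m N : ℕ} {R : Type*} [NormedAddCommGroup R] [InnerProductSpace ℝ R]
  [FiniteDimensional ℝ R] {P : LearningProblem n m N R}

theorem continuousOn_mismatch (θ : R) (y : WT P.T n) :
    ContinuousOn (P.mismatch θ y) (Icc 0 P.T) :=
  (continuous_ext P.T_pos _).continuousOn.congr fun _ ht => (ext_mismatchC θ y ht).symm

theorem continuousOn_Φ (θ : R) (y : WT P.T n) : ContinuousOn (P.Φ θ y) (Icc 0 P.T) := by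
  refine (continuous_ext P.T_pos (fprim P.T_pos
    (P.mismatchC (θ, toC P.T_pos y)))).continuousOn.congr fun t ht => ?_
  rw [ext_apply P.T_pos _ ht, fprim_mismatchC]

theorem continuousOn_weight (θ : R) (y : WT P.T n) :
    ContinuousOn (fun t => 1 - P.γ₁ * P.Φ θ y t) (Icc 0 P.T) :=
  continuousOn_const.sub (continuousOn_const.mul (continuousOn_Φ θ y))

theorem continuousOn_gradV_sub (θ : R) (y p : WT P.T n) :
    ContinuousOn (fun t => P.gradV θ t (y t) - p t) (Icc 0 P.T) :=
  (P.slabDiff_gradV.continuousOn_along P.T_pos θ y).sub (p.continuousOn P.T_pos)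

theorem continuousOn_adjoint_dyF_F (θ : R) (y : WT P.T n) :
    ContinuousOn (fun t => adjoint (P.dyF θ t (y t)) (P.F θ t (y t))) (Icc 0 P.T) :=
  ((P.slabDiff_dyF.clm_comp adjL).continuousOn_along P.T_pos θ y).clm_apply
    (P.slabDiff_F.continuousOn_along P.T_pos θ y)

theorem continuousOn_adjoint_dθF (θ : R) (y : WT P.T n) :
    ContinuousOn (fun t => adjoint (P.dθF θ t (y t))) (Icc 0 P.T) :=
  (P.slabDiff_dθF.clm_comp adjL).continuousOn_along P.T_pos θ y

theorem continuousOn_yHat_rest (θ : R) (y p : WT P.T n) :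
    ContinuousOn (fun t => (P.β * (1 - P.γ₁ * P.Φ θ y t)) •
        adjoint (P.dyF θ t (y t)) (P.F θ t (y t)) +
      (P.γ₁ * P.mismatch θ y t) • P.gradV θ t (y t) +
      P.γ₂ • P.hessV θ t (y t) (P.gradV θ t (y t) - p t)) (Icc 0 P.T) :=
  (((continuousOn_const.mul (continuousOn_weight θ y)).smul
      (continuousOn_adjoint_dyF_F θ y)).add
    ((continuousOn_const.mul (continuousOn_mismatch θ y)).smul
      (P.slabDiff_gradV.continuousOn_along P.T_pos θ y))).add
    (((P.slabDiff_hessV.continuousOn_along P.T_pos θ y).clm_apply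
      (continuousOn_gradV_sub θ y p)).const_smul P.γ₂)

theorem memLp_tracking (y : WT P.T n) :
    MemLp (fun t => adjoint P.Q₁ (P.Q₁ (y t - P.yd t))) 2 (volume.restrict (Ioo 0 P.T)) :=
  (adjoint P.Q₁ ∘L P.Q₁).comp_memLp'
    ((memLp_of_continuousOn (y.continuousOn P.T_pos)).sub (Lp.memLp P.yd))

/-- Only the tracking term is possibly discontinuous, through `y_d`; a continuous weight keeps it in
`L²`, and the remaining terms are continuous on `[0, T]`. -/
theorem memLp_yHat (θ : R) (y p : WT P.T n) :
    MemLp (P.yHat θ y p) 2 (volume.restrict (Ioo 0 P.T)) := by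
  have h := (memLp_smul_of_continuousOn (continuousOn_weight θ y) (memLp_tracking y)).add
    (memLp_of_continuousOn (continuousOn_yHat_rest θ y p))
  refine (memLp_congr_ae (ae_of_all _ fun t => ?_)).1 h
  rw [Pi.add_apply, yHat, ← add_assoc, ← add_assoc]

theorem continuousOn_adjoint_dyA (θ : R) (y p κ : WT P.T n) :
    ContinuousOn (fun t => adjoint (P.dyA θ t (y t) (p t)) (κ t)) (Icc 0 P.T) := by
  have h : SlabDiff P.T 0 (fun t (q : R × Euc n) => (fderiv ℝ (P.A q.1 t) q.2).flip) :=
    SlabDiff.clm_comp (F := Euc n →L[ℝ] Euc n →L[ℝ] Euc n) flipL P.slabDiff_DA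
  exact (adjL.continuous.comp_continuousOn ((h.continuousOn_along P.T_pos θ y).clm_apply
    (p.continuousOn P.T_pos))).clm_apply (κ.continuousOn P.T_pos)

theorem memLp_costateForce (θ : R) (y p κ : WT P.T n) :
    MemLp (fun t => adjoint (P.dyA θ t (y t) (p t)) (κ t) + adjoint P.Q₁ (P.Q₁ (κ t)) +
      P.yHat θ y p t) 2 (volume.restrict (Ioo 0 P.T)) :=
  ((memLp_of_continuousOn (continuousOn_adjoint_dyA θ y p κ)).add
    ((adjoint P.Q₁ ∘L P.Q₁).comp_memLp' (memLp_of_continuousOn (κ.continuousOn P.T_pos)))).add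
    (memLp_yHat θ y p)

theorem memLp_pHat (θ : R) (y p : WT P.T n) :
    MemLp (P.pHat θ y p) 2 (volume.restrict (Ioo 0 P.T)) :=
  memLp_of_continuousOn (((p.continuousOn P.T_pos).sub
    (P.slabDiff_gradV.continuousOn_along P.T_pos θ y)).const_smul P.γ₂)

theorem slabDiff_closedLoop : SlabDiff P.T 1 (fun t (q : R × Euc n) =>
    P.A q.1 t q.2 + adjoint (P.dyF q.1 t q.2) ∘L adjoint (P.g t q.2)) := by
  have h1 : SlabDiff P.T 1 (fun t (q : R × Euc n) => adjoint (P.dyF q.1 t q.2)) :=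
    P.slabDiff_dyF.clm_comp adjL
  have h2 : SlabDiff P.T 1 (fun t (q : R × Euc n) => adjoint (P.g t q.2)) :=
    (P.slabDiff_g.of_le one_le_two).clm_comp adjL
  exact P.slabDiff_A.add (ContDiffOn.clm_comp h1 h2)

/-- The system is triangular. The equation for `κ` does not contain `ζ` and is solved forward; once
`κ` is known, its terms join the forcing of a backward equation for `ζ` with coefficient `A + D_yFᵀ
gᵀ`. -/
theorem existsUnique_isCostate (θ : R) (y p : WT P.T n) :
    ∃! ζκ : WT P.T n × WT P.T n, P.IsCostate θ y p ζκ.1 ζκ.2 := by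
  have hB : ∀ t ∈ Icc 0 P.T, ext P.T_pos (nem (fun (t : Icc (0 : ℝ) P.T) => P.At t)
      (withParam (θ, toC P.T_pos y))) t = adjoint (P.A θ t (y t)) := fun t ht => by
    rw [ext_nem_withParam P.slabDiff_At θ y ht, adjoint_A]
  have hC : ∀ t ∈ Icc 0 P.T, ext P.T_pos (nem (fun (t : Icc (0 : ℝ) P.T) (q : R × Euc n) =>
      P.A q.1 t q.2 + adjoint (P.dyF q.1 t q.2) ∘L adjoint (P.g t q.2))
      (withParam (θ, toC P.T_pos y))) t =
      P.A θ t (y t) + adjoint (P.dyF θ t (y t)) ∘L adjoint (P.g t (y t)) := fun t ht =>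
    ext_nem_withParam P.slabDiff_closedLoop θ y ht
  set B := nem (fun (t : Icc (0 : ℝ) P.T) => P.At t) (withParam (θ, toC P.T_pos y))
  set C := nem (fun (t : Icc (0 : ℝ) P.T) (q : R × Euc n) =>
      P.A q.1 t q.2 + adjoint (P.dyF q.1 t q.2) ∘L adjoint (P.g t q.2))
      (withParam (θ, toC P.T_pos y))
  set κ := fwdSol P.T_pos B (memLp_pHat θ y p).toLp 0 with hκ
  -- Being a costate pair is equivalent to being this explicit pair, which settles existence and
  -- uniqueness together.
  have key : ∀ ζ κ' : WT P.T n, P.IsCostate θ y p ζ κ' ↔ κ' = κ ∧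
      ζ = bwdSol P.T_pos C (memLp_costateForce θ y p κ).toLp
        (adjoint P.Q₂ (P.Q₂ (κ P.T)) + P.yHatT θ y) := by
    intro ζ κ'
    constructor
    · rintro ⟨h1, h2, h3, h4⟩
      have e : κ' = κ := by
        refine eq_fwdSol P.T_pos ?_ h4
        filter_upwards [h2, (memLp_pHat θ y p).coeFn_toLp, ae_restrict_mem measurableSet_Ioo]
          with t a1 a2 ht
        rw [a1, a2, hB t (Ioo_subset_Icc_self ht)]
      subst e
      refine ⟨rfl, eq_bwdSol P.T_pos ?_ h3⟩
      filter_upwards [h1, (memLp_costateForce θ y p κ).coeFn_toLp,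
        ae_restrict_mem measurableSet_Ioo] with t a1 a2 ht
      rw [a1, a2, hC t (Ioo_subset_Icc_self ht), add_apply, ContinuousLinearMap.comp_apply]
      abel
    · rintro ⟨rfl, rfl⟩
      refine ⟨?_, ?_, bwdSol_end _ _ _ _, fwdSol_zero _ _ _ _⟩
      · filter_upwards [bwdSol_dot P.T_pos C (memLp_costateForce θ y p κ).toLp
          (adjoint P.Q₂ (P.Q₂ (κ P.T)) + P.yHatT θ y),
          (memLp_costateForce θ y p κ).coeFn_toLp, ae_restrict_mem measurableSet_Ioo] with t a1 a2 ht
        rw [a1, a2, hC t (Ioo_subset_Icc_self ht), add_apply, ContinuousLinearMap.comp_apply]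
        abel
      · filter_upwards [fwdSol_dot P.T_pos B (memLp_pHat θ y p).toLp 0,
          (memLp_pHat θ y p).coeFn_toLp, ae_restrict_mem measurableSet_Ioo] with t a1 a2 ht
        rw [a2, hB t (Ioo_subset_Icc_self ht)] at a1
        exact a1
  refine ⟨(_, κ), (key _ _).2 ⟨rfl, rfl⟩, fun ζκ h => ?_⟩
  obtain ⟨h1, h2⟩ := (key _ _).1 h
  exact Prod.ext h2 h1

end LearningProblem

/-! ### Duality between linearised equations and costates -/

namespace LearningProblem

open ContinuousLinearMap (adjoint)

variable {n m N : ℕ} {R : Type*} [NormedAddCommGroup R] [InnerProductSpace ℝ R]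
  [FiniteDimensional ℝ R] {P : LearningProblem n m N R}

/-- Symmetry of second derivatives. It is needed because differentiation applies the Hessian to the
variation of the state, whereas `yHat` applies it to the residual `∂_y V - p`. -/
theorem inner_hessV_comm (θ : R) (t : ℝ) (y a b : Euc n) :
    inner ℝ (P.hessV θ t y a) b = inner ℝ (P.hessV θ t y b) a := by
  have hV : ContDiff ℝ 4 (P.V θ t) :=
    P.V_smooth.comp (f := fun y : Euc n => (θ, t, y)) (by fun_prop)
  have hd : DifferentiableAt ℝ (fderiv ℝ (P.V θ t)) y :=
    (hV.fderiv_right (m := 1) (by norm_num)).differentiable one_ne_zero y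
  have h : HasFDerivAt (P.gradV θ t) (rieszL ∘L fderiv ℝ (fderiv ℝ (P.V θ t)) y) y :=
    rieszL.hasFDerivAt.comp y hd.hasFDerivAt
  have key : ∀ a b, inner ℝ (P.hessV θ t y a) b = fderiv ℝ (fderiv ℝ (P.V θ t)) y a b := by
    intro a b
    rw [hessV, h.fderiv]
    exact InnerProductSpace.toDual_symm_apply
  rw [key, key]
  exact (hV.contDiffAt.isSymmSndFDerivAt (by simp; norm_num)) a b

/-- The integrand of the derivative of the augmented objective. -/
def dObj (θ : R) (y p : WT P.T n) (δ : R × CE P.T n) (π : CE P.T n) (t : ℝ) : ℝ :=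
  (1 - P.γ₁ * P.Φ θ y t) * dRun θ y δ t + P.γ₁ * (P.mismatch θ y t * dVal θ y δ t) +
    P.γ₂ * inner ℝ (P.gradV θ t (y t) - p t) (dGrad θ y δ π t)

theorem continuousOn_dVal (θ : R) (y : WT P.T n) (δ : R × CE P.T n) :
    ContinuousOn (dVal θ y δ) (Icc 0 P.T) :=
  ((P.slabDiff_gradθV.continuousOn_along P.T_pos θ y).inner continuousOn_const).add
    ((P.slabDiff_gradV.continuousOn_along P.T_pos θ y).inner
      (continuous_ext P.T_pos δ.2).continuousOn)

theorem continuousOn_dGrad (θ : R) (y : WT P.T n) (δ : R × CE P.T n) (π : CE P.T n) :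
    ContinuousOn (dGrad θ y δ π) (Icc 0 P.T) :=
  (((P.slabDiff_dθgradV.continuousOn_along P.T_pos θ y).clm_apply continuousOn_const).add
    ((P.slabDiff_hessV.continuousOn_along P.T_pos θ y).clm_apply
      (continuous_ext P.T_pos δ.2).continuousOn)).sub (continuous_ext P.T_pos π).continuousOn

/-- The variation of the mismatch contains the tail integral of `dRun` and the terminal term. Fubini
moves the tail integral onto the primitive `Φ` of the mismatch, and the terminal term picks up
`Φ(T)`. This is the origin of the weights `1 - γ₁ Φ` in the costate data. -/
theorem DobjC_eq_integral (θ : R) (y p : WT P.T n) (δ : R × CE P.T n) (π : CE P.T n) :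
    P.DobjC ((θ, toC P.T_pos y), toC P.T_pos p) (δ, π) =
      (∫ t in (0 : ℝ)..P.T, dObj θ y p δ π t) + (1 - P.γ₁ * P.Φ θ y P.T) * dEnd y δ := by
  have h0 : (0 : ℝ) ∈ Icc 0 P.T := ⟨le_rfl, P.T_pos.le⟩
  have hTT : P.T ∈ Icc 0 P.T := ⟨P.T_pos.le, le_rfl⟩
  have hk := (DrunPrim_eq θ y δ).1
  have ci : ∀ {v : ℝ → ℝ}, ContinuousOn v (Icc 0 P.T) → IntervalIntegrable v volume 0 P.T :=
    fun hv => ContinuousOn.intervalIntegrable (by rwa [uIcc_of_le P.T_pos.le])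
  have ik : IntervalIntegrable (dRun θ y δ) volume 0 P.T := intervalIntegrable_of_Ioo hk h0 hTT
  have cr := continuousOn_mismatch (P := P) θ y
  have cK : ContinuousOn (fun t => ∫ s in t..P.T, dRun θ y δ s) (Icc 0 P.T) := by
    refine (continuous_ext P.T_pos (flipC P.T_pos (prim (dRun θ y δ)))).continuousOn.congr
      fun t ht => ?_
    rw [ext_apply P.T_pos _ ht, flipC_prim P.T_pos hk]
  have iΦk : IntervalIntegrable (fun t => P.Φ θ y t * dRun θ y δ t) volume 0 P.T :=
    ik.continuousOn_mul (by rw [uIcc_of_le P.T_pos.le]; exact continuousOn_Φ θ y)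
  have irV : IntervalIntegrable (fun t => P.mismatch θ y t * dVal θ y δ t) volume 0 P.T :=
    ci (cr.mul (continuousOn_dVal θ y δ))
  have irK : IntervalIntegrable (fun t => P.mismatch θ y t * ∫ s in t..P.T, dRun θ y δ s)
    volume 0 P.T := ci (cr.mul cK)
  have ire : IntervalIntegrable (fun t => P.mismatch θ y t * dEnd y δ) volume 0 P.T :=
    ci (cr.mul continuousOn_const)
  have iG : IntervalIntegrable (fun t => inner ℝ (P.gradV θ t (y t) - p t) (dGrad θ y δ π t))
    volume 0 P.T := ci ((continuousOn_gradV_sub θ y p).inner (continuousOn_dGrad θ y δ π))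
  have swap : ∫ t in (0 : ℝ)..P.T, (P.mismatch θ y t * ∫ s in t..P.T, dRun θ y δ s) =
      ∫ t in (0 : ℝ)..P.T, P.Φ θ y t * dRun θ y δ t := by
    have h := integral_inner_prim P.T_pos.le
      (cr.integrableOn_Icc.mono_set Ioo_subset_Icc_self) hk
    have hi : ∀ a b : ℝ, inner ℝ a b = a * b := fun a b => mul_comm b a
    simp only [hi] at h
    exact h
  have e1 : ∫ t in (0 : ℝ)..P.T, P.mismatch θ y t *
      (dVal θ y δ t - ((∫ s in t..P.T, dRun θ y δ s) + dEnd y δ)) =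
      (∫ t in (0 : ℝ)..P.T, P.mismatch θ y t * dVal θ y δ t) -
      ((∫ t in (0 : ℝ)..P.T, P.Φ θ y t * dRun θ y δ t) + P.Φ θ y P.T * dEnd y δ) := by
    simp only [mul_sub, mul_add]
    rw [intervalIntegral.integral_sub irV (irK.add ire), intervalIntegral.integral_add irK ire,
      swap, intervalIntegral.integral_mul_const, Φ]
  have e2 : ∫ t in (0 : ℝ)..P.T, dObj θ y p δ π t = (∫ t in (0 : ℝ)..P.T, dRun θ y δ t) -
      P.γ₁ * (∫ t in (0 : ℝ)..P.T, P.Φ θ y t * dRun θ y δ t) +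
      P.γ₁ * (∫ t in (0 : ℝ)..P.T, P.mismatch θ y t * dVal θ y δ t) +
      P.γ₂ * ∫ t in (0 : ℝ)..P.T, inner ℝ (P.gradV θ t (y t) - p t) (dGrad θ y δ π t) := by
    simp only [dObj, sub_mul, one_mul, mul_assoc]
    rw [intervalIntegral.integral_add ((ik.sub (iΦk.const_mul P.γ₁)).add (irV.const_mul P.γ₁))
        (iG.const_mul P.γ₂), intervalIntegral.integral_add (ik.sub (iΦk.const_mul P.γ₁))
        (irV.const_mul P.γ₁), intervalIntegral.integral_sub ik (iΦk.const_mul P.γ₁)]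
    simp only [intervalIntegral.integral_const_mul]
  rw [DobjC_apply, e1, e2]
  ring

/-- The integrand of `θ̂`. -/
def θDens (θ : R) (y p : WT P.T n) (t : ℝ) : R :=
  P.γ₁ • P.mismatch θ y t • P.gradθV θ t (y t) +
    ((P.β * (1 - P.γ₁ * P.Φ θ y t)) • adjoint (P.dθF θ t (y t)) (P.F θ t (y t)) +
      P.γ₂ • adjoint (P.dθgradV θ t (y t)) (P.gradV θ t (y t) - p t))

/-- Sorting the integrand by the three variations exhibits `yHat`, `pHat` and the density of `θHat`
as its coefficients. -/
theorem dObj_eq (θ δθ : R) (y p δ π : WT P.T n) {t : ℝ} (ht : t ∈ Icc 0 P.T) :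
    dObj θ y p (δθ, toC P.T_pos δ) (toC P.T_pos π) t =
      inner ℝ (P.yHat θ y p t) (δ t) + inner ℝ (P.pHat θ y p t) (π t) +
        inner ℝ (θDens θ y p t) δθ := by
  rw [dObj, dRun, dVal, dGrad, ext_toC _ _ ht, ext_toC _ _ ht, yHat, pHat, θDens]
  simp only [inner_add_left, inner_add_right, inner_sub_right, real_inner_smul_left,
    ContinuousLinearMap.adjoint_inner_left]
  rw [real_inner_comm (P.hessV θ t (y t) (δ t)), inner_hessV_comm θ t (y t) (δ t),
    inner_sub_left, inner_sub_left]
  simp only [map_sub, inner_sub_left]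
  ring

theorem dEnd_eq (θ δθ : R) (y δ : WT P.T n) :
    (1 - P.γ₁ * P.Φ θ y P.T) * dEnd y (δθ, toC P.T_pos δ) = inner ℝ (P.yHatT θ y) (δ P.T) := by
  rw [dEnd, yHatT, real_inner_smul_left, ContinuousLinearMap.adjoint_inner_left, toC_apply]

/-- The control-space vector that is mapped to the gradient by `D_θ𝓕_θ(y)ᵀ`. -/
def ctrlDual (y p ζ κ : WT P.T n) (t : ℝ) : Euc m :=
  adjoint (P.g t (y t)) (ζ t) + adjoint (fderiv ℝ (P.g t) (y t) (κ t)) (p t)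

/-- The linearised state equation is tested with `ζ`, the linearised adjoint equation with `κ`, the
equation for `ζ` with `δ` and the one for `κ` with `π`. Each coefficient term occurs once together
with its transpose and cancels. What survives is the time derivative of `⟨κ, π⟩ - ⟨ζ, δ⟩` and the
terms containing `D_θF δθ`. -/
theorem costate_identity {θ δθ : R} {y p δ π ζ κ : WT P.T n}
    (hl : P.IsLinearised θ δθ y p δ π) (hc : P.IsCostate θ y p ζ κ) :
    ∀ᵐ t ∂(volume.restrict (Ioo 0 P.T)),
      inner ℝ (P.yHat θ y p t) (δ t) + inner ℝ (P.pHat θ y p t) (π t) =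
        ((inner ℝ (κ.dot t) (π t) + inner ℝ (π.dot t) (κ t)) -
          (inner ℝ (ζ.dot t) (δ t) + inner ℝ (δ.dot t) (ζ t))) +
        inner ℝ (adjoint (P.dθF θ t (y t)) (ctrlDual y p ζ κ t)) δθ := by
  filter_upwards [hl.state, hl.adj, hc.1, hc.2.1] with t h1 h2 h3 h4
  have e1 : inner ℝ (δ.dot t) (ζ t) = inner ℝ (P.A θ t (y t) (ζ t)) (δ t) +
      inner ℝ (adjoint (P.dyF θ t (y t)) (adjoint (P.g t (y t)) (ζ t))) (δ t) +
      inner ℝ (adjoint (P.g t (y t)) (ζ t)) (P.dθF θ t (y t) δθ) := by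
    rw [h1, ← adjoint_A]
    simp only [inner_add_left, ContinuousLinearMap.adjoint_inner_left]
    rw [real_inner_comm (ζ t) (P.g t (y t) _), real_inner_comm (ζ t) (P.g t (y t) _),
      real_inner_comm (P.A θ t (y t) (ζ t))]
  have e2 : inner ℝ (-π.dot t) (κ t) = inner ℝ (adjoint (P.A θ t (y t)) (κ t)) (π t) +
      (inner ℝ (adjoint (P.dyA θ t (y t) (p t)) (κ t)) (δ t) +
        inner ℝ (adjoint (fderiv ℝ (P.g t) (y t) (κ t)) (p t)) (P.dθF θ t (y t) δθ)) +
      inner ℝ (adjoint P.Q₁ (P.Q₁ (κ t))) (δ t) := by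
    rw [h2]
    -- Undoing the flip of `D_y g` writes the parameter term as `p` paired with `[D_y g κ] (D_θF
    -- δθ)`, which is the second summand of `ctrlDual`.
    simp only [inner_add_left, ContinuousLinearMap.adjoint_inner_left,
      ContinuousLinearMap.flip_apply]
    rw [real_inner_comm (κ t) (P.A θ t (y t) _), real_inner_comm (κ t) (P.dyA _ _ _ _ _),
      real_inner_comm (P.Q₁ (κ t))]
  have e3 := congrArg (fun v => inner ℝ v (δ t)) h3
  have e4 := congrArg (fun v => inner ℝ v (π t)) h4
  simp only [inner_add_left, inner_neg_left] at e2 e3 e4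
  rw [ContinuousLinearMap.adjoint_inner_left, ctrlDual, inner_add_left]
  linarith

theorem continuousOn_ctrlDual (y p ζ κ : WT P.T n) :
    ContinuousOn (ctrlDual y p ζ κ) (Icc 0 P.T) := by
  -- `g` does not depend on the parameter; `0` merely fills its slot.
  have c1 := ((P.slabDiff_g.clm_comp adjL).continuousOn_along P.T_pos 0 y).clm_apply
    (ζ.continuousOn P.T_pos)
  have c2 := (P.slabDiff_Dg.continuousOn_along P.T_pos 0 y).clm_apply (κ.continuousOn P.T_pos)
  exact c1.add ((adjL.continuous.comp_continuousOn c2).clm_apply (p.continuousOn P.T_pos))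

theorem continuousOn_θDens_tracking (θ : R) (y : WT P.T n) :
    ContinuousOn (fun t => P.mismatch θ y t • P.gradθV θ t (y t)) (Icc 0 P.T) :=
  (continuousOn_mismatch θ y).smul (P.slabDiff_gradθV.continuousOn_along P.T_pos θ y)

theorem continuousOn_θDens_control (θ : R) (y p : WT P.T n) :
    ContinuousOn (fun t =>
      (P.β * (1 - P.γ₁ * P.Φ θ y t)) • adjoint (P.dθF θ t (y t)) (P.F θ t (y t)) +
        P.γ₂ • adjoint (P.dθgradV θ t (y t)) (P.gradV θ t (y t) - p t)) (Icc 0 P.T) :=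
  ((continuousOn_const.mul (continuousOn_weight θ y)).smul
    ((continuousOn_adjoint_dθF θ y).clm_apply
      (P.slabDiff_F.continuousOn_along P.T_pos θ y))).add
    ((((P.slabDiff_dθgradV.clm_comp adjL).continuousOn_along P.T_pos θ y).clm_apply
      (continuousOn_gradV_sub θ y p)).const_smul P.γ₂)

/-- The derivative of the augmented objective along the linearised equations, expressed through
the costates. -/
theorem DobjC_eq_inner {θ δθ : R} {y p δ π ζ κ : WT P.T n}
    (hl : P.IsLinearised θ δθ y p δ π) (hc : P.IsCostate θ y p ζ κ) :
    P.DobjC ((θ, toC P.T_pos y), toC P.T_pos p) ((δθ, toC P.T_pos δ), toC P.T_pos π) =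
      inner ℝ (P.dθFeedbackAdjoint θ y (ctrlDual y p ζ κ) + P.θHat θ y p) δθ := by
  have h0 : (0 : ℝ) ∈ Icc 0 P.T := ⟨le_rfl, P.T_pos.le⟩
  have hTT : P.T ∈ Icc 0 P.T := ⟨P.T_pos.le, le_rfl⟩
  have ci : ∀ {v : ℝ → R}, ContinuousOn v (Icc 0 P.T) → IntervalIntegrable v volume 0 P.T :=
    fun hv => ContinuousOn.intervalIntegrable (by rwa [uIcc_of_le P.T_pos.le])
  have ii : ∀ a b : WT P.T n, IntervalIntegrable (fun t => inner ℝ (a.dot t) (b t)) volume 0 P.T :=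
    fun a b => intervalIntegrable_of_Ioo
      (integrableOn_inner_val P.T_pos (L2.integrableOn a.dot) b) h0 hTT
  have i1 := ci ((continuousOn_adjoint_dθF θ y).clm_apply (continuousOn_ctrlDual y p ζ κ))
  have i2 := ci (continuousOn_θDens_tracking θ y)
  have i3 := ci (continuousOn_θDens_control θ y p)
  have iW : IntervalIntegrable (fun t => adjoint (P.dθF θ t (y t)) (ctrlDual y p ζ κ t) +
    θDens θ y p t) volume 0 P.T := i1.add ((i2.smul P.γ₁).add i3)
  have eW : P.dθFeedbackAdjoint θ y (ctrlDual y p ζ κ) + P.θHat θ y p =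
      ∫ t in (0 : ℝ)..P.T, (adjoint (P.dθF θ t (y t)) (ctrlDual y p ζ κ t) + θDens θ y p t) := by
    have e := intervalIntegral.integral_add i1 ((i2.smul P.γ₁).add i3)
    have e' := intervalIntegral.integral_add (i2.smul P.γ₁) i3
    rw [dθFeedbackAdjoint, θHat, ← intervalIntegral.integral_smul]
    exact (congrArg _ e'.symm).trans e.symm
  have hint : ∫ t in (0 : ℝ)..P.T, dObj θ y p (δθ, toC P.T_pos δ) (toC P.T_pos π) t =
      ∫ t in (0 : ℝ)..P.T, (((inner ℝ (κ.dot t) (π t) + inner ℝ (π.dot t) (κ t)) -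
          (inner ℝ (ζ.dot t) (δ t) + inner ℝ (δ.dot t) (ζ t))) +
        inner ℝ δθ (adjoint (P.dθF θ t (y t)) (ctrlDual y p ζ κ t) + θDens θ y p t)) := by
    refine intervalIntegral.integral_congr_ae (ae_restrict_uIoc ?_ h0 hTT)
    filter_upwards [costate_identity hl hc, ae_restrict_mem measurableSet_Ioo] with t h ht
    rw [dObj_eq _ _ _ _ _ _ (Ioo_subset_Icc_self ht), h, inner_add_right, real_inner_comm δθ,
      real_inner_comm δθ, add_assoc]
  have hiW : IntervalIntegrable (fun t => inner ℝ δθ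
      (adjoint (P.dθF θ t (y t)) (ctrlDual y p ζ κ t) + θDens θ y p t)) volume 0 P.T :=
    ⟨(innerL δθ).integrable_comp iW.1, (innerL δθ).integrable_comp iW.2⟩
  -- At `0` the boundary terms vanish by `κ(0) = 0` and `δ(0) = 0`. At `T` the two `Q₂ᵀ Q₂` terms
  -- cancel by symmetry, and `-⟨ŷᵀ, δ(T)⟩` cancels the terminal term of `DobjC_eq_integral`.
  have b1 := WT.integral_inner_dot P.T_pos κ π
  have b2 := WT.integral_inner_dot P.T_pos ζ δ
  rw [hc.2.2.2, inner_zero_left, hl.adj_end] at b1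
  rw [hc.2.2.1, hl.state_zero, inner_zero_right, inner_add_left] at b2
  have e5 : inner ℝ (adjoint P.Q₂ (P.Q₂ (κ P.T))) (δ P.T) =
      inner ℝ (κ P.T) (adjoint P.Q₂ (P.Q₂ (δ P.T))) := by
    rw [ContinuousLinearMap.adjoint_inner_left, ContinuousLinearMap.adjoint_inner_right]
  rw [DobjC_eq_integral, dEnd_eq, hint, intervalIntegral.integral_add
    (((ii κ π).add (ii π κ)).sub ((ii ζ δ).add (ii δ ζ))) hiW,
    intervalIntegral.integral_sub ((ii κ π).add (ii π κ)) ((ii ζ δ).add (ii δ ζ)),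
    intervalIntegral.integral_add (ii κ π) (ii π κ),
    intervalIntegral.integral_add (ii ζ δ) (ii δ ζ), b1, b2, ← inner_intervalIntegral iW, ← eW,
    real_inner_comm δθ, e5]
  ring

end LearningProblem

/-! ### Part (b): smoothness and gradient of the reduced objective -/

namespace LearningProblem

open ContinuousLinearMap (adjoint)

variable {n m N : ℕ} {R : Type*} [NormedAddCommGroup R] [InnerProductSpace ℝ R]
  [FiniteDimensional ℝ R] {P : LearningProblem n m N R}

theorem contDiffOn_augmentedCost {Y Z : R → WT P.T n} {U : Set R} (hY : ContDiffOn ℝ 1 Y U)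
    (hZ : ContDiffOn ℝ 1 Z U) : ContDiffOn ℝ 1 (fun θ => P.augmentedCost (Y θ) (Z θ) θ) U := by
  have h : ContDiffOn ℝ 1 (fun θ => ((θ, toC P.T_pos (Y θ)), toC P.T_pos (Z θ))) U :=
    (contDiffOn_id.prodMk ((contDiff_intoC (toC P.T_pos)).comp_contDiffOn hY)).prodMk
      ((contDiff_intoC (toC P.T_pos)).comp_contDiffOn hZ)
  exact (P.contDiff_objC.comp_contDiffOn h).congr fun θ _ => (objC_eq θ (Y θ) (Z θ)).symm

theorem contDiffOn_reducedObjective {y p : Fin N → WT P.T n} {θ₀ : R} {U : Set R}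
    {Y Z : Fin N → R → WT P.T n} (h : P.IsParamToState y p θ₀ U Y Z) :
    ContDiffOn ℝ 1 (P.reducedObjective Y Z) U :=
  (ContDiffOn.sum fun i _ => contDiffOn_const.mul
    (contDiffOn_augmentedCost (h.state_smooth i) (h.adjoint_smooth i))).add
    (contDiff_const.mul (contDiff_norm_sq ℝ)).contDiffOn

/-- The chain rule evaluates `DobjC` at the variations of state and adjoint state. These solve the
linearised equations, so `DobjC_eq_inner` removes them in favour of the costates. -/
theorem hasFDerivAt_augmentedCost {c : Euc n} {Y Z : R → WT P.T n} {Y' Z' : R →L[ℝ] WT P.T n}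
    {θ : R} (hY : HasFDerivAt Y Y' θ) (hZ : HasFDerivAt Z Z' θ)
    (h : ∀ᶠ η in 𝓝 θ, (Y η).dot = toL2 P.T_pos (P.rhsC (η, toC P.T_pos (Y η))) ∧ Y η 0 = c ∧
      Z η = P.adjState (η, toC P.T_pos (Y η))) {ζ κ : WT P.T n}
    (hc : P.IsCostate θ (Y θ) (Z θ) ζ κ) :
    HasFDerivAt (fun η => P.augmentedCost (Y η) (Z η) η)
      (innerL (P.dθFeedbackAdjoint θ (Y θ) (ctrlDual (Y θ) (Z θ) ζ κ) +
        P.θHat θ (Y θ) (Z θ))) θ := by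
  have h1 := ((hasFDerivAt_id θ).prodMk ((hasFDerivAt_intoC (toC P.T_pos) _).comp θ hY)).prodMk
    ((hasFDerivAt_intoC (toC P.T_pos) _).comp θ hZ)
  have h2 := HasFDerivAt.comp (g := P.objC) θ
    (P.hasFDerivAt_objC ((θ, toC P.T_pos (Y θ)), toC P.T_pos (Z θ))) h1
  have h3 : (fun η => P.augmentedCost (Y η) (Z η) η) =
      P.objC ∘ fun η => ((η, toC P.T_pos (Y η)), toC P.T_pos (Z η)) :=
    funext fun η => (objC_eq η (Y η) (Z η)).symm
  rw [h3]
  refine h2.congr_fderiv (ContinuousLinearMap.ext fun δθ => ?_)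
  exact DobjC_eq_inner (isLinearised_fderiv hY hZ h δθ) hc

theorem hasGradientAt_reducedObjective {y p : Fin N → WT P.T n} {θ₀ : R} {U : Set R}
    {Y Z : Fin N → R → WT P.T n} (h : P.IsParamToState y p θ₀ U Y Z) {θ : R} (hθ : θ ∈ U)
    {ζ κ : Fin N → WT P.T n} (hc : ∀ i, P.IsCostate θ (Y i θ) (Z i θ) (ζ i) (κ i)) :
    HasGradientAt (P.reducedObjective Y Z)
      (P.gradientFormula θ (fun i => Y i θ) (fun i => Z i θ) ζ κ) θ := by
  have hU : U ∈ 𝓝 θ := h.isOpen.mem_nhds hθ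
  have h1 : ∀ i, HasFDerivAt (fun η => P.augmentedCost (Y i η) (Z i η) η)
      (innerL (P.dθFeedbackAdjoint θ (Y i θ) (ctrlDual (Y i θ) (Z i θ) (ζ i) (κ i)) +
        P.θHat θ (Y i θ) (Z i θ))) θ := fun i =>
    hasFDerivAt_augmentedCost
      ((((h.state_smooth i).contDiffAt hU).differentiableAt one_ne_zero).hasFDerivAt)
      ((((h.adjoint_smooth i).contDiffAt hU).differentiableAt one_ne_zero).hasFDerivAt)
      -- Only differentiability at `θ` and the equations on the open set `U` enter, so the formula
      -- holds for any choice of solution maps, not just the constructed ones.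
      (Filter.eventually_of_mem hU fun η hη => isStateAdjoint_iff.1 (h.solves i η hη)) (hc i)
  have h2 := (HasFDerivAt.fun_sum fun (i : Fin N) (_ : i ∈ Finset.univ) =>
    (h1 i).const_mul (P.wt i)).add ((hasFDerivAt_half_norm_sq θ).const_mul P.γ)
  rw [hasGradientAt_iff_hasFDerivAt]
  have e : P.reducedObjective Y Z = fun η =>
      (∑ i, P.wt i * P.augmentedCost (Y i η) (Z i η) η) + P.γ * (1 / 2 * ‖η‖ ^ 2) := by
    funext η
    rw [reducedObjective]
    ring
  rw [e]
  refine h2.congr_fderiv (ContinuousLinearMap.ext fun δθ => ?_)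
  rw [InnerProductSpace.toDual_apply_apply, gradientFormula, inner_add_left, sum_inner, add_apply,
    sum_apply, smul_apply, innerL_apply, real_inner_smul_left]
  congr 1
  refine Finset.sum_congr rfl fun i _ => ?_
  rw [smul_apply, innerL_apply, real_inner_smul_left]
  rfl

end LearningProblem

end LearnFeedback

end

/-! ### The theorem -/

theorem mainTheorem10 {n m N : ℕ} {R : Type*} [NormedAddCommGroup R] [InnerProductSpace ℝ R]
    [FiniteDimensional ℝ R] (P : LearnFeedback.LearningProblem n m N R)
    (y p : Fin N → LearnFeedback.WT P.T n) (θ₀ : R)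
    (hadm : ∀ i, P.IsStateAdjoint i θ₀ (y i) (p i)) :
    (∃ (U : Set R) (Y Z : Fin N → R → LearnFeedback.WT P.T n),
      P.IsParamToState y p θ₀ U Y Z) ∧
    ∀ (U : Set R) (Y Z : Fin N → R → LearnFeedback.WT P.T n),
      P.IsParamToState y p θ₀ U Y Z →
        ContDiffOn ℝ 1 (P.reducedObjective Y Z) U ∧
        ∀ θ ∈ U,
          (∀ i, ∃! ζκ : LearnFeedback.WT P.T n × LearnFeedback.WT P.T n,
            P.IsCostate θ (Y i θ) (Z i θ) ζκ.1 ζκ.2) ∧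
          ∀ ζ κ : Fin N → LearnFeedback.WT P.T n,
            (∀ i, P.IsCostate θ (Y i θ) (Z i θ) (ζ i) (κ i)) →
              HasGradientAt (P.reducedObjective Y Z)
                (P.gradientFormula θ (fun i => Y i θ) (fun i => Z i θ) ζ κ) θ := by
  exact ⟨LearnFeedback.LearningProblem.exists_isParamToState y p θ₀ hadm, fun U Y Z h =>
    ⟨LearnFeedback.LearningProblem.contDiffOn_reducedObjective h, fun θ hθ =>
      ⟨fun i => LearnFeedback.LearningProblem.existsUnique_isCostate θ (Y i θ) (Z i θ),
        fun _ _ hc => LearnFeedback.LearningProblem.hasGradientAt_reducedObjective h hθ hc⟩⟩⟩
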